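/- Let $k>1$, let $\chi$ be a primitive Dirichlet character mod $k$, and let $a\in\{0,1\}$ be its parity, $\chi(-1)=(-1)^a$. Let $G(\chi)=\sum_{m=1}^{k}\chi(m)e^{2\pi i m/k}$, with $\arg G(\chi)$ the principal value, and $$\vartheta_{k,a}(t)=\arg\Gamma\left(\tfrac14+\tfrac a2+\tfrac{it}{2}\right)-\tfrac t2\log\tfrac{\pi}{k},$$ where $\arg\Gamma$ is continuous in $t$ and vanishes at $t=0$. For real $\sigma,t$ let $\arg L(\sigma+it,\chi)$ be obtained by continuous variation along the horizontal half-line from $+\infty+it$, where the argument is $0$; it is defined only if $L(\cdot,\chi)$ has no zero on $[\sigma,\infty)+it$. For $n\in\mathbb Z$ say that $t\in\mathbb R$ solves equation $E(n)$ if $\lim_{\delta\to0^+}\arg L(\tfrac12+\delta+it,\chi)$ exists and $$\vartheta_{k,a}(t)+\lim_{\delta\to0^+}\arg L\left(\tfrac12+\delta+it,\chi\right)-\tfrac12\arg G(\chi)=\left(n-\tfrac12-\tfrac a4\right)\pi .$$ For $T>0$ let $N^{+}(T,\chi)$ (resp. $N^-(T,\chi)$) be the number of zeros of $L(s,\chi)$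 with $0<\Re s<1$ and $0<\Im s<T$ (resp. $-T<\Im s<0$), and $N_0^{\pm}(T,\chi)$ the number of those with $\Re s=\tfrac12$, all counted with multiplicity. Consider the two assumptions: (A) $\lim_{\delta\to0^+}\arg L(\tfrac12+\delta+it,\chi)$ exists for every $t\in\mathbb R$; (U) for every $n\in\mathbb Z$, $E(n)$ has a unique solution. Then: 1. $L(\tfrac12+it,\chi)=0$ for infinitely many $t>0$ and for infinitely many $t<0$. 2. If the limit $\lim_{\delta\to0^+}\arg L(\tfrac12+\delta+it,\chi)$ exists, then $t$ solves $E(n)$ for some $n\in\mathbb Z$ if and only if $\tfrac12+it$ is a zero of $L(s,\chi)$ of odd order. In particular, solutions are zeros, and simple zeros are solutions. 3. For every $n\in\mathbb Z$, $E(n)$ has at most one solution. 4. (U) holds if and only if (A) holds and all zeros of $L(s,\chi)$ on the line $\Re s=\tfrac12$ are simple. 5. There is an integer $n_0$ (depending on $\chi$) such that: (i) If (A) holds then, for all $T>0$, $N_0^{+}(T,\chi)=N^{+}(T,\chi)$ and $N_0^-(T,\chi)=N^-(T,\chi)$. If moreover $L(\tfrac12+iT,\chi)\ne0$, then $$N_0^+(T,\chi)=\tfrac1\pi\vartheta_{k,a}(T)+\tfrac1\pi\arg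 L(\tfrac12+iT,\chi)-\tfrac1{2\pi}\arg G(\chi)+\tfrac a4+n_0 ,$$ and if $L(\tfrac12,\chi)\neq0$ and $L(\tfrac12-iT,\chi)\ne0$, then $$N_0^-(T,\chi)=\tfrac1\pi\vartheta_{k,a}(T)-\tfrac1\pi\arg L(\tfrac12-iT,\chi)+\tfrac1{2\pi}\arg G(\chi)-\tfrac a4-n_0 .$$ (ii) If (U) holds, then there is a strictly increasing sequence $(t_n)_{n\in\mathbb Z}$ of real numbers, with $t_n>0$ if and only if $n\ge1$, such that for every $n$ the number $t_n$ is the one and only solution of $E(n-n_0)$; the zeros of $L(s,\chi)$ in $0<\Re s<1$ are exactly the points $\tfrac12+it_n$, $n\in\mathbb Z$, and all of them are simple; and $N_0^{+}(T,\chi)=\#\{n:0<t_n<T\}$ and $N_0^{-}(T,\chi)=\#\{n:-T<t_n<0\}$ for all $T>0$. -/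

import Mathlib

open Filter Topology

noncomputable section

namespace DirichletZeros

/-- The parity `a` of a Dirichlet character: `1` if `χ (-1) = -1` (odd), `0` otherwise (even). -/
def parity {k : ℕ} (χ : DirichletCharacter ℂ k) : ℕ :=
  open Classical in if χ (-1) = -1 then 1 else 0

/-- The continuous argument of `t ↦ Γ (c + i t / 2)` that vanishes at `t = 0`, obtained by
integrating the derivative `Re ψ (c + i u / 2) / 2` of `Im log Γ (c + i u / 2)`, where
`ψ = Γ' / Γ` is the digamma function. See `continuous_argGamma`, `argGamma_zero` and
`Gamma_eq_norm_mul_exp_argGamma`, which determine this function uniquely. -/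
def argGamma (c t : ℝ) : ℝ :=
  ∫ u in (0 : ℝ)..t, (Complex.digamma (c + Complex.I * (u / 2))).re / 2

/-- `ϑ_{k,a}(t) = arg Γ (1/4 + a/2 + i t/2) - (t/2) log (π/k)`. -/
def thetaRS (k a : ℕ) (t : ℝ) : ℝ :=
  argGamma (1 / 4 + a / 2) t - t / 2 * Real.log (Real.pi / k)

/-- The Gauss sum `G(χ) = ∑_{m mod k} χ(m) exp(2 π i m / k)`. -/
def gauss {k : ℕ} [NeZero k] (χ : DirichletCharacter ℂ k) : ℂ :=
  gaussSum χ ZMod.stdAddChar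

/-- `HasArgLimit χ t ℓ` says that `lim_{δ → 0+} arg L(1/2 + δ + i t, χ)` exists and equals `ℓ`.
Here `arg L(σ + i t, χ)` is defined by continuous variation along the horizontal half-line
from `∞ + i t` (where `L = 1` and `arg L = 0`) to `σ + i t`; it is defined only if `L` has no
zero on the way. The function `g` is `σ ↦ arg L(σ + i t, χ)`. -/
def HasArgLimit {k : ℕ} [NeZero k] (χ : DirichletCharacter ℂ k) (t ℓ : ℝ) : Prop :=
  ∃ g : ℝ → ℝ, ContinuousOn g (Set.Ioi (1 / 2)) ∧
    (∀ σ : ℝ, 1 / 2 < σ → χ.LFunction (σ + t * Complex.I) ≠ 0 ∧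
      χ.LFunction (σ + t * Complex.I) =
        ‖χ.LFunction (σ + t * Complex.I)‖ * Complex.exp (g σ * Complex.I)) ∧
    Tendsto g atTop (𝓝 0) ∧
    Tendsto g (𝓝[>] (1 / 2)) (𝓝 ℓ)

/-- The real number `t` solves the exact equation with index `n`: the limit
`ℓ = lim_{δ → 0+} arg L(1/2 + δ + i t, χ)` exists and
`ϑ_{k,a}(t) + ℓ - arg G(χ) / 2 = (n - 1/2 - a/4) π` (principal value of `arg G(χ)`). -/
def IsSolution {k : ℕ} [NeZero k] (χ : DirichletCharacter ℂ k) (n : ℤ) (t : ℝ) : Prop :=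
  ∃ ℓ : ℝ, HasArgLimit χ t ℓ ∧
    thetaRS k (parity χ) t + ℓ - (gauss χ).arg / 2 =
      (n - 1 / 2 - (parity χ : ℝ) / 4) * Real.pi

/-- The point `1/2 + i t` of the critical line. -/
def linePoint (t : ℝ) : ℂ := 1 / 2 + t * Complex.I

/-- The number of zeros of `L(s, χ)` in `S`, counted with multiplicity. -/
def zeroCount {k : ℕ} [NeZero k] (χ : DirichletCharacter ℂ k) (S : Set ℂ) : ℕ :=
  ∑ᶠ s ∈ S, analyticOrderNatAt χ.LFunction s

/-- `N^+(T, χ)`: zeros with `0 < σ < 1` and `0 < t < T`. -/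
def stripCountPos {k : ℕ} [NeZero k] (χ : DirichletCharacter ℂ k) (T : ℝ) : ℕ :=
  zeroCount χ {s | 0 < s.re ∧ s.re < 1 ∧ 0 < s.im ∧ s.im < T}

/-- `N^-(T, χ)`: zeros with `0 < σ < 1` and `-T < t < 0`. -/
def stripCountNeg {k : ℕ} [NeZero k] (χ : DirichletCharacter ℂ k) (T : ℝ) : ℕ :=
  zeroCount χ {s | 0 < s.re ∧ s.re < 1 ∧ -T < s.im ∧ s.im < 0}

/-- `N_0^+(T, χ)`: zeros with `σ = 1/2` and `0 < t < T`. -/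
def lineCountPos {k : ℕ} [NeZero k] (χ : DirichletCharacter ℂ k) (T : ℝ) : ℕ :=
  zeroCount χ {s | s.re = 1 / 2 ∧ 0 < s.im ∧ s.im < T}

/-- `N_0^-(T, χ)`: zeros with `σ = 1/2` and `-T < t < 0`. -/
def lineCountNeg {k : ℕ} [NeZero k] (χ : DirichletCharacter ℂ k) (T : ℝ) : ℕ :=
  zeroCount χ {s | s.re = 1 / 2 ∧ -T < s.im ∧ s.im < 0}

/-- The limit `lim_{δ → 0+} arg L(1/2 + δ + i t, χ)` exists for every real `t`. -/
def ArgLimitExists {k : ℕ} [NeZero k] (χ : DirichletCharacter ℂ k) : Prop :=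
  ∀ t : ℝ, ∃ ℓ : ℝ, HasArgLimit χ t ℓ

/-- Every exact equation, `n ∈ ℤ`, has a unique real solution. -/
def UniquelySolvable {k : ℕ} [NeZero k] (χ : DirichletCharacter ℂ k) : Prop :=
  ∀ n : ℤ, ∃! t : ℝ, IsSolution χ n t

/-- All zeros on the critical line are simple. -/
def SimpleOnLine {k : ℕ} [NeZero k] (χ : DirichletCharacter ℂ k) : Prop :=
  ∀ t : ℝ, χ.LFunction (linePoint t) = 0 → analyticOrderNatAt χ.LFunction (linePoint t) = 1

lemma argGamma_zero (c : ℝ) : argGamma c 0 = 0 := by simp [argGamma]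

lemma analyticAt_Gamma_of_re_pos {s : ℂ} (hs : 0 < s.re) : AnalyticAt ℂ Complex.Gamma s := by
  refine DifferentiableOn.analyticAt (s := {z : ℂ | 0 < z.re}) ?_ ?_
  · intro z hz
    refine (Complex.differentiableAt_Gamma z ?_).differentiableWithinAt
    rintro m rfl
    have : (0 : ℝ) < (-(m : ℂ)).re := hz
    simp at this
    have h2 : (0 : ℝ) ≤ m := Nat.cast_nonneg m
    linarith
  · exact (isOpen_lt continuous_const Complex.continuous_re).mem_nhds hs

lemma continuous_digamma_line {c : ℝ} (hc : 0 < c) :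
    Continuous fun u : ℝ => Complex.digamma (c + Complex.I * (u / 2)) := by
  rw [continuous_iff_continuousAt]
  intro u
  have hre : 0 < ((c : ℂ) + Complex.I * (u / 2)).re := by simpa using hc
  have hA := analyticAt_Gamma_of_re_pos hre
  have hd : ContinuousAt Complex.digamma ((c : ℂ) + Complex.I * (u / 2)) := by
    rw [Complex.digamma_def]
    exact hA.deriv.continuousAt.div hA.continuousAt (Complex.Gamma_ne_zero_of_re_pos hre)
  have hl : ContinuousAt (fun u : ℝ => (c : ℂ) + Complex.I * (u / 2)) u := by fun_prop
  exact ContinuousAt.comp (f := fun u : ℝ => (c : ℂ) + Complex.I * (u / 2)) hd hl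

lemma continuous_argGamma {c : ℝ} (hc : 0 < c) : Continuous (argGamma c) := by
  have h : Continuous fun u : ℝ => (Complex.digamma (c + Complex.I * (u / 2))).re / 2 :=
    (Complex.continuous_re.comp (continuous_digamma_line hc)).div_const 2
  exact intervalIntegral.continuous_primitive (fun a b => h.intervalIntegrable a b) 0

/-- `argGamma c t` is an argument of `Γ (c + i t / 2)`. -/
lemma Gamma_eq_norm_mul_exp_argGamma {c : ℝ} (hc : 0 < c) (t : ℝ) :
    Complex.Gamma (c + Complex.I * (t / 2)) =
      ‖Complex.Gamma (c + Complex.I * (t / 2))‖ * Complex.exp (argGamma c t * Complex.I) := by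
  set f : ℝ → ℂ := fun u => Complex.digamma (c + Complex.I * (u / 2)) * (Complex.I / 2) with hf
  have hfc : Continuous f := (continuous_digamma_line hc).mul continuous_const
  set F : ℝ → ℂ := fun t => ∫ u in (0 : ℝ)..t, f u with hF
  have hFd : ∀ x, HasDerivAt F (f x) x := fun x =>
    intervalIntegral.integral_hasDerivAt_right (hfc.intervalIntegrable _ _)
      hfc.aestronglyMeasurable.stronglyMeasurableAtFilter hfc.continuousAt
  have hl : ∀ x : ℝ,
      HasDerivAt (fun u : ℝ => (c : ℂ) + Complex.I * (u / 2)) (Complex.I / 2) x := by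
    intro x
    have := (((hasDerivAt_id x).ofReal_comp.div_const (2 : ℂ)).const_mul Complex.I).const_add
      (c : ℂ)
    simpa [div_eq_mul_inv] using this
  have hG : ∀ x : ℝ, HasDerivAt (fun u : ℝ => Complex.Gamma (c + Complex.I * (u / 2)))
      (Complex.Gamma (c + Complex.I * (x / 2)) * f x) x := by
    intro x
    have hre : 0 < ((c : ℂ) + Complex.I * (x / 2)).re := by simpa using hc
    have h1 := (analyticAt_Gamma_of_re_pos hre).differentiableAt.hasDerivAt
    have h2 := HasDerivAt.comp (h := fun u : ℝ => (c : ℂ) + Complex.I * (u / 2)) x h1 (hl x)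
    refine h2.congr_deriv ?_
    have hne := Complex.Gamma_ne_zero_of_re_pos hre
    simp only [hf, Complex.digamma_def, logDeriv_apply]
    rw [← mul_assoc, mul_div_cancel₀ _ hne]
  have hconst : ∀ x : ℝ, HasDerivAt
      (fun u : ℝ => Complex.Gamma (c + Complex.I * (u / 2)) * Complex.exp (-F u)) 0 x := by
    intro x
    refine ((hG x).mul ((hFd x).neg.cexp)).congr_deriv ?_
    simp only [Pi.neg_apply]
    ring
  have hkey := is_const_of_deriv_eq_zero (fun x => (hconst x).differentiableAt)
    (fun x => (hconst x).deriv) t 0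
  have hF0 : F 0 = 0 := by simp [hF]
  have hGc : Complex.Gamma (c : ℂ) = (Real.Gamma c : ℂ) := Complex.Gamma_ofReal c
  have hpos := Real.Gamma_pos_of_pos hc
  have him : (F t).im = argGamma c t := by
    have := Complex.imCLM.intervalIntegral_comp_comm (hfc.intervalIntegrable (μ := MeasureTheory.volume) 0 t)
    change _ = (∫ u in (0 : ℝ)..t, f u).im at this
    rw [hF, ← this, argGamma]
    congr 1
    funext u
    simp [hf, Complex.mul_im]
    ring
  have heq : Complex.Gamma (c + Complex.I * (t / 2)) = Real.Gamma c * Complex.exp (F t) := by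
    simp only [hF0] at hkey
    have h0 : ((c : ℂ) + Complex.I * (((0 : ℝ) : ℂ) / 2)) = c := by simp
    rw [h0, hGc, neg_zero, Complex.exp_zero, mul_one] at hkey
    rw [← hkey, mul_assoc, ← Complex.exp_add]
    simp
  rw [heq, norm_mul, Complex.norm_exp, Complex.norm_real, Real.norm_of_nonneg hpos.le, ← him]
  conv_lhs => rw [← Complex.re_add_im (F t), Complex.exp_add]
  push_cast
  ring

end DirichletZeros

end

noncomputable section

namespace DirichletZeros

open Complex ComplexConjugate

set_option linter.unusedSectionVars false

variable {k : ℕ} [NeZero k] {χ : DirichletCharacter ℂ k}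

/-! Complete the L-function to `xi`, with a unimodular factor chosen so that the functional equation
makes `xi` real on the critical line. In polar form its angle there is `totalArg`, that is ϑ + ℓ −
arg G / 2 + aπ/4 with ℓ the boundary value of arg L. Where L does not vanish this angle lies in πℤ,
whereas E(n) asks for the value (n − 1/2)π.

The carrying lemma is `exists_totalArg_eq`: wherever it is defined, the total argument is π times an
integer plus a step function of the height. Dividing L by its finitely many zeros in a half-strip
leaves a nonvanishing function on a convex set, hence a continuous logarithm
(`exists_continuous_arg`). So only the principal arguments of 1/2 + iu − ρ can jump, and integrality
forces the rest to be constant. A zero of order m contributes a jump mπ if it lies on the line, 2mπ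
if to the right, none if to the left, and a zero on the line has received half its jump at its own
height.

Hence the total argument is nondecreasing, it is a half-odd multiple of π exactly at zeros of odd
order, and each E(n) has at most one solution. Between solutions of E(n) and E(n+1) the increase π
is used up by the two half-jumps at the ends, so these zeros are simple and no zero with real part ≥
1/2 lies strictly between (`IsSolution.consecutive`). Conversely (A) says that nothing vanishes to
the right of the line (`argLimitExists_iff`). If moreover all zeros on the line are simple, the
total argument rises by exactly π from each zero to the next, so every index is reached once there
are infinitely many zeros in both directions. The counting formulas compare the heights T or −T with
a height just above 0. The symmetry s ↦ 1 − conj s puts every zero of the strip on the line.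

The infinitude of zeros is Hardy's theorem (`infinite_zeros_pos`). If `xi` had constant sign from
some height on, the integral of |xi| e^{(π/4−δ)t} there would be bounded by the oscillatory integral
over the whole line. Moved to Re s = 2, the latter becomes a theta-like series, which is O(δ^{-(5/8
+ a/2)}). With δ = 1/T and the Gamma factor stripped off, this gives O(T^{7/8}) for the first moment
of |L| on [T, 2T], against a lower bound of order T from a contour integral. -/

/-! ### Zeros, orders and conjugation of the L-function. -/

lemma ne_one_of_isPrimitive (hk : 1 < k) (hχ : χ.IsPrimitive) : χ ≠ 1 := by
  rintro rfl
  have : DirichletCharacter.conductor (1 : DirichletCharacter ℂ k) = k := hχ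
  rw [DirichletCharacter.conductor_one] at this
  omega

lemma analyticOnNhd_LFunction (hχ : χ ≠ 1) : AnalyticOnNhd ℂ χ.LFunction Set.univ :=
  (DirichletCharacter.differentiable_LFunction hχ).differentiableOn.analyticOnNhd isOpen_univ

lemma LFunction_two_ne_zero (hχ : χ ≠ 1) : χ.LFunction 2 ≠ 0 :=
  χ.LFunction_ne_zero_of_one_le_re (.inl hχ) (by simp)

lemma finite_zeros_of_isCompact (hχ : χ ≠ 1) {K : Set ℂ} (hK : IsCompact K) :
    (K ∩ {s | χ.LFunction s = 0}).Finite := by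
  have h := (analyticOnNhd_LFunction hχ).preimage_zero_mem_codiscrete (LFunction_two_ne_zero hχ)
  have h2 := mem_codiscrete'.mp h
  have h3 : (χ.LFunction ⁻¹' {0}ᶜ)ᶜ = {s | χ.LFunction s = 0} := by ext; simp
  rw [h3] at h2
  have hcl : IsClosed {s | χ.LFunction s = 0} :=
    isClosed_eq (DirichletCharacter.differentiable_LFunction hχ).continuous continuous_const
  exact (hK.inter_right hcl).finite (h2.2.mono Set.inter_subset_right)

lemma analyticOrderAt_LFunction_ne_top (hχ : χ ≠ 1) (s : ℂ) :
    analyticOrderAt χ.LFunction s ≠ ⊤ := by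
  intro h
  rw [analyticOrderAt_eq_top] at h
  have := (analyticOnNhd_LFunction hχ).eqOn_zero_of_preconnected_of_eventuallyEq_zero
    isPreconnected_univ (Set.mem_univ s) h
  exact LFunction_two_ne_zero hχ (this (Set.mem_univ 2))

lemma order_ne_zero_iff (hχ : χ ≠ 1) (s : ℂ) :
    analyticOrderNatAt χ.LFunction s ≠ 0 ↔ χ.LFunction s = 0 := by
  rw [← not_iff_not, not_not, ← Nat.cast_inj (R := ℕ∞),
    Nat.cast_analyticOrderNatAt (analyticOrderAt_LFunction_ne_top hχ s), Nat.cast_zero,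
    ((analyticOnNhd_LFunction hχ) s trivial).analyticOrderAt_eq_zero]

/-- Conjugating the coefficients of the Dirichlet series replaces χ by χ⁻¹. The identity theorem
carries this from Re s > 1 to the whole plane. -/
lemma LFunction_inv_conj (hχ : χ ≠ 1) (s : ℂ) :
    χ⁻¹.LFunction (conj s) = conj (χ.LFunction s) := by
  have hχ' : χ⁻¹ ≠ 1 := inv_ne_one.mpr hχ
  have hd : Differentiable ℂ (fun s => conj (χ⁻¹.LFunction (conj s))) := by
    intro z
    have := ((DirichletCharacter.differentiable_LFunction hχ') (conj z)).conj_conj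
    simpa [Function.comp_def] using this
  have hE := (hd.differentiableOn.analyticOnNhd isOpen_univ).eqOn_of_preconnected_of_eventuallyEq
    (analyticOnNhd_LFunction hχ) isPreconnected_univ (Set.mem_univ 2) ?_
  · have := hE (Set.mem_univ s)
    simp only at this
    rw [← this, conj_conj]
  · have hopen : {z : ℂ | 1 < z.re} ∈ 𝓝 (2 : ℂ) :=
      (isOpen_lt continuous_const continuous_re).mem_nhds (by simp)
    filter_upwards [hopen] with z hz
    rw [χ.LFunction_eq_LSeries hz, χ⁻¹.LFunction_eq_LSeries (by simpa using hz), LSeries, LSeries,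
      conj_tsum]
    refine tsum_congr fun n => ?_
    rcases eq_or_ne n 0 with rfl | hn
    · simp
    · rw [LSeries.term_of_ne_zero hn, LSeries.term_of_ne_zero hn, map_div₀]
      congr 1
      · rw [← MulChar.star_eq_inv]
        simp
      · have := cpow_conj (n : ℂ) z (by rw [natCast_arg]; exact Real.pi_pos.ne)
        rw [conj_natCast] at this
        rw [this, conj_conj]

lemma LFunction_inv_eq_conj (hχ : χ ≠ 1) (s : ℂ) :
    χ⁻¹.LFunction s = conj (χ.LFunction (conj s)) := by
  rw [← LFunction_inv_conj hχ, conj_conj]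

/-! ### The completed L-function and its reality on the critical line. -/

lemma parity_eq_zero (h : χ.Even) : parity χ = 0 := by
  have : χ (-1) = 1 := h
  simp only [parity, this]
  rw [if_neg]
  norm_num

lemma parity_eq_one (h : χ.Odd) : parity χ = 1 := by
  have : χ (-1) = -1 := h
  simp [parity, this]

lemma gammaFactor_eq (χ : DirichletCharacter ℂ k) (s : ℂ) :
    χ.gammaFactor s = (Real.pi : ℂ) ^ (-(s + parity χ) / 2) * Gamma ((s + parity χ) / 2) := by
  rcases χ.even_or_odd with h | h
  · rw [h.gammaFactor_def, parity_eq_zero h, Gammaℝ_def]; simp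
  · rw [h.gammaFactor_def, parity_eq_one h, Gammaℝ_def]; simp

/-- The unimodular constant that makes the completed `L`-function real on the critical line. -/
def phase (χ : DirichletCharacter ℂ k) : ℂ :=
  exp ((parity χ * Real.pi / 4 - (gauss χ).arg / 2 : ℝ) * I)

/-- The completed `L`-function, normalised to be real on the critical line. -/
def xi (χ : DirichletCharacter ℂ k) (s : ℂ) : ℂ :=
  phase χ * exp ((s - 1 / 2) / 2 * Real.log (k / Real.pi)) * Gamma ((s + parity χ) / 2) *
    χ.LFunction s

lemma re_add_parity_pos {s : ℂ} (hs : 0 < s.re) : 0 < ((s + parity χ) / 2).re := by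
  have : (0 : ℝ) ≤ parity χ := Nat.cast_nonneg _
  simp
  positivity

lemma xi_eq_zero_iff {s : ℂ} (hs : 0 < s.re) : xi χ s = 0 ↔ χ.LFunction s = 0 := by
  simp [xi, phase, exp_ne_zero, Gamma_ne_zero_of_re_pos (re_add_parity_pos (χ := χ) hs)]

/-- Supplies a point at which the functional equation on the line can be divided by L, as needed for
`norm_rootNumber`. -/
lemma exists_line_ne_zero (hχ : χ ≠ 1) : ∃ t : ℝ, χ.LFunction (linePoint t) ≠ 0 := by
  by_contra! h
  have hc : IsCompact (linePoint '' Set.Icc 0 1) :=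
    isCompact_Icc.image (by unfold linePoint; fun_prop)
  have hf := finite_zeros_of_isCompact hχ hc
  have hinj : Function.Injective linePoint := by
    intro x y hxy
    have := congrArg im hxy
    simpa [linePoint] using this
  have : linePoint '' Set.Icc 0 1 ∩ {s | χ.LFunction s = 0} = linePoint '' Set.Icc 0 1 := by
    apply Set.inter_eq_left.mpr
    rintro _ ⟨t, -, rfl⟩
    exact h t
  rw [this, Set.finite_image_iff hinj.injOn] at hf
  exact (Set.Icc_infinite zero_lt_one) hf

lemma gamma_mul_LFunction (hk : 1 < k) {s : ℂ} (hs : 0 < s.re) :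
    χ.completedLFunction s =
      (Real.pi : ℂ) ^ (-(s + parity χ) / 2) * Gamma ((s + parity χ) / 2) * χ.LFunction s := by
  rw [← gammaFactor_eq, χ.LFunction_eq_completed_div_gammaFactor s (.inr hk.ne'), mul_div_cancel₀]
  rw [gammaFactor_eq]
  refine mul_ne_zero ?_ (Gamma_ne_zero_of_re_pos (re_add_parity_pos hs))
  rw [Ne, cpow_eq_zero_iff]
  simp [Real.pi_ne_zero]

lemma parity_inv (χ : DirichletCharacter ℂ k) : parity χ⁻¹ = parity χ := by
  have : χ⁻¹ (-1) = (χ (-1))⁻¹ := by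
    rw [← MulChar.star_eq_inv]
    rcases χ.even_or_odd with h | h
    · have h1 : χ (-1) = 1 := h
      simp [h1]
    · have h1 : χ (-1) = -1 := h
      simp [h1]
  rcases χ.even_or_odd with h | h
  · have h1 : χ (-1) = 1 := h
    rw [parity_eq_zero h, parity_eq_zero]; rw [DirichletCharacter.Even, this, h1]; simp
  · have h1 : χ (-1) = -1 := h
    rw [parity_eq_one h, parity_eq_one]; rw [DirichletCharacter.Odd, this, h1]; norm_num

/-- The powers of π and k in the symmetric functional equation merge into one exponential. Inside
the open strip both Gamma arguments have positive real part, so the gamma factors can be cleared. -/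
lemma functional_equation (hk : 1 < k) (hχ : χ.IsPrimitive) {s : ℂ} (hs : 0 < s.re)
    (hs1 : s.re < 1) :
    Gamma ((s + parity χ) / 2) * χ.LFunction s =
      exp ((1 / 2 - s) * Real.log (k / Real.pi)) * χ.rootNumber *
        (Gamma ((1 - s + parity χ) / 2) * χ⁻¹.LFunction (1 - s)) := by
  have h := hχ.completedLFunction_one_sub (1 - s)
  have hpi : (Real.pi : ℂ) ≠ 0 := ofReal_ne_zero.mpr Real.pi_ne_zero
  have hk0 : (k : ℂ) ≠ 0 := Nat.cast_ne_zero.mpr (NeZero.ne k)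
  rw [sub_sub_cancel, gamma_mul_LFunction hk hs, gamma_mul_LFunction hk (by simpa using hs1),
    parity_inv, cpow_def_of_ne_zero hpi, cpow_def_of_ne_zero hpi, cpow_def_of_ne_zero hk0,
    ← ofReal_log Real.pi_pos.le, ← natCast_log] at h
  rw [Real.log_div (by exact_mod_cast NeZero.ne k) Real.pi_ne_zero]
  have he := exp_ne_zero (Real.log Real.pi * (-(s + parity χ) / 2))
  rw [mul_assoc] at h
  apply mul_left_cancel₀ he
  rw [h]
  have : exp (Real.log k * (1 - s - 1 / 2)) * χ.rootNumber *
      (exp (Real.log Real.pi * (-(1 - s + parity χ) / 2)) * Gamma ((1 - s + parity χ) / 2) *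
        χ⁻¹.LFunction (1 - s)) =
      (exp (Real.log k * (1 - s - 1 / 2)) * exp (Real.log Real.pi * (-(1 - s + parity χ) / 2))) *
        (χ.rootNumber * (Gamma ((1 - s + parity χ) / 2) * χ⁻¹.LFunction (1 - s))) := by ring
  rw [this, ← exp_add]
  have e2 : Real.log k * (1 - s - 1 / 2) + Real.log Real.pi * (-(1 - s + parity χ) / 2) =
      Real.log Real.pi * (-(s + parity χ) / 2) +
        (1 / 2 - s) * ((Real.log k - Real.log Real.pi : ℝ) : ℂ) := by
    push_cast; ring
  rw [e2, exp_add]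
  ring

lemma norm_rootNumber (hk : 1 < k) (hχ : χ.IsPrimitive) : ‖χ.rootNumber‖ = 1 := by
  have h1 := ne_one_of_isPrimitive hk hχ
  obtain ⟨t, ht⟩ := exists_line_ne_zero h1
  have hre : (linePoint t).re = 1 / 2 := by simp [linePoint]
  have hG : Gamma ((linePoint t + parity χ) / 2) ≠ 0 :=
    Gamma_ne_zero_of_re_pos (re_add_parity_pos (by rw [hre]; norm_num))
  have h := functional_equation hk hχ (s := linePoint t) (by rw [hre]; norm_num)
    (by rw [hre]; norm_num)
  have hc : 1 - linePoint t = conj (linePoint t) := by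
    apply Complex.ext
    · simp [linePoint]; norm_num
    · simp [linePoint]
  have hc2 : (1 - linePoint t + parity χ) / 2 = conj ((linePoint t + parity χ) / 2) := by
    rw [hc, map_div₀, map_add, map_natCast, map_ofNat]
  rw [hc2, hc, LFunction_inv_conj h1, Gamma_conj, ← map_mul] at h
  have hn := congrArg norm h
  rw [norm_mul (_ * _), norm_mul (exp _), norm_exp, RCLike.norm_conj] at hn
  have : ((1 / 2 - linePoint t) * (Real.log (k / Real.pi) : ℂ)).re = 0 := by
    simp [linePoint]
  rw [this, Real.exp_zero, one_mul] at hn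
  have hne := norm_ne_zero_iff.mpr (mul_ne_zero hG ht)
  exact mul_right_cancel₀ hne (by rw [← hn, one_mul])

/-- The root number is G / (i^a √k) with |G| = √k, hence equals exp(i(arg G − aπ/2)); the phase was
defined as the square root of its inverse. -/
lemma phase_sq_mul_rootNumber (hk : 1 < k) (hχ : χ.IsPrimitive) :
    phase χ ^ 2 * χ.rootNumber = 1 := by
  have hn := norm_rootNumber hk hχ
  have hkn : ‖(k : ℂ) ^ (1 / 2 : ℂ)‖ = (k : ℝ) ^ (1 / 2 : ℝ) := by
    rw [norm_natCast_cpow_of_pos (NeZero.pos k)]; simp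
  have hroot : χ.rootNumber =
      gauss χ / exp (parity χ * Real.pi / 2 * I) / (k : ℂ) ^ (1 / 2 : ℂ) := by
    rw [DirichletCharacter.rootNumber, gauss]
    rcases χ.even_or_odd with h | h
    · rw [if_pos h, parity_eq_zero h]; simp
    · rw [if_neg h.not_even, parity_eq_one h, pow_one]; simp [exp_pi_div_two_mul_I]
  have hk2 : (k : ℂ) ^ (1 / 2 : ℂ) = ((k : ℝ) ^ (1 / 2 : ℝ) : ℝ) := by
    rw [ofReal_cpow (Nat.cast_nonneg k)]; norm_num
  have hkpos : (0 : ℝ) < (k : ℝ) ^ (1 / 2 : ℝ) :=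
    Real.rpow_pos_of_pos (Nat.cast_pos.mpr (NeZero.pos k)) _
  rw [hroot, hk2] at hn ⊢
  have hg : ‖gauss χ‖ = (k : ℝ) ^ (1 / 2 : ℝ) := by
    rw [norm_div, norm_div, norm_exp] at hn
    have h0 : ((parity χ * Real.pi / 2 * I : ℂ)).re = 0 := by simp
    rw [h0, Real.exp_zero, div_one, norm_real, Real.norm_of_nonneg hkpos.le,
      div_eq_one_iff_eq hkpos.ne'] at hn
    exact hn
  have hpol := norm_mul_exp_arg_mul_I (gauss χ)
  rw [hg] at hpol
  rw [phase]
  nth_rw 2 [← hpol]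
  have hk3 : (((k : ℝ) ^ (1 / 2 : ℝ) : ℝ) : ℂ) ≠ 0 := ofReal_ne_zero.mpr hkpos.ne'
  field_simp
  rw [← exp_nat_mul, ← exp_add]
  congr 1
  push_cast
  ring

/-- Reflection produces the root number, and it is absorbed because conj(phase) = phase · root
number. -/
lemma xi_one_sub_conj (hk : 1 < k) (hχ : χ.IsPrimitive) {s : ℂ} (hs : 0 < s.re)
    (hs1 : s.re < 1) : conj (xi χ (1 - conj s)) = xi χ s := by
  have h1 := ne_one_of_isPrimitive hk hχ
  have hph : conj (phase χ) = phase χ * χ.rootNumber := by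
    have h2 := phase_sq_mul_rootNumber hk hχ
    have h3 : phase χ * conj (phase χ) = 1 := by
      rw [mul_conj, normSq_eq_norm_sq, phase, norm_exp_ofReal_mul_I]; simp
    have h0 : phase χ ≠ 0 := exp_ne_zero _
    apply mul_left_cancel₀ h0
    rw [h3, ← h2]; ring
  have e1 : conj (xi χ (1 - conj s)) = conj (phase χ) *
      exp ((1 / 2 - s) / 2 * Real.log (k / Real.pi)) * Gamma ((1 - s + parity χ) / 2) *
        χ⁻¹.LFunction (1 - s) := by
    rw [LFunction_inv_eq_conj h1]
    simp only [xi, map_mul, ← exp_conj, ← Gamma_conj, map_sub, map_add, map_div₀, conj_conj,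
      map_one, map_ofNat, conj_ofReal, map_natCast]
    congr 4
    ring
  rw [e1, hph, xi]
  have := functional_equation hk hχ hs hs1
  rw [mul_assoc _ (Gamma _) (χ.LFunction s), this]
  have h2 : exp ((1 / 2 - s) / 2 * Real.log (k / Real.pi)) =
      exp ((s - 1 / 2) / 2 * Real.log (k / Real.pi)) *
        exp ((1 / 2 - s) * Real.log (k / Real.pi)) := by
    rw [← exp_add]; congr 1; ring
  rw [h2]
  ring

lemma xi_line_real (hk : 1 < k) (hχ : χ.IsPrimitive) (t : ℝ) :
    xi χ (linePoint t) = ((xi χ (linePoint t)).re : ℂ) := by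
  have hre : (linePoint t).re = 1 / 2 := by simp [linePoint]
  have h := xi_one_sub_conj hk hχ (s := linePoint t) (by rw [hre]; norm_num)
    (by rw [hre]; norm_num)
  have hc : 1 - conj (linePoint t) = linePoint t := by
    apply Complex.ext
    · simp [linePoint]; norm_num
    · simp [linePoint]
  rw [hc] at h
  exact (conj_eq_iff_re.mp h).symm

lemma LFunction_one_sub_conj_eq_zero (hk : 1 < k) (hχ : χ.IsPrimitive) {s : ℂ} (hs : 0 < s.re)
    (hs1 : s.re < 1) (h0 : χ.LFunction s = 0) : χ.LFunction (1 - conj s) = 0 := by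
  have h := xi_one_sub_conj hk hχ hs hs1
  rw [(xi_eq_zero_iff hs).mpr h0, map_eq_zero] at h
  exact (xi_eq_zero_iff (by simpa using hs1)).mp h

/-! ### Removing zeros and choosing a continuous argument in a half-strip. -/

lemma exists_factor_pow {f : ℂ → ℂ} (hf : Differentiable ℂ f) (ρ : ℂ)
    (h : analyticOrderAt f ρ ≠ ⊤) :
    ∃ g : ℂ → ℂ, Differentiable ℂ g ∧ (∀ s, f s = (s - ρ) ^ analyticOrderNatAt f ρ * g s) ∧
      g ρ ≠ 0 := by
  set n := analyticOrderNatAt f ρ with hn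
  have hA : AnalyticAt ℂ f ρ := hf.analyticAt ρ
  obtain ⟨g, hg, hg0, hfg⟩ := (hA.analyticOrderAt_eq_natCast (n := n)).mp
    (Nat.cast_analyticOrderNatAt h).symm
  set G : ℂ → ℂ := fun s => if s = ρ then g ρ else f s / (s - ρ) ^ n with hG
  have hGg : G =ᶠ[𝓝 ρ] g := by
    filter_upwards [hfg] with s hs
    by_cases h1 : s = ρ
    · simp [hG, h1]
    · have : (s - ρ) ^ n ≠ 0 := pow_ne_zero _ (sub_ne_zero.mpr h1)
      simp only [hG, h1, if_false, hs, smul_eq_mul]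
      field_simp
  refine ⟨G, fun s => ?_, fun s => ?_, by simpa [hG] using hg0⟩
  · by_cases h1 : s = ρ
    · subst h1
      exact (hg.congr hGg.symm).differentiableAt
    · have h2 : (s - ρ) ^ n ≠ 0 := pow_ne_zero _ (sub_ne_zero.mpr h1)
      have h3 : G =ᶠ[𝓝 s] fun s => f s / (s - ρ) ^ n := by
        filter_upwards [isOpen_ne.mem_nhds h1] with z hz
        simp [hG, if_neg hz]
      exact DifferentiableAt.congr_of_eventuallyEq
        ((hf s).div (by fun_prop) h2) h3
  · by_cases h1 : s = ρ
    · subst h1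
      have := hfg.self_of_nhds
      simpa [hG] using this
    · have h2 : (s - ρ) ^ n ≠ 0 := pow_ne_zero _ (sub_ne_zero.mpr h1)
      simp only [hG, h1, if_false]
      field_simp

lemma exists_factor_finset {f : ℂ → ℂ} (hf : Differentiable ℂ f)
    (h : ∀ s, analyticOrderAt f s ≠ ⊤) (Z : Finset ℂ) :
    ∃ g : ℂ → ℂ, Differentiable ℂ g ∧
      (∀ s, f s = (∏ ρ ∈ Z, (s - ρ) ^ analyticOrderNatAt f ρ) * g s) ∧ ∀ ρ ∈ Z, g ρ ≠ 0 := by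
  induction Z using Finset.induction_on with
  | empty => exact ⟨f, hf, by simp, by simp⟩
  | insert ρ Z hρ ih =>
    obtain ⟨g, hg, hfg, hg0⟩ := ih
    set P : ℂ → ℂ := fun s => ∏ ρ ∈ Z, (s - ρ) ^ analyticOrderNatAt f ρ with hP
    have hPd : Differentiable ℂ P := by
      simp only [hP]; fun_prop
    have hPρ : P ρ ≠ 0 := Finset.prod_ne_zero_iff.mpr fun z hz =>
      pow_ne_zero _ (sub_ne_zero.mpr fun hh => hρ (hh ▸ hz))
    have hfP : f = P * g := funext hfg
    -- The factors already extracted do not vanish at the new point, so the quotient still has the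
    -- full order of `f` there.
    have hord : analyticOrderAt f ρ = analyticOrderAt g ρ := by
      conv_lhs => rw [hfP]
      rw [analyticOrderAt_mul (hPd.analyticAt ρ) (hg.analyticAt ρ),
        (hPd.analyticAt ρ).analyticOrderAt_eq_zero.mpr hPρ, zero_add]
    obtain ⟨G, hG, hgG, hGρ⟩ := exists_factor_pow hg ρ (hord ▸ h ρ)
    have hordn : analyticOrderNatAt g ρ = analyticOrderNatAt f ρ := by
      rw [analyticOrderNatAt, analyticOrderNatAt, hord]
    refine ⟨G, hG, fun s => ?_, ?_⟩
    · rw [Finset.prod_insert hρ, hfg s, hgG s, hordn]; ring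
    · intro z hz
      rcases Finset.mem_insert.mp hz with rfl | hz
      · exact hGρ
      · intro h0
        apply hg0 z hz
        rw [hgG z, h0, mul_zero]

/-- The half-strip `0 < σ`, `|t| < R + 1`. -/
def halfStrip (R : ℝ) : Set ℂ := {s | 0 < s.re ∧ |s.im| < R + 1}

lemma convex_halfStrip (R : ℝ) : Convex ℝ (halfStrip R) := by
  have : halfStrip R = {s : ℂ | 0 < s.re} ∩ ({s : ℂ | s.im < R + 1} ∩ {s : ℂ | -(R + 1) < s.im}) := by
    ext s
    simp [halfStrip, abs_lt]
    tauto
  rw [this]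
  exact (convex_halfSpace_re_gt 0).inter ((convex_halfSpace_im_lt _).inter (convex_halfSpace_im_gt _))

lemma isOpen_halfStrip (R : ℝ) : IsOpen (halfStrip R) :=
  (isOpen_lt continuous_const continuous_re).inter
    (isOpen_lt (continuous_im.abs) continuous_const)

lemma isSimplyConnected_halfStrip {R : ℝ} (hR : 0 ≤ R) : IsSimplyConnected (halfStrip R) := by
  have : ContractibleSpace (halfStrip R) :=
    (convex_halfStrip R).contractibleSpace ⟨1, by simp [halfStrip]; linarith⟩
  exact SimplyConnectedSpace.ofContractible (halfStrip R)

/-- The set of zeros in the half-strip. -/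
def zerosIn (χ : DirichletCharacter ℂ k) (R : ℝ) : Set ℂ :=
  halfStrip R ∩ {s | χ.LFunction s = 0}

lemma finite_zerosIn (hχ : χ ≠ 1) (R : ℝ) : (zerosIn χ R).Finite := by
  have hK : IsCompact (Set.Icc (0 : ℝ) 1 ×ℂ Set.Icc (-(R + 1)) (R + 1)) :=
    isCompact_Icc.reProdIm isCompact_Icc
  refine (finite_zeros_of_isCompact hχ hK).subset ?_
  rintro s ⟨⟨h1, h2⟩, h3⟩
  refine ⟨⟨⟨h1.le, ?_⟩, abs_le.mp h2.le⟩, h3⟩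
  by_contra! h4
  exact χ.LFunction_ne_zero_of_one_le_re (.inl hχ) h4.le h3

/-- For n ≥ 2 one has n^{-σ} ≤ 2^{2−σ} n^{-2}, so the tail is compared with ζ(2) − 1. The factor
2^{2−σ} yields L → 1 at +∞, and the bound at σ = 2 keeps L in the right half-plane. -/
lemma norm_LFunction_sub_one_le (χ : DirichletCharacter ℂ k) {s : ℂ} (hs : 2 ≤ s.re) :
    ‖χ.LFunction s - 1‖ ≤ (2 : ℝ) ^ (2 - s.re) * (Real.pi ^ 2 / 6 - 1) := by
  have hs1 : 1 < s.re := by linarith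
  rw [χ.LFunction_eq_LSeries hs1]
  have hsum : Summable (LSeries.term (χ ·) s) := χ.LSeriesSummable_of_one_lt_re hs1
  have h2 : LSeries (χ ·) s = 1 + ∑' n : ℕ, LSeries.term (χ ·) s (n + 2) := by
    rw [LSeries, ← hsum.sum_add_tsum_nat_add 2]
    simp [Finset.sum_range_succ, LSeries.term_of_ne_zero]
  rw [h2, add_sub_cancel_left]
  have hz : HasSum (fun n : ℕ => 1 / ((n + 2 : ℕ) : ℝ) ^ 2) (Real.pi ^ 2 / 6 - 1) := by
    have := (hasSum_nat_add_iff' 2).mpr hasSum_zeta_two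
    simpa [Finset.sum_range_succ] using this
  refine tsum_of_norm_bounded (hz.mul_left _) fun n => ?_
  rw [LSeries.norm_term_eq, if_neg (by omega)]
  have hn : (2 : ℝ) ≤ ((n + 2 : ℕ) : ℝ) := by push_cast; linarith [Nat.cast_nonneg (α := ℝ) n]
  have hpos : (0 : ℝ) < ((n + 2 : ℕ) : ℝ) := by linarith
  have hd : ((n + 2 : ℕ) : ℝ) ^ s.re = ((n + 2 : ℕ) : ℝ) ^ (s.re - 2) * ((n + 2 : ℕ) : ℝ) ^ 2 := by
    rw [← Real.rpow_natCast _ 2, ← Real.rpow_add hpos]; simp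
  have h3 : (2 : ℝ) ^ (s.re - 2) ≤ ((n + 2 : ℕ) : ℝ) ^ (s.re - 2) :=
    Real.rpow_le_rpow (by norm_num) hn (by linarith)
  have h4 : (0 : ℝ) < 2 ^ (s.re - 2) := by positivity
  have h5 : (2 : ℝ) ^ (2 - s.re) = (2 ^ (s.re - 2))⁻¹ := by
    rw [← Real.rpow_neg (by norm_num)]; simp
  rw [hd, h5]
  calc ‖χ ((n + 2 : ℕ) : ZMod k)‖ / (((n + 2 : ℕ) : ℝ) ^ (s.re - 2) * ((n + 2 : ℕ) : ℝ) ^ 2)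
      ≤ 1 / ((2 : ℝ) ^ (s.re - 2) * ((n + 2 : ℕ) : ℝ) ^ 2) := by
        gcongr
        exact χ.norm_le_one _
    _ = _ := by rw [one_div, mul_inv, one_div]

lemma pi_sq_div_six_sub_one_lt : Real.pi ^ 2 / 6 - 1 < 2 / 3 := by
  have := Real.pi_lt_d2
  have := Real.pi_pos
  nlinarith

lemma norm_LFunction_sub_one_lt (χ : DirichletCharacter ℂ k) {s : ℂ} (hs : 2 ≤ s.re) :
    ‖χ.LFunction s - 1‖ < 2 / 3 := by
  have h0 : 0 ≤ Real.pi ^ 2 / 6 - 1 := by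
    have := Real.pi_gt_three
    nlinarith
  have h1 : (2 : ℝ) ^ (2 - s.re) ≤ 1 := Real.rpow_le_one_of_one_le_of_nonpos (by norm_num) (by linarith)
  calc _ ≤ _ := norm_LFunction_sub_one_le χ hs
    _ ≤ 1 * (Real.pi ^ 2 / 6 - 1) := by gcongr
    _ < _ := by linarith [pi_sq_div_six_sub_one_lt]

lemma LFunction_mem_slitPlane (χ : DirichletCharacter ℂ k) {s : ℂ} (hs : 2 ≤ s.re) :
    χ.LFunction s ∈ slitPlane := by
  left
  have h1 := norm_LFunction_sub_one_lt χ hs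
  have h2 := (abs_re_le_norm (χ.LFunction s - 1)).trans_lt h1
  have := (abs_lt.mp h2).1
  simp at this
  linarith

lemma tendsto_LFunction_horizontal (χ : DirichletCharacter ℂ k) (t : ℝ) :
    Tendsto (fun σ : ℝ => χ.LFunction (σ + t * I)) atTop (𝓝 1) := by
  rw [tendsto_iff_norm_sub_tendsto_zero]
  have h1 : Tendsto (fun σ : ℝ => (2 : ℝ) ^ (2 - σ) * (Real.pi ^ 2 / 6 - 1)) atTop (𝓝 0) := by
    have h2 : Tendsto (fun σ : ℝ => (2 : ℝ) ^ (2 - σ)) atTop (𝓝 0) :=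
      (tendsto_rpow_atBot_of_base_gt_one 2 (by norm_num)).comp
        (tendsto_atBot_add_const_left _ 2 tendsto_neg_atTop_atBot)
    simpa using h2.mul_const (Real.pi ^ 2 / 6 - 1)
  refine squeeze_zero' (Eventually.of_forall fun _ => norm_nonneg _) ?_ h1
  filter_upwards [eventually_ge_atTop 2] with σ hσ
  simpa using norm_LFunction_sub_one_le χ (s := σ + t * I) (by simpa using hσ)

/-- A continuous map from a connected set to a discrete group is constant. All ambiguities of
branches by multiples of π or 2π are settled this way. -/
lemma eq_of_continuousOn_of_mem_zmultiples {α : Type*} [TopologicalSpace α] {S : Set α}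
    (hS : IsPreconnected S) {f : α → ℝ} (hf : ContinuousOn f S) {c : ℝ}
    (h : ∀ x ∈ S, ∃ n : ℤ, f x = n * c) {x y : α} (hx : x ∈ S) (hy : y ∈ S) : f x = f y := by
  have hm : Set.MapsTo f S (AddSubgroup.zmultiples c : Set ℝ) := by
    intro z hz
    obtain ⟨n, hn⟩ := h z hz
    exact AddSubgroup.mem_zmultiples_iff.mpr ⟨n, by rw [hn, zsmul_eq_mul]⟩
  have : DiscreteTopology (AddSubgroup.zmultiples c : Set ℝ) :=
    NormedSpace.discreteTopology_zmultiples c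
  exact hS.constant_of_mapsTo ⟨this⟩ hf hm hx hy

lemma exists_int_mul_two_pi {x y : ℝ} (h : exp (x * I) = exp (y * I)) :
    ∃ n : ℤ, x - y = n * (2 * Real.pi) := by
  obtain ⟨n, hn⟩ := exp_eq_exp_iff_exists_int.mp h
  refine ⟨n, ?_⟩
  have h1 : ((x - y - n * (2 * Real.pi) : ℝ) : ℂ) * I = 0 := by
    push_cast
    linear_combination hn
  have h2 := (mul_eq_zero.mp h1).resolve_right I_ne_zero
  have h3 := ofReal_eq_zero.mp h2
  linarith

/-- Two continuous arguments differ by a constant multiple of 2π, which is 0 because both tend to 0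
at +∞. -/
lemma HasArgLimit.unique {t ℓ ℓ' : ℝ} (h : HasArgLimit χ t ℓ) (h' : HasArgLimit χ t ℓ') :
    ℓ = ℓ' := by
  obtain ⟨g, hg, hgL, hg0, hgl⟩ := h
  obtain ⟨g', hg', hgL', hg0', hgl'⟩ := h'
  have hmul : ∀ σ ∈ Set.Ioi (1 / 2 : ℝ), ∃ n : ℤ, (g - g') σ = n * (2 * Real.pi) := by
    intro σ hσ
    apply exists_int_mul_two_pi
    have h1 := hgL σ hσ
    have h2 := hgL' σ hσ
    have h3 : (‖χ.LFunction (σ + t * I)‖ : ℂ) ≠ 0 := by simpa using h1.1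
    apply mul_left_cancel₀ h3
    rw [← h1.2, ← h2.2]
  have hcst : ∀ σ ∈ Set.Ioi (1 / 2 : ℝ), g σ - g' σ = g 1 - g' 1 := fun σ hσ =>
    eq_of_continuousOn_of_mem_zmultiples isPreconnected_Ioi (hg.sub hg') hmul hσ
      (by norm_num : (1 : ℝ) ∈ Set.Ioi (1 / 2 : ℝ))
  have h0 : g 1 - g' 1 = 0 := by
    have h1 : Tendsto (fun σ => g σ - g' σ) atTop (𝓝 (0 - 0)) := hg0.sub hg0'
    have h2 : Tendsto (fun σ => g σ - g' σ) atTop (𝓝 (g 1 - g' 1)) :=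
      tendsto_const_nhds.congr' (by
        filter_upwards [eventually_gt_atTop (1 / 2)] with σ hσ
        exact (hcst σ hσ).symm)
    rw [tendsto_nhds_unique h2 h1, sub_zero]
  refine tendsto_nhds_unique hgl (hgl'.congr' ?_)
  filter_upwards [self_mem_nhdsWithin] with σ hσ
  have := hcst σ hσ
  linarith

/-- The argument of `∏ (s - ρ)^m(ρ)` over `ρ ∈ Z`, with principal arguments. -/
def argSum (χ : DirichletCharacter ℂ k) (Z : Finset ℂ) (s : ℂ) : ℝ :=
  ∑ ρ ∈ Z, analyticOrderNatAt χ.LFunction ρ * (s - ρ).arg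

lemma prod_sub_pow_eq (χ : DirichletCharacter ℂ k) (Z : Finset ℂ) (s : ℂ) :
    ∏ ρ ∈ Z, (s - ρ) ^ analyticOrderNatAt χ.LFunction ρ =
      ‖∏ ρ ∈ Z, (s - ρ) ^ analyticOrderNatAt χ.LFunction ρ‖ * exp (argSum χ Z s * I) := by
  rw [norm_prod, argSum]
  push_cast
  rw [Finset.sum_mul, exp_sum, ← Finset.prod_mul_distrib]
  refine Finset.prod_congr rfl fun ρ _ => ?_
  rw [norm_pow, mul_assoc, exp_nat_mul]
  push_cast
  rw [← mul_pow, norm_mul_exp_arg_mul_I]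

/-- Once the zeros are divided out, the cofactor has a continuous logarithm on the simply connected
half-strip. Its imaginary part is Φ up to a constant, so all discontinuities of the argument of L
sit in the explicit sum of principal arguments. -/
lemma exists_continuous_arg (hχ : χ ≠ 1) {R : ℝ} (hR : 0 ≤ R) {Z : Finset ℂ}
    (hZ : ∀ s, s ∈ Z ↔ s ∈ zerosIn χ R) :
    ∃ Φ : ℂ → ℝ, ContinuousOn Φ (halfStrip R) ∧
      (∀ s ∈ halfStrip R,
        χ.LFunction s = ‖χ.LFunction s‖ * exp ((Φ s + argSum χ Z s : ℝ) * I)) ∧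
      ∀ s ∈ halfStrip R, 2 ≤ s.re → Φ s + argSum χ Z s = (χ.LFunction s).arg := by
  obtain ⟨h, hd, hfac, hh0⟩ := exists_factor_finset
    (DirichletCharacter.differentiable_LFunction hχ) (analyticOrderAt_LFunction_ne_top hχ) Z
  have hne : ∀ s ∈ halfStrip R, h s ≠ 0 := by
    intro s hs h0
    have : s ∈ Z := (hZ s).mpr ⟨hs, by simp [hfac s, h0]⟩
    exact hh0 s this h0
  obtain ⟨H, hHc, hHe⟩ := exists_continuousOn_eqOn_exp_comp (isSimplyConnected_halfStrip hR)
    (isOpen_halfStrip R) hd.continuous.continuousOn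
    (by rintro ⟨s, hs, h0⟩; exact hne s hs h0)
  have hLe : ∀ s ∈ halfStrip R,
      χ.LFunction s = ‖χ.LFunction s‖ * exp (((H s).im + argSum χ Z s : ℝ) * I) := by
    intro s hs
    have h1 : h s = ‖h s‖ * exp ((H s).im * I) := by
      have : exp (H s) = h s := hHe hs
      rw [← this, norm_exp, ofReal_exp, ← exp_add, re_add_im]
    conv_lhs => rw [hfac s, prod_sub_pow_eq, h1]
    conv_rhs => rw [hfac s, norm_mul]
    push_cast
    rw [add_mul, exp_add]
    ring
  set V : Set ℂ := halfStrip R ∩ {s : ℂ | 2 ≤ s.re} with hV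
  have hVc : IsPreconnected V :=
    ((convex_halfStrip R).inter (convex_halfSpace_re_ge 2)).isPreconnected
  have harg : ContinuousOn (fun s => argSum χ Z s) V := by
    unfold argSum
    refine continuousOn_finsetSum _ fun ρ hρ => ContinuousOn.mul continuousOn_const ?_
    intro s hs
    refine ContinuousAt.continuousWithinAt ?_
    have hmem : s - ρ ∈ slitPlane := by
      left
      have h1 : ρ ∈ zerosIn χ R := (hZ ρ).mp hρ
      have h2 : ρ.re < 1 := by
        by_contra! h4
        exact χ.LFunction_ne_zero_of_one_le_re (.inl hχ) h4 h1.2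
      have h3 : 2 ≤ s.re := hs.2
      simp only [sub_re]
      linarith
    exact (continuousAt_arg hmem).comp (f := fun s => s - ρ) (by fun_prop)
  have hargL : ContinuousOn (fun s => (χ.LFunction s).arg) V := fun s hs =>
    ((continuousAt_arg (LFunction_mem_slitPlane χ hs.2)).comp
      (DirichletCharacter.differentiable_LFunction hχ s).continuousAt).continuousWithinAt
  have hQ : ∀ s ∈ V, ∃ n : ℤ,
      ((H s).im + argSum χ Z s - (χ.LFunction s).arg) = n * (2 * Real.pi) := by
    intro s hs
    apply exists_int_mul_two_pi
    have h0 : (‖χ.LFunction s‖ : ℂ) ≠ 0 := by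
      simpa using slitPlane_ne_zero (LFunction_mem_slitPlane χ hs.2)
    apply mul_left_cancel₀ h0
    rw [← hLe s hs.1, norm_mul_exp_arg_mul_I]
  have h2V : (2 : ℂ) ∈ V := by
    refine ⟨⟨by simp, ?_⟩, by simp⟩
    simp
    linarith
  obtain ⟨n, hn⟩ := hQ 2 h2V
  have hcst : ∀ s ∈ V, (H s).im + argSum χ Z s - (χ.LFunction s).arg = n * (2 * Real.pi) := by
    intro s hs
    rw [← hn]
    exact eq_of_continuousOn_of_mem_zmultiples (f := fun s => (H s).im + argSum χ Z s -
      (χ.LFunction s).arg) hVc (((continuous_im.comp_continuousOn (hHc.mono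
        Set.inter_subset_left)).add harg).sub hargL) hQ hs h2V
  -- Subtracting this multiple of 2π makes the branch agree with the principal value on Re s ≥ 2,
  -- and hence tend to 0 at +∞.
  refine ⟨fun s => (H s).im - n * (2 * Real.pi), (continuous_im.comp_continuousOn hHc).sub
    continuousOn_const, fun s hs => ?_, fun s hs h2 => ?_⟩
  · conv_lhs => rw [hLe s hs]
    congr 1
    rw [exp_eq_exp_iff_exists_int]
    refine ⟨n, ?_⟩
    push_cast
    ring
  · have := hcst s ⟨hs, h2⟩
    linarith

/-- The principal argument of s − ρ is cut along the ray going left from ρ. Zeros at height u have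
real part at most 1/2, so the half-line coming from +∞ meets no cut before it reaches the critical
line. -/
lemma hasArgLimit_of_ne_zero {R : ℝ} {Z : Finset ℂ}
    (hZ : ∀ s, s ∈ Z ↔ s ∈ zerosIn χ R) {Φ : ℂ → ℝ} (hΦ : ContinuousOn Φ (halfStrip R))
    (hΦL : ∀ s ∈ halfStrip R,
        χ.LFunction s = ‖χ.LFunction s‖ * exp ((Φ s + argSum χ Z s : ℝ) * I))
    (hΦ2 : ∀ s ∈ halfStrip R, 2 ≤ s.re → Φ s + argSum χ Z s = (χ.LFunction s).arg)
    {u : ℝ} (hu : |u| < R + 1) (hne : ∀ σ : ℝ, 1 / 2 < σ → χ.LFunction (σ + u * I) ≠ 0) :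
    HasArgLimit χ u (Φ (linePoint u) + argSum χ Z (linePoint u)) := by
  have hmem : ∀ σ : ℝ, 0 < σ → (σ + u * I : ℂ) ∈ halfStrip R := by
    intro σ hσ
    refine ⟨by simpa using hσ, by simpa using hu⟩
  have hΦc : ∀ σ : ℝ, 0 < σ → ContinuousAt (fun σ : ℝ => Φ (σ + u * I)) σ := fun σ hσ =>
    (hΦ.continuousAt ((isOpen_halfStrip R).mem_nhds (hmem σ hσ))).comp
      (f := fun σ : ℝ => (σ + u * I : ℂ)) (by fun_prop)
  have hre : ∀ ρ ∈ Z, ρ.im = u → ρ.re ≤ 1 / 2 := by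
    intro ρ hρ hi
    by_contra! h
    apply hne ρ.re h
    rw [← hi, re_add_im]
    exact ((hZ ρ).mp hρ).2
  have hargc : ∀ ρ ∈ Z, ∀ σ : ℝ, 1 / 2 ≤ σ → (σ = 1 / 2 → ρ ≠ linePoint u) →
      ContinuousAt (fun σ : ℝ => ((σ + u * I : ℂ) - ρ).arg) σ := by
    intro ρ hρ σ hσ hl
    have hs : (σ + u * I : ℂ) - ρ ∈ slitPlane := by
      by_cases hi : ρ.im = u
      · left
        have h1 := hre ρ hρ hi
        simp only [sub_re, add_re, ofReal_re, mul_re, I_re, mul_zero, ofReal_im, I_im, mul_one,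
          sub_self, add_zero, sub_pos]
        rcases lt_or_eq_of_le hσ with h2 | h2
        · linarith
        · refine h2 ▸ lt_of_le_of_ne h1 fun h3 => hl h2.symm ?_
          rw [← re_add_im ρ, h3, hi, linePoint]
          simp
      · right
        simp only [sub_im, add_im, ofReal_im, mul_im, ofReal_re, I_im, mul_one, I_re, mul_zero,
          add_zero, zero_add]
        exact sub_ne_zero.mpr (Ne.symm hi)
    exact (continuousAt_arg hs).comp (f := fun σ : ℝ => (σ + u * I : ℂ) - ρ) (by fun_prop)
  refine ⟨fun σ => Φ (σ + u * I) + argSum χ Z (σ + u * I), ?_, ?_, ?_, ?_⟩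
  · intro σ hσ
    refine ContinuousAt.continuousWithinAt ?_
    refine (hΦc σ (by have : (1 / 2 : ℝ) < σ := hσ; linarith)).add ?_
    unfold argSum
    exact tendsto_finsetSum _ fun ρ hρ => (hargc ρ hρ σ (le_of_lt hσ)
      (fun h => absurd h (ne_of_gt hσ))).const_mul _
  · intro σ hσ
    exact ⟨hne σ hσ, hΦL _ (hmem σ (by linarith))⟩
  · have h1 : Tendsto (fun σ : ℝ => (χ.LFunction (σ + u * I)).arg) atTop (𝓝 (arg 1)) :=
      ((continuousAt_arg one_mem_slitPlane).tendsto).comp (tendsto_LFunction_horizontal χ u)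
    rw [arg_one] at h1
    refine h1.congr' ?_
    filter_upwards [eventually_ge_atTop 2] with σ hσ
    rw [hΦ2 _ (hmem σ (by linarith)) (by simpa using hσ)]
  · have hl : linePoint u = ((1 / 2 : ℝ) : ℂ) + u * I := by simp [linePoint]
    refine Tendsto.add ?_ ?_
    · have := (hΦc (1 / 2) (by norm_num)).tendsto
      rw [← hl] at this
      exact this.mono_left nhdsWithin_le_nhds
    · unfold argSum
      refine tendsto_finsetSum _ fun ρ hρ => Tendsto.const_mul _ ?_
      by_cases h : ρ = linePoint u
      -- If ρ is the endpoint itself, the differences along the half-line are positive reals of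
      -- argument 0, and the convention arg 0 = 0 is the correct limit.
      · have h1 : (linePoint u - ρ).arg = 0 := by simp [h]
        rw [h1]
        refine tendsto_const_nhds.congr' ?_
        filter_upwards [self_mem_nhdsWithin] with σ hσ
        have : (σ + u * I : ℂ) - ρ = ((σ - 1 / 2 : ℝ) : ℂ) := by
          rw [h, linePoint]; push_cast; ring
        rw [this, arg_ofReal_of_nonneg (by have : (1 / 2 : ℝ) < σ := hσ; linarith)]
      · have := (hargc ρ hρ (1 / 2) le_rfl (fun _ => h)).tendsto
        rw [← hl] at this
        exact this.mono_left nhdsWithin_le_nhds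

/-! ### The total argument on the critical line as a step function. -/

lemma HasArgLimit.ne_zero {t ℓ : ℝ} (h : HasArgLimit χ t ℓ) {σ : ℝ} (hσ : 1 / 2 < σ) :
    χ.LFunction (σ + t * I) ≠ 0 := by
  obtain ⟨g, -, hg, -⟩ := h
  exact (hg σ hσ).1

/-- The left-hand side of the exact equation, for the value `ℓ` of the limit of the argument,
shifted by `a π / 4`. -/
def totalArg (χ : DirichletCharacter ℂ k) (t ℓ : ℝ) : ℝ :=
  thetaRS k (parity χ) t + ℓ - (gauss χ).arg / 2 + parity χ * Real.pi / 4

lemma isSolution_iff {n : ℤ} {t : ℝ} : IsSolution χ n t ↔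
    ∃ ℓ, HasArgLimit χ t ℓ ∧ totalArg χ t ℓ = (n - 1 / 2) * Real.pi := by
  refine exists_congr fun ℓ => and_congr_right fun _ => ?_
  rw [totalArg]
  constructor <;> intro h <;> linarith

lemma xi_linePoint (χ : DirichletCharacter ℂ k) {t ℓ : ℝ}
    (h : χ.LFunction (linePoint t) = ‖χ.LFunction (linePoint t)‖ * exp (ℓ * I)) :
    xi χ (linePoint t) =
      (‖Gamma ((linePoint t + parity χ) / 2)‖ * ‖χ.LFunction (linePoint t)‖ : ℝ) *
        exp (totalArg χ t ℓ * I) := by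
  have hc : (0 : ℝ) < 1 / 4 + (parity χ : ℝ) / 2 := by positivity
  have hG := Gamma_eq_norm_mul_exp_argGamma hc t
  have hs : (((1 / 4 + (parity χ : ℝ) / 2 : ℝ) : ℂ) + I * (t / 2)) =
      (linePoint t + parity χ) / 2 := by
    rw [linePoint]; push_cast; ring
  rw [hs] at hG
  have hlog : Real.log (k / Real.pi) = -Real.log (Real.pi / k) := by
    rw [← Real.log_inv, inv_div]
  rw [xi, hG, phase, totalArg, thetaRS]
  conv_lhs => rw [h]
  rw [norm_mul, norm_exp_ofReal_mul_I, mul_one, norm_real, norm_norm, hlog]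
  have : ∀ a b c d e f : ℂ, exp a * exp b * (c * exp d) * (e * exp f) =
      c * e * exp (a + b + d + f) := by
    intro a b c d e f
    rw [exp_add, exp_add, exp_add]; ring
  rw [this]
  push_cast
  congr 2
  rw [linePoint]
  ring

/-- `xi` is real on the line and the modulus in its polar form is nonzero, so the sine of the total
argument vanishes. -/
lemma totalArg_mem (hk : 1 < k) (hχ : χ.IsPrimitive) {t ℓ : ℝ}
    (h : χ.LFunction (linePoint t) = ‖χ.LFunction (linePoint t)‖ * exp (ℓ * I))
    (h0 : χ.LFunction (linePoint t) ≠ 0) : ∃ n : ℤ, totalArg χ t ℓ = n * Real.pi := by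
  have h1 := xi_linePoint χ h
  have h2 := congrArg im (xi_line_real hk hχ t)
  rw [h1, ofReal_im, im_ofReal_mul, exp_ofReal_mul_I_im] at h2
  have hre : 0 < (linePoint t).re := by simp [linePoint]
  have hG : Gamma ((linePoint t + parity χ) / 2) ≠ 0 :=
    Gamma_ne_zero_of_re_pos (re_add_parity_pos hre)
  have h3 : Real.sin (totalArg χ t ℓ) = 0 := by
    refine (mul_eq_zero.mp h2).resolve_left ?_
    simp [hG, h0]
  obtain ⟨n, hn⟩ := Real.sin_eq_zero_iff.mp h3
  exact ⟨n, hn.symm⟩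

/-- The step function with value `1 / 2` at the jump. -/
def step (x : ℝ) : ℝ := if x < 0 then 0 else if x = 0 then 1 / 2 else 1

/-- The weight of a zero: `1` on the critical line, `2` to the right of it, `0` to the left. -/
def weight (ρ : ℂ) : ℕ := if ρ.re < 1 / 2 then 0 else if ρ.re = 1 / 2 then 1 else 2

/-- The weighted number of zeros in `Z` with imaginary part below `u`. -/
def stepSum (χ : DirichletCharacter ℂ k) (Z : Finset ℂ) (u : ℝ) : ℝ :=
  ∑ ρ ∈ Z, (weight ρ * analyticOrderNatAt χ.LFunction ρ : ℕ) * step (u - ρ.im)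

/-- The continuous part of the argument of `1/2 + iu - ρ`. -/
def argCont (ρ : ℂ) (u : ℝ) : ℝ :=
  if ρ.re < 1 / 2 then (linePoint u - ρ).arg
  else if ρ.re = 1 / 2 then -(Real.pi / 2) else (ρ - linePoint u).arg - Real.pi

lemma linePoint_re (t : ℝ) : (linePoint t).re = 1 / 2 := by simp [linePoint]

lemma linePoint_im (t : ℝ) : (linePoint t).im = t := by simp [linePoint]

lemma continuous_linePoint : Continuous linePoint := by unfold linePoint; fun_prop

lemma continuous_argCont (ρ : ℂ) : Continuous (argCont ρ) := by
  rw [continuous_iff_continuousAt]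
  intro u
  unfold argCont
  have hl := continuous_linePoint
  split_ifs with h1 h2
  · refine (continuousAt_arg (.inl ?_)).comp (f := fun u => linePoint u - ρ) (by fun_prop)
    rw [sub_re, linePoint_re]; linarith
  · exact continuousAt_const
  · refine ((continuousAt_arg (.inl ?_)).comp (f := fun u => ρ - linePoint u) (by fun_prop)).sub
      continuousAt_const
    rw [sub_re, linePoint_re]
    have := lt_of_le_of_ne (not_lt.mp h1) (Ne.symm h2)
    linarith

/-- As u passes the height of ρ, the vector 1/2 + iu − ρ turns without a jump if ρ is to the left.
If ρ is on the line the argument goes from −π/2 through 0 to π/2. If ρ is to the right it crosses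
the cut and jumps by 2π; the hypothesis excludes only the crossing height in this last case. -/
lemma arg_linePoint_sub {ρ : ℂ} {u : ℝ} (h : ρ.re ≤ 1 / 2 ∨ ρ.im ≠ u) :
    (linePoint u - ρ).arg = argCont ρ u + Real.pi * (weight ρ * step (u - ρ.im)) := by
  unfold argCont weight
  split_ifs with h1 h2
  · simp
  · have : linePoint u - ρ = ((u - ρ.im : ℝ) : ℂ) * I := by
      apply Complex.ext
      · simp [linePoint, h2]
      · simp [linePoint]
    rw [this, step]
    split_ifs with h3 h4
    · rw [arg_eq_neg_pi_div_two_iff.mpr ⟨by simp, by simpa using h3⟩]; simp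
    · rw [h4]; simp; ring
    · have : 0 < u - ρ.im := lt_of_le_of_ne (not_lt.mp h3) (Ne.symm h4)
      rw [arg_eq_pi_div_two_iff.mpr ⟨by simp, by simpa using this⟩]; simp; ring
  · have h3 : 1 / 2 < ρ.re := lt_of_le_of_ne (not_lt.mp h1) (Ne.symm h2)
    have h4 : ρ.im ≠ u := h.resolve_left (by linarith)
    rw [step]
    split_ifs with h5 h6
    · have := arg_neg_eq_arg_add_pi_of_im_neg (x := linePoint u - ρ)
        (by rw [sub_im, linePoint_im]; exact h5)
      rw [neg_sub] at this
      rw [this]; simp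
    · exact absurd (by linarith) h4
    · have h7 : 0 < u - ρ.im := lt_of_le_of_ne (not_lt.mp h5) (Ne.symm h6)
      have := arg_neg_eq_arg_sub_pi_of_im_pos (x := linePoint u - ρ)
        (by rw [sub_im, linePoint_im]; exact h7)
      rw [neg_sub] at this
      rw [this]; push_cast; ring

lemma continuous_thetaRS (k a : ℕ) : Continuous (thetaRS k a) := by
  unfold thetaRS
  have : Continuous (argGamma (1 / 4 + a / 2)) := continuous_argGamma (by positivity)
  fun_prop

/-- The multiples of c form a closed set, so at the exceptional points the values are multiples as
well, by continuity. Connectedness then gives a constant. -/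
lemma const_of_mem_zmultiples_off_finite {f : ℝ → ℝ} {S : Set ℝ} (hS : IsOpen S)
    (hSp : IsPreconnected S) (hf : ContinuousOn f S) {E : Set ℝ} (hE : E.Finite) {c : ℝ}
    (h : ∀ x ∈ S \ E, ∃ n : ℤ, f x = n * c) {x₀ : ℝ} (hx₀ : x₀ ∈ S) :
    ∃ N : ℤ, ∀ x ∈ S, f x = N * c := by
  have hcl : IsClosed (AddSubgroup.zmultiples c : Set ℝ) := by
    have : DiscreteTopology (AddSubgroup.zmultiples c) := NormedSpace.discreteTopology_zmultiples c
    exact AddSubgroup.isClosed_of_discrete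
  have hall : ∀ x ∈ S, ∃ n : ℤ, f x = n * c := by
    intro x hx
    have h1 : ∀ᶠ y in 𝓝[≠] x, f y ∈ (AddSubgroup.zmultiples c : Set ℝ) := by
      have h2 : (E \ {x})ᶜ ∈ 𝓝 x := (hE.subset Set.sdiff_subset).isClosed.isOpen_compl.mem_nhds
        (by simp)
      filter_upwards [mem_nhdsWithin_of_mem_nhds h2, self_mem_nhdsWithin,
        mem_nhdsWithin_of_mem_nhds (hS.mem_nhds hx)] with y hy hyx hyS
      obtain ⟨n, hn⟩ := h y ⟨hyS, fun hyE => hy ⟨hyE, hyx⟩⟩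
      exact AddSubgroup.mem_zmultiples_iff.mpr ⟨n, by rw [hn, zsmul_eq_mul]⟩
    have h3 := hcl.mem_of_tendsto
      ((hf.continuousAt (hS.mem_nhds hx)).tendsto.mono_left nhdsWithin_le_nhds) h1
    obtain ⟨n, hn⟩ := AddSubgroup.mem_zmultiples_iff.mp h3
    exact ⟨n, by rw [← hn, zsmul_eq_mul]⟩
  obtain ⟨N, hN⟩ := hall x₀ hx₀
  exact ⟨N, fun x hx => hN ▸ eq_of_continuousOn_of_mem_zmultiples hSp hf hall hx hx₀⟩

/-- No zeros to the right of the critical line at height `t`. -/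
def NoZerosRight (χ : DirichletCharacter ℂ k) (t : ℝ) : Prop :=
  ∀ s : ℂ, 1 / 2 < s.re → s.im = t → χ.LFunction s ≠ 0

lemma HasArgLimit.noZerosRight {t ℓ : ℝ} (h : HasArgLimit χ t ℓ) : NoZerosRight χ t := by
  intro s hs hi
  rw [← re_add_im s, hi]
  exact h.ne_zero hs

/-- The zeros in the half-strip `|t| < R + 1`, as a finite set. -/
def zerosFinset (χ : DirichletCharacter ℂ k) (R : ℝ) : Finset ℂ :=
  open Classical in if h : (zerosIn χ R).Finite then h.toFinset else ∅

lemma mem_zerosFinset (hχ : χ ≠ 1) {R : ℝ} {s : ℂ} :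
    s ∈ zerosFinset χ R ↔ s ∈ zerosIn χ R := by
  rw [zerosFinset, dif_pos (finite_zerosIn hχ R), Set.Finite.mem_toFinset]

lemma exists_int_step {x : ℝ} (hx : x ≠ 0) : ∃ n : ℤ, step x = n := by
  unfold step
  split_ifs
  · exact ⟨0, by simp⟩
  · exact ⟨1, by simp⟩

/-- Subtracting π `stepSum` from the total argument leaves a continuous function B of the height.
Away from the finitely many heights of zeros, the total argument lies in πℤ and `stepSum` is an
integer, so B lies in πℤ there and is therefore constant. -/
lemma exists_totalArg_eq (hk : 1 < k) (hχ : χ.IsPrimitive) {R : ℝ} (hR : 0 ≤ R) :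
    ∃ N : ℤ, ∀ u : ℝ, |u| ≤ R → NoZerosRight χ u →
      ∃ ℓ, HasArgLimit χ u ℓ ∧
        totalArg χ u ℓ = Real.pi * (N + stepSum χ (zerosFinset χ R) u) := by
  have h1 := ne_one_of_isPrimitive hk hχ
  set Z := zerosFinset χ R with hZdef
  have hZ : ∀ s, s ∈ Z ↔ s ∈ zerosIn χ R := fun s => mem_zerosFinset h1
  obtain ⟨Φ, hΦ, hΦL, hΦ2⟩ := exists_continuous_arg h1 hR hZ
  set S : Set ℝ := Set.Ioo (-(R + 1)) (R + 1) with hS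
  have hSmem : ∀ u ∈ S, linePoint u ∈ halfStrip R := by
    intro u hu
    refine ⟨by rw [linePoint_re]; norm_num, ?_⟩
    rw [linePoint_im]
    exact abs_lt.mpr hu
  set m : ℂ → ℕ := fun ρ => analyticOrderNatAt χ.LFunction ρ with hm
  set B : ℝ → ℝ := fun u => thetaRS k (parity χ) u +
    (Φ (linePoint u) + ∑ ρ ∈ Z, m ρ * argCont ρ u) - (gauss χ).arg / 2 +
      parity χ * Real.pi / 4 with hB
  have hBc : ContinuousOn B S := by
    have c1 : ContinuousOn (fun u => Φ (linePoint u)) S :=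
      hΦ.comp continuous_linePoint.continuousOn hSmem
    have c2 := continuous_thetaRS k (parity χ)
    have c3 : Continuous fun u => ∑ ρ ∈ Z, (m ρ : ℝ) * argCont ρ u :=
      continuous_finsetSum _ fun ρ _ => continuous_const.mul (continuous_argCont ρ)
    exact ((c2.continuousOn.add (c1.add c3.continuousOn)).sub continuousOn_const).add
      continuousOn_const
  have hkey : ∀ u : ℝ, (∀ ρ ∈ Z, ρ.re ≤ 1 / 2 ∨ ρ.im ≠ u) →
      totalArg χ u (Φ (linePoint u) + argSum χ Z (linePoint u)) =
        B u + Real.pi * stepSum χ Z u := by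
    intro u hu
    have : argSum χ Z (linePoint u) = ∑ ρ ∈ Z, m ρ * argCont ρ u + Real.pi * stepSum χ Z u := by
      rw [argSum, stepSum, Finset.mul_sum, ← Finset.sum_add_distrib]
      refine Finset.sum_congr rfl fun ρ hρ => ?_
      rw [arg_linePoint_sub (hu ρ hρ)]
      simp only [hm]
      push_cast
      ring
    rw [totalArg, this, hB]
    ring
  have hE : ((Z.image im : Finset ℝ) : Set ℝ).Finite := Finset.finite_toSet _
  have hint : ∀ u ∈ S \ ((Z.image im : Finset ℝ) : Set ℝ), ∃ n : ℤ, B u = n * Real.pi := by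
    rintro u ⟨huS, huE⟩
    have hu : ∀ ρ ∈ Z, ρ.im ≠ u := fun ρ hρ h => huE (by simpa using ⟨ρ, hρ, h⟩)
    have h2 := hkey u fun ρ hρ => .inr (hu ρ hρ)
    have h0 : χ.LFunction (linePoint u) ≠ 0 := fun h0 =>
      hu (linePoint u) ((hZ _).mpr ⟨hSmem u huS, h0⟩) (linePoint_im u)
    obtain ⟨n, hn⟩ := totalArg_mem hk hχ (hΦL _ (hSmem u huS)) h0
    have h3 : ∃ N : ℤ, stepSum χ Z u = N := by
      unfold stepSum
      have : ∀ ρ ∈ Z, ∃ n : ℤ, step (u - ρ.im) = n := fun ρ hρ =>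
        exists_int_step (sub_ne_zero.mpr (hu ρ hρ).symm)
      choose! f hf using this
      refine ⟨∑ ρ ∈ Z, (weight ρ * analyticOrderNatAt χ.LFunction ρ : ℕ) * f ρ, ?_⟩
      push_cast
      exact Finset.sum_congr rfl fun ρ hρ => by rw [hf ρ hρ]
    obtain ⟨N, hN⟩ := h3
    refine ⟨n - N, ?_⟩
    rw [hn, hN] at h2
    push_cast
    linarith
  obtain ⟨N, hN⟩ := const_of_mem_zmultiples_off_finite isOpen_Ioo isPreconnected_Ioo hBc hE hint
    (x₀ := 0) (by constructor <;> linarith)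
  refine ⟨N, fun u hu hne => ⟨_, hasArgLimit_of_ne_zero hZ hΦ hΦL hΦ2 (by linarith)
    (fun σ hσ => hne _ (by simpa using hσ) (by simp)), ?_⟩⟩
  rw [hkey u, hN u (abs_lt.mp (by linarith))]
  · ring
  · intro ρ hρ
    by_contra! h
    exact hne ρ h.1 h.2 ((hZ ρ).mp hρ).2

/-- The total argument at height `t`; meaningful if the limit of the argument exists. -/
def heightArg (χ : DirichletCharacter ℂ k) (t : ℝ) : ℝ :=
  open Classical in if h : ∃ ℓ, HasArgLimit χ t ℓ then totalArg χ t h.choose else 0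

lemma HasArgLimit.heightArg_eq {t ℓ : ℝ} (h : HasArgLimit χ t ℓ) :
    heightArg χ t = totalArg χ t ℓ := by
  have h' : ∃ ℓ, HasArgLimit χ t ℓ := ⟨ℓ, h⟩
  rw [heightArg, dif_pos h', h'.choose_spec.unique h]

lemma NoZerosRight.exists_hasArgLimit (hk : 1 < k) (hχ : χ.IsPrimitive) {t : ℝ}
    (h : NoZerosRight χ t) : ∃ ℓ, HasArgLimit χ t ℓ := by
  obtain ⟨N, hN⟩ := exists_totalArg_eq hk hχ (abs_nonneg t)
  obtain ⟨ℓ, hℓ, -⟩ := hN t le_rfl h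
  exact ⟨ℓ, hℓ⟩

lemma isSolution_iff_heightArg (hk : 1 < k) (hχ : χ.IsPrimitive) {n : ℤ} {t : ℝ} :
    IsSolution χ n t ↔ NoZerosRight χ t ∧ heightArg χ t = (n - 1 / 2) * Real.pi := by
  rw [isSolution_iff]
  constructor
  · rintro ⟨ℓ, hℓ, h⟩
    exact ⟨hℓ.noZerosRight, by rw [hℓ.heightArg_eq, h]⟩
  · rintro ⟨h1, h2⟩
    obtain ⟨ℓ, hℓ⟩ := h1.exists_hasArgLimit hk hχ
    exact ⟨ℓ, hℓ, by rw [← hℓ.heightArg_eq, h2]⟩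

lemma argLimitExists_iff (hk : 1 < k) (hχ : χ.IsPrimitive) :
    ArgLimitExists χ ↔ ∀ t, NoZerosRight χ t :=
  ⟨fun h t => (h t).choose_spec.noZerosRight, fun h t => (h t).exists_hasArgLimit hk hχ⟩

lemma exists_heightArg_eq (hk : 1 < k) (hχ : χ.IsPrimitive) {R : ℝ} (hR : 0 ≤ R) :
    ∃ N : ℤ, ∀ u : ℝ, |u| ≤ R → NoZerosRight χ u →
      heightArg χ u = Real.pi * (N + stepSum χ (zerosFinset χ R) u) := by
  obtain ⟨N, hN⟩ := exists_totalArg_eq hk hχ hR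
  refine ⟨N, fun u hu h => ?_⟩
  obtain ⟨ℓ, hℓ, h2⟩ := hN u hu h
  rw [hℓ.heightArg_eq, h2]

/-! ### Jumps of the total argument and solutions of the exact equation. -/

/-- The order of vanishing at `ρ`. -/
abbrev mult (χ : DirichletCharacter ℂ k) (ρ : ℂ) : ℕ := analyticOrderNatAt χ.LFunction ρ

/-- The contribution of `ρ` to the variation of the total argument between `u` and `v`. -/
def jump (χ : DirichletCharacter ℂ k) (u v : ℝ) (ρ : ℂ) : ℝ :=
  (weight ρ * mult χ ρ : ℕ) * (step (v - ρ.im) - step (u - ρ.im))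

lemma step_mono {x y : ℝ} (h : x ≤ y) : step x ≤ step y := by
  unfold step
  rcases lt_trichotomy x 0 with hx | rfl | hx
  · rw [if_pos hx]; split_ifs <;> norm_num
  · rw [if_neg (lt_irrefl _), if_pos rfl, if_neg h.not_gt]; split_ifs <;> norm_num
  · rw [if_neg hx.not_gt, if_neg hx.ne', if_neg (by linarith), if_neg (by linarith)]

lemma step_of_neg {x : ℝ} (h : x < 0) : step x = 0 := by simp [step, h]

lemma step_of_pos {x : ℝ} (h : 0 < x) : step x = 1 := by simp [step, h.not_gt, h.ne']

lemma step_zero : step 0 = 1 / 2 := by simp [step]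

lemma jump_nonneg {u v : ℝ} (h : u ≤ v) (ρ : ℂ) : 0 ≤ jump χ u v ρ :=
  mul_nonneg (Nat.cast_nonneg _) (sub_nonneg.mpr (step_mono (by linarith)))

lemma heightArg_sub (hk : 1 < k) (hχ : χ.IsPrimitive) {R u v : ℝ}
    (hu : |u| ≤ R) (hv : |v| ≤ R) (hu' : NoZerosRight χ u) (hv' : NoZerosRight χ v) :
    heightArg χ v - heightArg χ u = Real.pi * ∑ ρ ∈ zerosFinset χ R, jump χ u v ρ := by
  obtain ⟨N, hN⟩ := exists_heightArg_eq hk hχ ((abs_nonneg u).trans hu)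
  rw [hN u hu hu', hN v hv hv', ← mul_sub, add_sub_add_left_eq_sub, stepSum, stepSum,
    ← Finset.sum_sub_distrib]
  congr 1
  exact Finset.sum_congr rfl fun ρ _ => by rw [jump]; ring

lemma weight_of_lt {ρ : ℂ} (h : ρ.re < 1 / 2) : weight ρ = 0 := if_pos h

lemma weight_linePoint (t : ℝ) : weight (linePoint t) = 1 := by simp [weight, linePoint_re]

lemma linePoint_injective : Function.Injective linePoint := fun x y h => by
  have := congrArg im h
  rwa [linePoint_im, linePoint_im] at this

lemma eq_linePoint {s : ℂ} (h : s.re = 1 / 2) : s = linePoint s.im := by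
  apply Complex.ext
  · rw [h, linePoint_re]
  · rw [linePoint_im]

lemma mem_zerosFinset_of (hχ : χ ≠ 1) {R : ℝ} {s : ℂ} (h0 : 0 < s.re) (hR : |s.im| ≤ R)
    (h : χ.LFunction s = 0) : s ∈ zerosFinset χ R :=
  (mem_zerosFinset hχ).mpr ⟨⟨h0, by linarith⟩, h⟩

lemma linePoint_mem_zerosFinset (hχ : χ ≠ 1) {R t : ℝ} (hR : |t| ≤ R)
    (h : χ.LFunction (linePoint t) = 0) : linePoint t ∈ zerosFinset χ R :=
  mem_zerosFinset_of hχ (by rw [linePoint_re]; norm_num) (by rwa [linePoint_im]) h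

lemma one_le_mult (hχ : χ ≠ 1) {s : ℂ} (h : χ.LFunction s = 0) : 1 ≤ mult χ s :=
  Nat.one_le_iff_ne_zero.mpr ((order_ne_zero_iff hχ s).mpr h)

lemma mult_eq_zero (hχ : χ ≠ 1) {s : ℂ} (h : χ.LFunction s ≠ 0) : mult χ s = 0 := by
  by_contra h2
  exact h ((order_ne_zero_iff hχ s).mp h2)

/-- Only a zero at 1/2 + iu itself contributes a half-integer. Zeros at the same height to the left
have weight 0, none lies to the right, and at other heights the step is 0 or 1. -/
lemma heightArg_eq_int_add (hk : 1 < k) (hχ : χ.IsPrimitive) {u : ℝ} (h : NoZerosRight χ u) :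
    ∃ M : ℤ, heightArg χ u = (M + (mult χ (linePoint u) : ℝ) / 2) * Real.pi := by
  have h1 := ne_one_of_isPrimitive hk hχ
  obtain ⟨N, hN⟩ := exists_heightArg_eq hk hχ (abs_nonneg u)
  rw [hN u le_rfl h]
  set Z := zerosFinset χ |u|
  have hterm : ∀ ρ ∈ Z, ∃ M : ℤ, (weight ρ * mult χ ρ : ℕ) * step (u - ρ.im) =
      M + if ρ = linePoint u then (mult χ (linePoint u) : ℝ) / 2 else 0 := by
    intro ρ hρ
    by_cases h2 : ρ = linePoint u
    · refine ⟨0, ?_⟩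
      rw [if_pos h2, h2, weight_linePoint, linePoint_im, sub_self, step_zero]
      push_cast; ring
    · rw [if_neg h2]
      by_cases h3 : ρ.im = u
      · have h4 : ρ.re < 1 / 2 := by
          rcases lt_trichotomy ρ.re (1 / 2) with h5 | h5 | h5
          · exact h5
          · exact absurd (h3 ▸ eq_linePoint h5) h2
          · exact absurd ((mem_zerosFinset h1).mp hρ).2 (h ρ h5 h3)
        exact ⟨0, by simp [weight_of_lt h4]⟩
      · obtain ⟨n, hn⟩ := exists_int_step (sub_ne_zero.mpr (Ne.symm h3))
        refine ⟨(weight ρ * mult χ ρ : ℕ) * n, ?_⟩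
        rw [hn]; push_cast; ring
  choose! f hf using hterm
  refine ⟨N + ∑ ρ ∈ Z, f ρ, ?_⟩
  rw [stepSum, Finset.sum_congr rfl hf, Finset.sum_add_distrib, Finset.sum_ite_eq' Z]
  have : (if linePoint u ∈ Z then (mult χ (linePoint u) : ℝ) / 2 else 0) =
      (mult χ (linePoint u) : ℝ) / 2 := by
    split_ifs with h2
    · rfl
    · have : mult χ (linePoint u) = 0 := mult_eq_zero h1 fun h0 =>
        h2 (linePoint_mem_zerosFinset h1 le_rfl h0)
      simp [this]
  rw [this]
  push_cast
  ring

lemma exists_index_iff_odd (hk : 1 < k) (hχ : χ.IsPrimitive) {u : ℝ} (h : NoZerosRight χ u) :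
    (∃ n : ℤ, IsSolution χ n u) ↔ Odd (mult χ (linePoint u)) := by
  obtain ⟨M, hM⟩ := heightArg_eq_int_add hk hχ h
  simp only [isSolution_iff_heightArg hk hχ, h, true_and, hM]
  constructor
  · rintro ⟨n, hn⟩
    have h2 := mul_right_cancel₀ Real.pi_ne_zero hn
    have h3 : (mult χ (linePoint u) : ℝ) = 2 * (n - M - 1) + 1 := by linarith
    have h4 : (mult χ (linePoint u) : ℤ) = 2 * (n - M - 1) + 1 := by exact_mod_cast h3
    have h5 : Odd (mult χ (linePoint u) : ℤ) := ⟨_, h4⟩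
    exact_mod_cast h5
  · rintro ⟨j, hj⟩
    refine ⟨M + j + 1, ?_⟩
    rw [hj]; push_cast; ring

lemma IsSolution.isZero (hk : 1 < k) (hχ : χ.IsPrimitive) {n : ℤ} {t : ℝ}
    (h : IsSolution χ n t) : χ.LFunction (linePoint t) = 0 := by
  have h1 := ((isSolution_iff_heightArg hk hχ).mp h).1
  have h2 := (exists_index_iff_odd hk hχ h1).mp ⟨n, h⟩
  exact (order_ne_zero_iff (ne_one_of_isPrimitive hk hχ) _).mp h2.pos.ne'

/-- All jumps are nonnegative, and the zero at the later solution adds at least its half-jump, so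
the total argument strictly increases. -/
lemma IsSolution.index_lt (hk : 1 < k) (hχ : χ.IsPrimitive) {n n' : ℤ} {t t' : ℝ}
    (h : IsSolution χ n t) (h' : IsSolution χ n' t') (htt : t < t') : n < n' := by
  have h1 := ne_one_of_isPrimitive hk hχ
  obtain ⟨a1, a2⟩ := (isSolution_iff_heightArg hk hχ).mp h
  obtain ⟨b1, b2⟩ := (isSolution_iff_heightArg hk hχ).mp h'
  have hs := heightArg_sub hk hχ (le_max_left |t| |t'|) (le_max_right |t| |t'|) a1 b1
  set Z := zerosFinset χ (max |t| |t'|)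
  have hmem : linePoint t' ∈ Z := linePoint_mem_zerosFinset h1 (le_max_right _ _) (h'.isZero hk hχ)
  have hj : 0 < jump χ t t' (linePoint t') := by
    rw [jump, weight_linePoint, linePoint_im, sub_self, step_zero, step_of_neg (by linarith)]
    have := one_le_mult h1 (h'.isZero hk hχ)
    have h3 : (0 : ℝ) < (1 * mult χ (linePoint t') : ℕ) := by
      rw [one_mul]; exact_mod_cast this
    positivity
  have hsum : 0 < ∑ ρ ∈ Z, jump χ t t' ρ :=
    hj.trans_le (Finset.single_le_sum (fun ρ _ => jump_nonneg htt.le ρ) hmem)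
  rw [a2, b2] at hs
  have hpos : 0 < Real.pi * ∑ ρ ∈ Z, jump χ t t' ρ := mul_pos Real.pi_pos hsum
  have h4 : ((n : ℝ) - 1 / 2) * Real.pi < (n' - 1 / 2) * Real.pi := by linarith
  have h5 := lt_of_mul_lt_mul_right h4 Real.pi_pos.le
  exact_mod_cast (by linarith : (n : ℝ) < n')

lemma IsSolution.unique (hk : 1 < k) (hχ : χ.IsPrimitive) {n : ℤ} {t t' : ℝ}
    (h : IsSolution χ n t) (h' : IsSolution χ n t') : t = t' := by
  rcases lt_trichotomy t t' with h1 | h1 | h1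
  · exact absurd (h.index_lt hk hχ h' h1) (lt_irrefl _)
  · exact h1
  · exact absurd (h'.index_lt hk hχ h h1) (lt_irrefl _)

lemma IsSolution.lt_of_index_lt (hk : 1 < k) (hχ : χ.IsPrimitive) {n n' : ℤ} {t t' : ℝ}
    (h : IsSolution χ n t) (h' : IsSolution χ n' t') (hnn : n < n') : t < t' := by
  by_contra! h1
  rcases h1.lt_or_eq with h2 | h2
  · exact absurd (h'.index_lt hk hχ h h2) (by omega)
  · subst h2
    have a := ((isSolution_iff_heightArg hk hχ).mp h).2
    have b := ((isSolution_iff_heightArg hk hχ).mp h').2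
    rw [a] at b
    have := mul_right_cancel₀ Real.pi_ne_zero b
    have h3 : (n : ℝ) = n' := by linarith
    exact absurd (by exact_mod_cast h3) hnn.ne

/-- The increase is exactly π. The two end zeros already use half their orders, at least 1/2 each,
so both orders are 1. A zero strictly between with real part ≥ 1/2 would contribute at least 1 more.
-/
lemma IsSolution.consecutive (hk : 1 < k) (hχ : χ.IsPrimitive) {n : ℤ} {t t' : ℝ}
    (h : IsSolution χ n t) (h' : IsSolution χ (n + 1) t') :
    mult χ (linePoint t) = 1 ∧
      ∀ s : ℂ, 1 / 2 ≤ s.re → t < s.im → s.im < t' → χ.LFunction s ≠ 0 := by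
  have h1 := ne_one_of_isPrimitive hk hχ
  have htt := h.lt_of_index_lt hk hχ h' (by omega)
  obtain ⟨a1, a2⟩ := (isSolution_iff_heightArg hk hχ).mp h
  obtain ⟨b1, b2⟩ := (isSolution_iff_heightArg hk hχ).mp h'
  have hs := heightArg_sub hk hχ (le_max_left |t| |t'|) (le_max_right |t| |t'|) a1 b1
  set R := max |t| |t'| with hR
  set Z := zerosFinset χ R
  have hmem : linePoint t ∈ Z := linePoint_mem_zerosFinset h1 (le_max_left _ _) (h.isZero hk hχ)
  have hmem' : linePoint t' ∈ Z :=
    linePoint_mem_zerosFinset h1 (le_max_right _ _) (h'.isZero hk hχ)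
  have hsum : ∑ ρ ∈ Z, jump χ t t' ρ = 1 := by
    rw [a2, b2] at hs
    have : Real.pi * ∑ ρ ∈ Z, jump χ t t' ρ = Real.pi * 1 := by
      rw [← hs]; push_cast; ring
    exact mul_left_cancel₀ Real.pi_ne_zero this
  have hj : jump χ t t' (linePoint t) = mult χ (linePoint t) / 2 := by
    rw [jump, weight_linePoint, linePoint_im, sub_self, step_zero, step_of_pos (by linarith)]
    push_cast; ring
  have hj' : jump χ t t' (linePoint t') = mult χ (linePoint t') / 2 := by
    rw [jump, weight_linePoint, linePoint_im, sub_self, step_zero, step_of_neg (by linarith)]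
    push_cast; ring
  have hne : linePoint t ≠ linePoint t' := fun hh => htt.ne (linePoint_injective hh)
  have m1 : (1 : ℝ) ≤ mult χ (linePoint t) := by exact_mod_cast one_le_mult h1 (h.isZero hk hχ)
  have m1' : (1 : ℝ) ≤ mult χ (linePoint t') := by
    exact_mod_cast one_le_mult h1 (h'.isZero hk hχ)
  constructor
  · have h2 : ∑ ρ ∈ {linePoint t, linePoint t'}, jump χ t t' ρ ≤ 1 := by
      rw [← hsum]
      refine Finset.sum_le_sum_of_subset_of_nonneg ?_ fun ρ _ _ => jump_nonneg htt.le ρ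
      intro x hx
      simp only [Finset.mem_insert, Finset.mem_singleton] at hx
      rcases hx with rfl | rfl <;> assumption
    rw [Finset.sum_pair hne, hj, hj'] at h2
    have h3 : (mult χ (linePoint t) : ℝ) = 1 := by linarith
    exact_mod_cast h3
  · intro s hs1 hs2 hs3 h0
    have hsR : |s.im| ≤ R := by
      rw [abs_le]
      have e1 := neg_abs_le t
      have e2 := le_abs_self t'
      have e3 := le_max_left |t| |t'|
      have e4 := le_max_right |t| |t'|
      constructor <;> linarith
    have hsm : s ∈ Z := mem_zerosFinset_of h1 (by linarith) hsR h0
    have hjs : 1 ≤ jump χ t t' s := by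
      rw [jump, step_of_pos (by linarith), step_of_neg (by linarith), sub_zero, mul_one]
      have hw : 1 ≤ weight s := by
        rw [weight, if_neg (by linarith)]; split_ifs <;> norm_num
      exact_mod_cast Nat.mul_le_mul hw (one_le_mult h1 h0)
    have n1 : linePoint t ≠ s := fun hh => by rw [← hh, linePoint_im] at hs2; linarith
    have n2 : linePoint t' ≠ s := fun hh => by rw [← hh, linePoint_im] at hs3; linarith
    have h2 : ∑ ρ ∈ {linePoint t, linePoint t', s}, jump χ t t' ρ ≤ 1 := by
      rw [← hsum]
      refine Finset.sum_le_sum_of_subset_of_nonneg ?_ fun ρ _ _ => jump_nonneg htt.le ρ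
      intro x hx
      simp only [Finset.mem_insert, Finset.mem_singleton] at hx
      rcases hx with rfl | rfl | rfl <;> assumption
    rw [Finset.sum_insert (by simp [hne, n1]), Finset.sum_pair n2, hj, hj'] at h2
    linarith

/-! ### Unique solvability versus simplicity of the zeros on the line. -/

lemma finite_line_zeros (hχ : χ ≠ 1) (a b : ℝ) :
    {t : ℝ | t ∈ Set.Icc a b ∧ χ.LFunction (linePoint t) = 0}.Finite := by
  have hf := finite_zeros_of_isCompact hχ
    ((isCompact_Icc (a := a) (b := b)).image continuous_linePoint)
  have : linePoint '' {t : ℝ | t ∈ Set.Icc a b ∧ χ.LFunction (linePoint t) = 0} ⊆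
      linePoint '' Set.Icc a b ∩ {s | χ.LFunction s = 0} := by
    rintro _ ⟨t, ⟨h1, h2⟩, rfl⟩
    exact ⟨⟨t, h1, rfl⟩, h2⟩
  exact (hf.subset this).of_finite_image linePoint_injective.injOn

/-- The solutions are distinct zeros on the line, and a bounded interval holds finitely many. So the
increasing sequence is unbounded in both directions and its half-open gaps cover ℝ. -/
lemma UniquelySolvable.exists_between (hk : 1 < k) (hχ : χ.IsPrimitive) {t : ℤ → ℝ}
    (ht : ∀ n, IsSolution χ n (t n)) (u : ℝ) : ∃ n, t n ≤ u ∧ u < t (n + 1) := by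
  have h1 := ne_one_of_isPrimitive hk hχ
  have hmono : StrictMono t := fun n m hnm => (ht n).lt_of_index_lt hk hχ (ht m) hnm
  have hfin : ∀ a b : ℝ, {n : ℤ | t n ∈ Set.Icc a b}.Finite := by
    intro a b
    refine Set.Finite.of_finite_image (f := t) ?_ hmono.injective.injOn
    refine (finite_line_zeros h1 a b).subset ?_
    rintro _ ⟨n, hn, rfl⟩
    exact ⟨hn, (ht n).isZero hk hχ⟩
  have hlow : ∃ n, t n ≤ u := by
    by_contra! h
    refine (Set.infinite_of_injective_forall_mem (f := fun j : ℕ => -(j : ℤ))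
      (fun a b hab => by simpa using hab) fun j => ?_) (hfin u (t 0))
    exact ⟨(h _).le, hmono.monotone (by simp)⟩
  have hup : ∃ b : ℤ, ∀ z, t z ≤ u → z ≤ b := by
    by_contra! h
    refine (Set.infinite_of_injective_forall_mem (f := fun j : ℕ => (j : ℤ))
      (fun a b hab => by simpa using hab) fun j => ?_) (hfin (t 0) u)
    obtain ⟨z, hz, hjz⟩ := h j
    exact ⟨hmono.monotone (by simp), (hmono.monotone hjz.le).trans hz⟩
  obtain ⟨n, hn, hmax⟩ := Int.exists_greatest_of_bdd hup hlow
  refine ⟨n, hn, ?_⟩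
  by_contra! h
  have := hmax _ h
  omega

lemma UniquelySolvable.argLimitExists_and_simpleOnLine (hk : 1 < k) (hχ : χ.IsPrimitive)
    (h : UniquelySolvable χ) : ArgLimitExists χ ∧ SimpleOnLine χ := by
  choose t ht _ using h
  rw [argLimitExists_iff hk hχ]
  have hb := UniquelySolvable.exists_between hk hχ ht
  constructor
  · intro u s hs hi
    obtain ⟨n, hn, hn'⟩ := hb u
    rcases hn.lt_or_eq with h1 | h1
    · exact ((ht n).consecutive hk hχ (ht (n + 1))).2 s hs.le (by rwa [hi]) (by rwa [hi])
    · exact ((isSolution_iff_heightArg hk hχ).mp (ht n)).1 s hs (by rw [hi, h1])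
  · intro u hu
    obtain ⟨n, hn, hn'⟩ := hb u
    rcases hn.lt_or_eq with h1 | h1
    · exact absurd hu (((ht n).consecutive hk hχ (ht (n + 1))).2 (linePoint u)
        (by rw [linePoint_re]) (by rwa [linePoint_im]) (by rwa [linePoint_im]))
    · rw [← h1]
      exact ((ht n).consecutive hk hχ (ht (n + 1))).1

/-- With no zeros to the right, only the two simple end zeros have a nonzero jump between these
heights, and each gives half of π. -/
lemma isSolution_of_consecutive_zeros (hk : 1 < k) (hχ : χ.IsPrimitive)
    (hA : ∀ t, NoZerosRight χ t) (hS : SimpleOnLine χ) {t t' : ℝ} (htt : t < t')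
    (h0 : χ.LFunction (linePoint t) = 0) (h0' : χ.LFunction (linePoint t') = 0)
    (hne : ∀ u, t < u → u < t' → χ.LFunction (linePoint u) ≠ 0) :
    heightArg χ t' = heightArg χ t + Real.pi := by
  have h1 := ne_one_of_isPrimitive hk hχ
  have hs := heightArg_sub hk hχ (le_max_left |t| |t'|) (le_max_right |t| |t'|) (hA t) (hA t')
  set R := max |t| |t'| with hR
  set Z := zerosFinset χ R
  have hmem : linePoint t ∈ Z := linePoint_mem_zerosFinset h1 (le_max_left _ _) h0
  have hmem' : linePoint t' ∈ Z := linePoint_mem_zerosFinset h1 (le_max_right _ _) h0'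
  have hj : jump χ t t' (linePoint t) = 1 / 2 := by
    rw [jump, weight_linePoint, linePoint_im, sub_self, step_zero, step_of_pos (by linarith),
      mult, hS t h0]
    norm_num
  have hj' : jump χ t t' (linePoint t') = 1 / 2 := by
    rw [jump, weight_linePoint, linePoint_im, sub_self, step_zero, step_of_neg (by linarith),
      mult, hS t' h0']
    norm_num
  have hne' : linePoint t ≠ linePoint t' := fun hh => htt.ne (linePoint_injective hh)
  have hsum : ∑ ρ ∈ Z, jump χ t t' ρ = ∑ ρ ∈ {linePoint t, linePoint t'}, jump χ t t' ρ := by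
    symm
    refine Finset.sum_subset ?_ ?_
    · intro x hx
      simp only [Finset.mem_insert, Finset.mem_singleton] at hx
      rcases hx with rfl | rfl <;> assumption
    · intro ρ hρ hρn
      simp only [Finset.mem_insert, Finset.mem_singleton, not_or] at hρn
      have hz := ((mem_zerosFinset h1).mp hρ).2
      rcases lt_trichotomy ρ.re (1 / 2) with h5 | h5 | h5
      · simp [jump, weight_of_lt h5]
      · have hl := eq_linePoint h5
        have c1 : ρ.im ≠ t := fun hh => hρn.1 (hh ▸ hl)
        have c2 : ρ.im ≠ t' := fun hh => hρn.2 (hh ▸ hl)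
        rw [jump]
        rcases lt_or_gt_of_ne c1 with d1 | d1
        · rw [step_of_pos (by linarith), step_of_pos (by linarith)]; ring
        · rcases lt_or_gt_of_ne c2 with d2 | d2
          · exact absurd (hl ▸ hz) (hne _ d1 d2)
          · rw [step_of_neg (by linarith), step_of_neg (by linarith)]; ring
      · exact absurd hz (hA _ ρ h5 rfl)
  rw [hsum, Finset.sum_pair hne', hj, hj'] at hs
  linarith

lemma exists_next_zero (hχ : χ ≠ 1)
    (hinf : {t : ℝ | 0 < t ∧ χ.LFunction (linePoint t) = 0}.Infinite) (t : ℝ) :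
    ∃ t', t < t' ∧ χ.LFunction (linePoint t') = 0 ∧
      ∀ u, t < u → u < t' → χ.LFunction (linePoint u) ≠ 0 := by
  obtain ⟨b, hb, hb0⟩ : ∃ b, t < b ∧ χ.LFunction (linePoint b) = 0 := by
    by_contra! h
    refine hinf ((finite_line_zeros hχ 0 t).subset ?_)
    rintro u ⟨hu, hu0⟩
    exact ⟨⟨hu.le, not_lt.mp fun hh => h u hh hu0⟩, hu0⟩
  have hf : {u : ℝ | (t < u ∧ u ≤ b) ∧ χ.LFunction (linePoint u) = 0}.Finite :=
    (finite_line_zeros hχ t b).subset fun u hu => ⟨⟨hu.1.1.le, hu.1.2⟩, hu.2⟩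
  obtain ⟨t', ht', hmin⟩ := Set.exists_min_image _ id hf ⟨b, ⟨hb, le_rfl⟩, hb0⟩
  refine ⟨t', ht'.1.1, ht'.2, fun u h1 h2 h0 => ?_⟩
  have := hmin u ⟨⟨h1, h2.le.trans ht'.1.2⟩, h0⟩
  simp only [id] at this
  linarith

lemma exists_prev_zero (hχ : χ ≠ 1)
    (hinf : {t : ℝ | t < 0 ∧ χ.LFunction (linePoint t) = 0}.Infinite) (t : ℝ) :
    ∃ t', t' < t ∧ χ.LFunction (linePoint t') = 0 ∧
      ∀ u, t' < u → u < t → χ.LFunction (linePoint u) ≠ 0 := by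
  obtain ⟨b, hb, hb0⟩ : ∃ b, b < t ∧ χ.LFunction (linePoint b) = 0 := by
    by_contra! h
    refine hinf ((finite_line_zeros hχ t 0).subset ?_)
    rintro u ⟨hu, hu0⟩
    exact ⟨⟨not_lt.mp fun hh => h u hh hu0, hu.le⟩, hu0⟩
  have hf : {u : ℝ | (b ≤ u ∧ u < t) ∧ χ.LFunction (linePoint u) = 0}.Finite :=
    (finite_line_zeros hχ b t).subset fun u hu => ⟨⟨hu.1.1, hu.1.2.le⟩, hu.2⟩
  obtain ⟨t', ht', hmax⟩ := Set.exists_max_image _ id hf ⟨b, ⟨le_rfl, hb⟩, hb0⟩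
  refine ⟨t', ht'.1.2, ht'.2, fun u h1 h2 h0 => ?_⟩
  have := hmax u ⟨⟨ht'.1.1.trans h1.le, h2⟩, h0⟩
  simp only [id] at this
  linarith

lemma uniquelySolvable_of_simple (hk : 1 < k) (hχ : χ.IsPrimitive)
    (hpos : {t : ℝ | 0 < t ∧ χ.LFunction (linePoint t) = 0}.Infinite)
    (hneg : {t : ℝ | t < 0 ∧ χ.LFunction (linePoint t) = 0}.Infinite)
    (hA : ArgLimitExists χ) (hS : SimpleOnLine χ) : UniquelySolvable χ := by
  have h1 := ne_one_of_isPrimitive hk hχ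
  have hA' := (argLimitExists_iff hk hχ).mp hA
  have hsol : ∀ t, χ.LFunction (linePoint t) = 0 → ∃ n : ℤ, IsSolution χ n t := fun t ht =>
    (exists_index_iff_odd hk hχ (hA' t)).mpr (by rw [mult, hS t ht]; exact odd_one)
  have hup : ∀ n : ℤ, (∃ t, IsSolution χ n t) → ∃ t, IsSolution χ (n + 1) t := by
    rintro n ⟨t, ht⟩
    obtain ⟨t', h2, h3, h4⟩ := exists_next_zero h1 hpos t
    have h5 := isSolution_of_consecutive_zeros hk hχ hA' hS h2 (ht.isZero hk hχ) h3 h4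
    refine ⟨t', (isSolution_iff_heightArg hk hχ).mpr ⟨hA' t', ?_⟩⟩
    rw [h5, ((isSolution_iff_heightArg hk hχ).mp ht).2]
    push_cast; ring
  have hdown : ∀ n : ℤ, (∃ t, IsSolution χ n t) → ∃ t, IsSolution χ (n - 1) t := by
    rintro n ⟨t, ht⟩
    obtain ⟨t', h2, h3, h4⟩ := exists_prev_zero h1 hneg t
    have h5 := isSolution_of_consecutive_zeros hk hχ hA' hS h2 h3 (ht.isZero hk hχ) h4
    refine ⟨t', (isSolution_iff_heightArg hk hχ).mpr ⟨hA' t', ?_⟩⟩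
    rw [((isSolution_iff_heightArg hk hχ).mp ht).2] at h5
    push_cast
    linarith
  obtain ⟨t₀, -, ht₀⟩ := hpos.nonempty
  obtain ⟨n₀, hn₀⟩ := hsol t₀ ht₀
  have hall : ∀ n : ℤ, ∃ t, IsSolution χ n t := by
    intro n
    -- Any positive zero solves some equation. Moving to the next or previous zero changes the index
    -- by one, and the infinitude of zeros on both sides ensures that neither direction stops.
    refine Int.inductionOn' n n₀ ⟨t₀, hn₀⟩ (fun m _ hm => hup m hm) (fun m _ hm => hdown m hm)
  intro n
  obtain ⟨t, ht⟩ := hall n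
  exact ⟨t, ht, fun t' ht' => ht'.unique hk hχ ht⟩

/-! ### Counting zeros and enumerating them. -/

/-- Γ(conj z) = conj Γ(z) makes argGamma(−x) + argGamma(x) a multiple of 2π; by continuity it keeps
its value 0 at x = 0. -/
lemma thetaRS_neg (k a : ℕ) (t : ℝ) : thetaRS k a (-t) = -thetaRS k a t := by
  have hc : (0 : ℝ) < 1 / 4 + (a : ℝ) / 2 := by positivity
  set c : ℝ := 1 / 4 + (a : ℝ) / 2 with hcdef
  have hcont := continuous_argGamma hc
  have hmul : ∀ x ∈ (Set.univ : Set ℝ), ∃ n : ℤ,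
      argGamma c (-x) + argGamma c x = n * (2 * Real.pi) := by
    intro x _
    have h1 := Gamma_eq_norm_mul_exp_argGamma hc x
    have h2 := Gamma_eq_norm_mul_exp_argGamma hc (-x)
    have h3 : (c : ℂ) + I * (((-x : ℝ) : ℂ) / 2) = conj ((c : ℂ) + I * (x / 2)) := by
      rw [map_add, map_mul, conj_I, conj_ofReal, map_div₀, conj_ofReal, map_ofNat]
      push_cast
      ring
    rw [h3, Gamma_conj, RCLike.norm_conj] at h2
    conv_lhs at h2 => rw [h1]
    rw [map_mul, conj_ofReal, ← exp_conj, map_mul, conj_ofReal, conj_I] at h2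
    have hne : (‖Gamma ((c : ℂ) + I * (x / 2))‖ : ℂ) ≠ 0 := by
      simpa using Gamma_ne_zero_of_re_pos (s := (c : ℂ) + I * (x / 2)) (by simpa using hc)
    have h4 := mul_left_cancel₀ hne h2
    obtain ⟨n, hn⟩ := exists_int_mul_two_pi (x := argGamma c (-x)) (y := -argGamma c x)
      (by rw [← h4]; push_cast; ring_nf)
    exact ⟨n, by linarith⟩
  have h5 := eq_of_continuousOn_of_mem_zmultiples isPreconnected_univ
    ((hcont.comp continuous_neg).add hcont).continuousOn hmul (Set.mem_univ t) (Set.mem_univ 0)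
  simp only [Pi.add_apply, Function.comp_apply, neg_zero, argGamma_zero, add_zero] at h5
  rw [thetaRS, thetaRS, ← hcdef]
  linarith

lemma zeroCount_eq_sum (hχ : χ ≠ 1) {R : ℝ} {S : Set ℂ} [DecidablePred (· ∈ S)]
    (hS : S ⊆ halfStrip R) :
    zeroCount χ S = ∑ ρ ∈ zerosFinset χ R, if ρ ∈ S then mult χ ρ else 0 := by
  rw [zeroCount, ← Finset.sum_filter]
  apply finsum_mem_eq_sum_of_inter_support_eq
  ext s
  simp only [Set.mem_inter_iff, Function.mem_support, order_ne_zero_iff hχ, Finset.coe_filter,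
    Set.mem_ofPred_eq, mem_zerosFinset hχ, zerosIn]
  constructor
  · rintro ⟨h1, h2⟩
    exact ⟨⟨⟨hS h1, h2⟩, h1⟩, h2⟩
  · rintro ⟨⟨_, h1⟩, h2⟩
    exact ⟨h1, h2⟩

lemma zeroCount_congr (hχ : χ ≠ 1) {S S' : Set ℂ}
    (h : ∀ s, χ.LFunction s = 0 → (s ∈ S ↔ s ∈ S')) : zeroCount χ S = zeroCount χ S' := by
  have hI : S ∩ Function.support (fun s => analyticOrderNatAt χ.LFunction s) =
      S' ∩ Function.support (fun s => analyticOrderNatAt χ.LFunction s) := by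
    ext s
    simp only [Set.mem_inter_iff, Function.mem_support, order_ne_zero_iff hχ]
    exact and_congr_left fun h2 => h s h2
  rw [zeroCount, zeroCount, ← finsum_mem_inter_support, hI, finsum_mem_inter_support]

/-- A zero left of the line would be reflected by s ↦ 1 − conj s to one at the same height on the
right, where none exists. -/
lemma re_eq_half_of_zero (hk : 1 < k) (hχ : χ.IsPrimitive) (hA : ∀ t, NoZerosRight χ t)
    {s : ℂ} (hs : 0 < s.re) (hs1 : s.re < 1) (h0 : χ.LFunction s = 0) : s.re = 1 / 2 := by
  rcases lt_trichotomy s.re (1 / 2) with h | h | h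
  · exact absurd (LFunction_one_sub_conj_eq_zero hk hχ hs hs1 h0)
      (hA _ _ (by simp; linarith) rfl)
  · exact h
  · exact absurd h0 (hA _ s h rfl)

lemma lineCountPos_eq (hk : 1 < k) (hχ : χ.IsPrimitive) (hA : ∀ t, NoZerosRight χ t) (T : ℝ) :
    lineCountPos χ T = stripCountPos χ T := by
  refine zeroCount_congr (ne_one_of_isPrimitive hk hχ) fun s h0 => ⟨?_, ?_⟩
  · rintro ⟨h1, h2⟩
    exact ⟨by rw [h1]; norm_num, by rw [h1]; norm_num, h2⟩
  · rintro ⟨h1, h2, h3⟩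
    exact ⟨re_eq_half_of_zero hk hχ hA h1 h2 h0, h3⟩

lemma lineCountNeg_eq (hk : 1 < k) (hχ : χ.IsPrimitive) (hA : ∀ t, NoZerosRight χ t) (T : ℝ) :
    lineCountNeg χ T = stripCountNeg χ T := by
  refine zeroCount_congr (ne_one_of_isPrimitive hk hχ) fun s h0 => ⟨?_, ?_⟩
  · rintro ⟨h1, h2⟩
    exact ⟨by rw [h1]; norm_num, by rw [h1]; norm_num, h2⟩
  · rintro ⟨h1, h2, h3⟩
    exact ⟨re_eq_half_of_zero hk hχ hA h1 h2 h0, h3⟩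

/-- The height ε serves as base point in place of 0, so that a possible zero at s = 1/2 does not
disturb the counting of positive zeros. -/
lemma exists_gap (hχ : χ ≠ 1) :
    ∃ ε : ℝ, 0 < ε ∧ ∀ t, 0 < t → t ≤ ε → χ.LFunction (linePoint t) ≠ 0 := by
  have hf : {t : ℝ | (0 < t ∧ t ≤ 1) ∧ χ.LFunction (linePoint t) = 0}.Finite :=
    (finite_line_zeros hχ 0 1).subset fun u hu => ⟨⟨hu.1.1.le, hu.1.2⟩, hu.2⟩
  rcases Set.eq_empty_or_nonempty {t : ℝ | (0 < t ∧ t ≤ 1) ∧ χ.LFunction (linePoint t) = 0}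
    with h | h
  · refine ⟨1, one_pos, fun t h1 h2 h0 => ?_⟩
    have : t ∈ {t : ℝ | (0 < t ∧ t ≤ 1) ∧ χ.LFunction (linePoint t) = 0} := ⟨⟨h1, h2⟩, h0⟩
    rw [h] at this
    exact this
  · obtain ⟨t', ht', hmin⟩ := Set.exists_min_image _ id hf h
    refine ⟨t' / 2, by linarith [ht'.1.1], fun t h1 h2 h0 => ?_⟩
    have := hmin t ⟨⟨h1, by linarith [ht'.1.1, ht'.1.2]⟩, h0⟩
    simp only [id] at this
    linarith [ht'.1.1]

lemma heightArg_sub_eq_lineCountPos (hk : 1 < k) (hχ : χ.IsPrimitive)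
    (hA : ∀ t, NoZerosRight χ t) {ε T : ℝ} (hε : 0 < ε)
    (hgap : ∀ t, 0 < t → t ≤ ε → χ.LFunction (linePoint t) ≠ 0) (hT : 0 < T)
    (h0 : χ.LFunction (linePoint T) ≠ 0) :
    heightArg χ T - heightArg χ ε = Real.pi * lineCountPos χ T := by
  classical
  have h1 := ne_one_of_isPrimitive hk hχ
  rw [heightArg_sub hk hχ (R := max ε T) (by rw [abs_of_pos hε]; exact le_max_left _ _)
    (by rw [abs_of_pos hT]; exact le_max_right _ _) (hA _) (hA _), lineCountPos,
    zeroCount_eq_sum h1 (R := max ε T)]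
  · push_cast
    congr 1
    refine Finset.sum_congr rfl fun ρ hρ => ?_
    have hz := ((mem_zerosFinset h1).mp hρ).2
    rcases lt_trichotomy ρ.re (1 / 2) with h5 | h5 | h5
    · rw [if_neg]
      · simp [jump, weight_of_lt h5]
      · rintro ⟨h6, -⟩; linarith
    · have hl := eq_linePoint h5
      rw [hl] at hz
      have hw : weight ρ = 1 := by rw [hl, weight_linePoint]
      rw [jump, hw, one_mul]
      have c1 : ρ.im ≠ T := fun hh => h0 (hh ▸ hz)
      rcases le_or_gt ρ.im 0 with d | d
      · rw [if_neg (by rintro ⟨-, h6, -⟩; linarith), step_of_pos (by linarith),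
          step_of_pos (by linarith)]
        simp
      · have d2 : ε < ρ.im := by
          by_contra! h6
          exact hgap _ d h6 hz
        rcases lt_or_gt_of_ne c1 with d3 | d3
        · rw [if_pos ⟨h5, d, d3⟩, step_of_pos (by linarith), step_of_neg (by linarith)]
          simp
        · rw [if_neg (by rintro ⟨-, -, h6⟩; linarith), step_of_neg (by linarith),
            step_of_neg (by linarith)]
          simp
    · exact absurd hz (hA _ ρ h5 rfl)
  · rintro s ⟨h2, h3, h4⟩
    refine ⟨by rw [h2]; norm_num, ?_⟩
    rw [abs_of_pos h3]
    have := le_max_right ε T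
    linarith

/-- The heights from −T to ε include 0, so a zero at s = 1/2 would enter the increment although it
is not counted; hence the condition at 0. -/
lemma heightArg_sub_eq_lineCountNeg (hk : 1 < k) (hχ : χ.IsPrimitive)
    (hA : ∀ t, NoZerosRight χ t) {ε T : ℝ} (hε : 0 < ε)
    (hgap : ∀ t, 0 < t → t ≤ ε → χ.LFunction (linePoint t) ≠ 0) (hT : 0 < T)
    (hz0 : χ.LFunction (linePoint 0) ≠ 0) (h0 : χ.LFunction (linePoint (-T)) ≠ 0) :
    heightArg χ ε - heightArg χ (-T) = Real.pi * lineCountNeg χ T := by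
  classical
  have h1 := ne_one_of_isPrimitive hk hχ
  rw [heightArg_sub hk hχ (R := max ε T)
    (by rw [abs_neg, abs_of_pos hT]; exact le_max_right _ _)
    (by rw [abs_of_pos hε]; exact le_max_left _ _) (hA _) (hA _), lineCountNeg,
    zeroCount_eq_sum h1 (R := max ε T)]
  · push_cast
    congr 1
    refine Finset.sum_congr rfl fun ρ hρ => ?_
    have hz := ((mem_zerosFinset h1).mp hρ).2
    rcases lt_trichotomy ρ.re (1 / 2) with h5 | h5 | h5
    · rw [if_neg]
      · simp [jump, weight_of_lt h5]
      · rintro ⟨h6, -⟩; linarith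
    · have hl := eq_linePoint h5
      rw [hl] at hz
      have hw : weight ρ = 1 := by rw [hl, weight_linePoint]
      rw [jump, hw, one_mul]
      have c1 : ρ.im ≠ -T := fun hh => h0 (hh ▸ hz)
      have c2 : ρ.im ≠ 0 := fun hh => hz0 (hh ▸ hz)
      rcases lt_or_gt_of_ne c2 with d | d
      · rcases lt_or_gt_of_ne c1 with d3 | d3
        · rw [if_neg (by rintro ⟨-, h6, -⟩; linarith), step_of_pos (by linarith),
            step_of_pos (by linarith)]
          simp
        · rw [if_pos ⟨h5, d3, d⟩, step_of_pos (by linarith), step_of_neg (by linarith)]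
          simp
      · have d2 : ε < ρ.im := by
          by_contra! h6
          exact hgap _ d h6 hz
        rw [if_neg (by rintro ⟨-, -, h6⟩; linarith), step_of_neg (by linarith),
          step_of_neg (by linarith)]
        simp
    · exact absurd hz (hA _ ρ h5 rfl)
  · rintro s ⟨h2, h3, h4⟩
    refine ⟨by rw [h2]; norm_num, ?_⟩
    rw [abs_of_neg h4]
    have := le_max_right ε T
    linarith

/-- This fixes the shift n₀. Relative to the base height ε, the index n − n₀ asks for an increase of
(n − 1/2)π, so the first zero above ε gets n = 1 when all zeros on the line are simple. -/
lemma exists_heightArg_gap_eq (hk : 1 < k) (hχ : χ.IsPrimitive) (hA : ∀ t, NoZerosRight χ t)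
    {ε : ℝ} (h0 : χ.LFunction (linePoint ε) ≠ 0) :
    ∃ n₀ : ℤ, heightArg χ ε = -n₀ * Real.pi := by
  obtain ⟨M, hM⟩ := heightArg_eq_int_add hk hχ (hA ε)
  refine ⟨-M, ?_⟩
  rw [hM, mult_eq_zero (ne_one_of_isPrimitive hk hχ) h0]
  push_cast
  ring

lemma zeroCount_eq_ncard (hχ : χ ≠ 1) {t : ℤ → ℝ} (ht : Function.Injective t) {S : Set ℂ}
    {P : ℝ → Prop} (hS : ∀ s ∈ S, χ.LFunction s = 0 → ∃ n, s = linePoint (t n))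
    (h1 : ∀ n, mult χ (linePoint (t n)) = 1) (hP : ∀ u, linePoint u ∈ S ↔ P u) :
    zeroCount χ S = {n : ℤ | P (t n)}.ncard := by
  have himg : S ∩ Function.support (fun s => mult χ s) =
      (fun n => linePoint (t n)) '' {n : ℤ | P (t n)} := by
    ext s
    constructor
    · rintro ⟨hs, h0⟩
      obtain ⟨n, rfl⟩ := hS s hs ((order_ne_zero_iff hχ s).mp h0)
      exact ⟨n, (hP _).mp hs, rfl⟩
    · rintro ⟨n, hn, rfl⟩
      exact ⟨(hP _).mpr hn, by simp [h1 n]⟩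
  rw [zeroCount, ← finsum_mem_inter_support, himg, ← Set.ncard_image_of_injective
    {n : ℤ | P (t n)} (f := fun n => linePoint (t n)) (linePoint_injective.comp ht),
    ← finsum_one]
  refine finsum_mem_congr rfl ?_
  rintro _ ⟨n, -, rfl⟩
  exact h1 n

lemma exists_enumeration (hk : 1 < k) (hχ : χ.IsPrimitive) (hU : UniquelySolvable χ)
    (hA : ∀ t, NoZerosRight χ t) (hS : SimpleOnLine χ) {ε : ℝ} (hε : 0 < ε)
    (hgap : ∀ t, 0 < t → t ≤ ε → χ.LFunction (linePoint t) ≠ 0) {n₀ : ℤ}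
    (hn₀ : heightArg χ ε = -n₀ * Real.pi) :
    ∃ t : ℤ → ℝ,
        StrictMono t ∧
        (∀ n : ℤ, 0 < t n ↔ 1 ≤ n) ∧
        (∀ (n : ℤ) (τ : ℝ), IsSolution χ (n - n₀) τ ↔ τ = t n) ∧
        (∀ s : ℂ, 0 < s.re → s.re < 1 → (χ.LFunction s = 0 ↔ ∃ n : ℤ, s = linePoint (t n))) ∧
        (∀ n : ℤ, analyticOrderNatAt χ.LFunction (linePoint (t n)) = 1) ∧
        (∀ T : ℝ, 0 < T →
          lineCountPos χ T = {n : ℤ | 0 < t n ∧ t n < T}.ncard ∧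
          lineCountNeg χ T = {n : ℤ | -T < t n ∧ t n < 0}.ncard) := by
  have h1 := ne_one_of_isPrimitive hk hχ
  choose τ hτ _ using hU
  set t : ℤ → ℝ := fun n => τ (n - n₀) with ht
  have htsol : ∀ n, IsSolution χ (n - n₀) (t n) := fun n => hτ _
  have hmono : StrictMono t := fun n m hnm =>
    (htsol n).lt_of_index_lt hk hχ (htsol m) (by omega)
  have hzero : ∀ n, χ.LFunction (linePoint (t n)) = 0 := fun n => (htsol n).isZero hk hχ
  have hsimple : ∀ n, analyticOrderNatAt χ.LFunction (linePoint (t n)) = 1 := fun n =>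
    hS _ (hzero n)
  have hall : ∀ s : ℂ, 0 < s.re → s.re < 1 →
      (χ.LFunction s = 0 ↔ ∃ n : ℤ, s = linePoint (t n)) := by
    intro s hs hs1
    constructor
    · intro h0
      have hl := eq_linePoint (re_eq_half_of_zero hk hχ hA hs hs1 h0)
      rw [hl] at h0
      obtain ⟨n, hn⟩ := (exists_index_iff_odd hk hχ (hA s.im)).mpr
        (by rw [mult, hS _ h0]; exact odd_one)
      refine ⟨n + n₀, ?_⟩
      rw [hl]
      congr 1
      exact hn.unique hk hχ (by simpa using htsol (n + n₀))
    · rintro ⟨n, rfl⟩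
      exact hzero n
  refine ⟨t, hmono, fun n => ?_, fun n u => ⟨fun h => h.unique hk hχ (htsol n),
    fun h => h ▸ htsol n⟩, hall, hsimple, fun T hT => ⟨?_, ?_⟩⟩
  · have hval := ((isSolution_iff_heightArg hk hχ).mp (htsol n)).2
    have hmm : ∀ {u v : ℝ}, u ≤ v → heightArg χ u ≤ heightArg χ v := by
      intro u v huv
      have h2 := heightArg_sub hk hχ (le_max_left |u| |v|) (le_max_right |u| |v|) (hA u) (hA v)
      have h3 : 0 ≤ Real.pi * ∑ ρ ∈ zerosFinset χ (max |u| |v|), jump χ u v ρ :=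
        mul_nonneg Real.pi_pos.le (Finset.sum_nonneg fun ρ _ => jump_nonneg huv ρ)
      linarith
    constructor
    · intro hpos
      have h2 : ε < t n := by
        by_contra! h
        exact hgap _ hpos h (hzero n)
      have h3 := hmm h2.le
      rw [hval, hn₀] at h3
      -- After cancelling π and n₀ the inequality reads n ≥ 1/2, which for integers is n ≥ 1.
      have h4 := le_of_mul_le_mul_right h3 Real.pi_pos
      push_cast at h4
      have h5 : (0 : ℝ) < n := by linarith
      have : (0 : ℤ) < n := by exact_mod_cast h5
      omega
    · intro hn
      by_contra! h
      have h3 := hmm (h.trans hε.le)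
      rw [hval, hn₀] at h3
      have h4 := le_of_mul_le_mul_right h3 Real.pi_pos
      push_cast at h4
      have h5 : (1 : ℝ) ≤ n := by exact_mod_cast hn
      linarith
  · refine zeroCount_eq_ncard (P := fun u => 0 < u ∧ u < T) h1 hmono.injective ?_ hsimple ?_
    · rintro s ⟨hs, -⟩ h0
      exact (hall s (by rw [hs]; norm_num) (by rw [hs]; norm_num)).mp h0
    · intro u
      simp [linePoint_re, linePoint_im]
  · refine zeroCount_eq_ncard (P := fun u => -T < u ∧ u < 0) h1 hmono.injective ?_ hsimple ?_
    · rintro s ⟨hs, -⟩ h0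
      exact (hall s (by rw [hs]; norm_num) (by rw [hs]; norm_num)).mp h0
    · intro u
      simp [linePoint_re, linePoint_im]

/-! ### Bounds for Gamma in vertical strips. -/

lemma norm_Gamma_le_Gamma_re {s : ℂ} (hs : 0 < s.re) : ‖Gamma s‖ ≤ Real.Gamma s.re := by
  rw [Gamma_eq_integral hs, Real.Gamma_eq_integral hs, GammaIntegral]
  refine (MeasureTheory.norm_integral_le_integral_norm _).trans_eq ?_
  refine MeasureTheory.setIntegral_congr_fun measurableSet_Ioi fun x hx => ?_
  have hx' : (0 : ℝ) < x := hx
  simp only [norm_mul, norm_real, Real.norm_of_nonneg (Real.exp_pos _).le,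
    norm_cpow_eq_rpow_re_of_pos hx', sub_re, one_re]

lemma norm_sq_Gamma_half {s : ℂ} (hs : s.re = 1 / 2) :
    ‖Gamma s‖ ^ 2 = Real.pi / Real.cosh (Real.pi * s.im) := by
  have hc : 1 - s = conj s := by
    apply Complex.ext
    · simp [hs]; norm_num
    · simp
  have h := Gamma_mul_Gamma_one_sub s
  rw [hc, Gamma_conj, mul_conj, normSq_eq_norm_sq] at h
  have hsin : sin (Real.pi * s) = Real.cosh (Real.pi * s.im) := by
    have : (Real.pi : ℂ) * s = (Real.pi * s.im : ℝ) * I + Real.pi / 2 := by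
      apply Complex.ext
      · simp [hs]; ring
      · simp
    rw [this, sin_add_pi_div_two, cos_mul_I, ofReal_cosh]
  rw [hsin] at h
  exact_mod_cast h

lemma norm_Gamma_half_le {s : ℂ} (hs : s.re = 1 / 2) :
    ‖Gamma s‖ ≤ √(2 * Real.pi) * Real.exp (-(Real.pi * |s.im| / 2)) := by
  refine le_of_sq_le_sq ?_ (by positivity)
  rw [norm_sq_Gamma_half hs, mul_pow, Real.sq_sqrt (by positivity), ← Real.exp_nat_mul]
  have hcosh : Real.exp (Real.pi * |s.im|) / 2 ≤ Real.cosh (Real.pi * s.im) := by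
    rw [← Real.cosh_abs, abs_mul, abs_of_pos Real.pi_pos, Real.cosh_eq]
    have := Real.exp_pos (-(Real.pi * |s.im|))
    linarith
  have he : ((2 : ℕ) : ℝ) * -(Real.pi * |s.im| / 2) = -(Real.pi * |s.im|) := by push_cast; ring
  rw [he, Real.exp_neg, div_le_iff₀ (Real.cosh_pos _)]
  have h0 := Real.exp_pos (Real.pi * |s.im|)
  calc Real.pi = 2 * Real.pi * (Real.exp (Real.pi * |s.im|))⁻¹ *
        (Real.exp (Real.pi * |s.im|) / 2) := by field_simp
    _ ≤ _ := by gcongr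

lemma im_mul_arg_eq (s : ℂ) : s.im * s.arg = |s.im| * |s.arg| := by
  rw [← abs_mul, abs_of_nonneg]
  rcases le_or_gt 0 s.im with h | h
  · exact mul_nonneg h (arg_nonneg_iff.mpr h)
  · exact mul_nonneg_of_nonpos_of_nonpos h.le (arg_neg_iff.mpr h).le

lemma im_mul_arg_le {s : ℂ} (hs : 0 < s.re) : s.im * s.arg ≤ Real.pi * |s.im| / 2 := by
  rw [im_mul_arg_eq]
  have : |s.arg| ≤ Real.pi / 2 := abs_arg_le_pi_div_two_iff.mpr hs.le
  nlinarith [abs_nonneg s.im]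

/-- Jordan's inequality applied to π/2 − |arg s| bounds this angle by (π/2) cos(arg s) = (π/2) Re s
/ |s|, and |Im s| ≤ |s|. -/
lemma le_im_mul_arg {s : ℂ} (hs : 0 < s.re) :
    Real.pi * |s.im| / 2 - Real.pi / 2 * s.re ≤ s.im * s.arg := by
  rw [im_mul_arg_eq]
  have h1 : |s.arg| ≤ Real.pi / 2 := abs_arg_le_pi_div_two_iff.mpr hs.le
  have h2 := Real.mul_le_sin (x := Real.pi / 2 - |s.arg|) (by linarith)
    (by linarith [abs_nonneg s.arg])
  rw [Real.sin_pi_div_two_sub, Real.cos_abs, cos_arg (by rintro rfl; simp at hs)] at h2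
  have hn : 0 < ‖s‖ := by rw [norm_pos_iff]; rintro rfl; simp at hs
  have h3 : |s.im| * (s.re / ‖s‖) ≤ s.re := by
    rw [mul_div_assoc', div_le_iff₀ hn, mul_comm]
    exact mul_le_mul_of_nonneg_left (abs_im_le_norm s) hs.le
  have h4 : Real.pi / 2 - |s.arg| ≤ Real.pi / 2 * (s.re / ‖s‖) := by
    have := mul_le_mul_of_nonneg_left h2 (by positivity : 0 ≤ Real.pi / 2)
    rw [← mul_assoc] at this
    have e : Real.pi / 2 * (2 / Real.pi) = 1 := by
      have := Real.pi_ne_zero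
      field_simp
    rw [e, one_mul] at this
    exact this
  have h5 := mul_le_mul_of_nonneg_left h4 (abs_nonneg s.im)
  have h6 : |s.im| * (Real.pi / 2 * (s.re / ‖s‖)) ≤ Real.pi / 2 * s.re := by
    calc _ = Real.pi / 2 * (|s.im| * (s.re / ‖s‖)) := by ring
      _ ≤ _ := by gcongr
  linarith

/-- `Γ(s)` divided by the main factor `s ^ (s - 1/2)` of its asymptotic expansion. -/
def gammaQuot (s : ℂ) : ℂ := Gamma s * exp (-((s - 1 / 2) * log s))

lemma norm_gammaQuot {s : ℂ} (hs : 0 < s.re) :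
    ‖gammaQuot s‖ = ‖Gamma s‖ * (‖s‖ ^ (-(s.re - 1 / 2)) * Real.exp (s.im * s.arg)) := by
  have hn : 0 < ‖s‖ := by rw [norm_pos_iff]; rintro rfl; simp at hs
  rw [gammaQuot, norm_mul, norm_exp, Real.rpow_def_of_pos hn, ← Real.exp_add]
  congr 2
  simp [log_re, log_im]
  ring

/-- Phragmén–Lindelöf stands in for Stirling's formula. On Re s = 1/2 the reflection formula gives
|Γ|² exactly, the edge Re s = 3/2 follows by the recursion with |z − 1| ≤ |z|, and inside a crude
growth bound suffices. -/
lemma norm_gammaQuot_le {s : ℂ} (hs : 1 / 2 ≤ s.re) (hs' : s.re ≤ 3 / 2) :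
    ‖gammaQuot s‖ ≤ √(2 * Real.pi) := by
  have hpos : ∀ {z : ℂ}, 1 / 2 ≤ z.re → 0 < z.re := fun h => by linarith
  have hnorm : ∀ {z : ℂ}, 1 / 2 ≤ z.re → 1 / 2 ≤ ‖z‖ := fun {z} h =>
    h.trans ((le_abs_self _).trans (abs_re_le_norm z))
  refine PhragmenLindelof.vertical_strip (a := 1 / 2) (b := 3 / 2) (f := gammaQuot) ?_ ?_ ?_ ?_
    hs hs'
  · refine DifferentiableOn.diffContOnCl fun z hz => ?_
    have hcl : closure (re ⁻¹' Set.Ioo (1 / 2) (3 / 2)) ⊆ re ⁻¹' Set.Icc (1 / 2) (3 / 2) :=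
      closure_minimal (Set.preimage_mono Set.Ioo_subset_Icc_self)
        (isClosed_Icc.preimage continuous_re)
    have hz0 := hpos (hcl hz).1
    have hG := (analyticAt_Gamma_of_re_pos hz0).differentiableAt
    have hl : DifferentiableAt ℂ log z := differentiableAt_log (.inl hz0)
    unfold gammaQuot
    exact DifferentiableAt.differentiableWithinAt (by fun_prop)
  · obtain ⟨C, hC⟩ := (isCompact_Icc (a := (1 / 2 : ℝ)) (b := 3 / 2)).exists_bound_of_continuousOn
      (f := Real.Gamma) fun x hx => (Real.differentiableAt_Gamma fun m => by
        have : (0 : ℝ) ≤ m := Nat.cast_nonneg m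
        have := hx.1
        linarith).continuousAt.continuousWithinAt
    -- The admissible growth is exp(B e^{c|t|}) with c < π, the strip having width 1; c = 1 and B =
    -- π/2 suffice.
    refine ⟨1, by norm_num; exact lt_trans (by norm_num) Real.pi_gt_three, Real.pi / 2, ?_⟩
    refine Asymptotics.IsBigO.of_bound (C * 2) ?_
    rw [eventually_inf_principal]
    refine Eventually.of_forall fun z hz => ?_
    have hz1 : 1 / 2 ≤ z.re := hz.1.le
    have hz2 : z.re ≤ 3 / 2 := hz.2.le
    rw [norm_gammaQuot (hpos hz1), Real.norm_of_nonneg (Real.exp_pos _).le, mul_assoc]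
    have hG : ‖Gamma z‖ ≤ C := (norm_Gamma_le_Gamma_re (hpos hz1)).trans
      ((le_abs_self _).trans (hC _ ⟨hz1, hz2⟩))
    have hn := hnorm hz1
    have h2 : ‖z‖ ^ (-(z.re - 1 / 2)) ≤ 2 := by
      calc ‖z‖ ^ (-(z.re - 1 / 2)) ≤ (1 / 2 : ℝ) ^ (-(z.re - 1 / 2)) :=
            Real.rpow_le_rpow_of_nonpos (by norm_num) hn (by linarith)
        _ ≤ (1 / 2 : ℝ) ^ (-1 : ℝ) :=
            Real.rpow_le_rpow_of_exponent_ge (by norm_num) (by norm_num) (by linarith)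
        _ = 2 := by rw [Real.rpow_neg_one]; norm_num
    have h3 : z.im * z.arg ≤ Real.pi / 2 * Real.exp (1 * |z.im|) := by
      have a1 := im_mul_arg_le (hpos hz1)
      have a2 := Real.add_one_le_exp |z.im|
      rw [one_mul]
      have a3 := mul_le_mul_of_nonneg_left (by linarith : |z.im| ≤ Real.exp |z.im|)
        (by positivity : 0 ≤ Real.pi / 2)
      linarith
    have hC0 : 0 ≤ C := (norm_nonneg _).trans hG
    gcongr
  · intro z hz
    have hz0 : 0 < z.re := by rw [hz]; norm_num
    rw [norm_gammaQuot hz0, hz, sub_self, neg_zero, Real.rpow_zero, one_mul]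
    calc ‖Gamma z‖ * Real.exp (z.im * z.arg)
        ≤ (√(2 * Real.pi) * Real.exp (-(Real.pi * |z.im| / 2))) *
            Real.exp (Real.pi * |z.im| / 2) := by
          gcongr
          · exact norm_Gamma_half_le hz
          · exact im_mul_arg_le hz0
      _ = √(2 * Real.pi) := by rw [mul_assoc, ← Real.exp_add]; simp
  · intro z hz
    have hz0 : 0 < z.re := by rw [hz]; norm_num
    have hn : 0 < ‖z‖ := by rw [norm_pos_iff]; rintro rfl; simp at hz0
    have hw : (z - 1).re = 1 / 2 := by rw [sub_re, hz, one_re]; norm_num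
    have hw0 : z - 1 ≠ 0 := by intro h; rw [h] at hw; norm_num at hw
    have hrec : Gamma z = (z - 1) * Gamma (z - 1) := by
      rw [← Gamma_add_one _ hw0, sub_add_cancel]
    have hle : ‖z - 1‖ ≤ ‖z‖ := by
      rw [norm_def, norm_def]
      refine Real.sqrt_le_sqrt ?_
      rw [normSq_apply, normSq_apply, hw, hz, sub_im, one_im, sub_zero]
      linarith
    have e : -(z.re - 1 / 2) = -1 := by rw [hz]; norm_num
    rw [norm_gammaQuot hz0, e, Real.rpow_neg_one, hrec, norm_mul]
    have h1 := norm_Gamma_half_le hw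
    rw [sub_im, one_im, sub_zero] at h1
    calc ‖z - 1‖ * ‖Gamma (z - 1)‖ * (‖z‖⁻¹ * Real.exp (z.im * z.arg))
        ≤ ‖z‖ * (√(2 * Real.pi) * Real.exp (-(Real.pi * |z.im| / 2))) *
            (‖z‖⁻¹ * Real.exp (Real.pi * |z.im| / 2)) := by
          gcongr
          exact im_mul_arg_le hz0
      _ = √(2 * Real.pi) * (‖z‖ * ‖z‖⁻¹) *
            (Real.exp (-(Real.pi * |z.im| / 2)) * Real.exp (Real.pi * |z.im| / 2)) := by ring
      _ = √(2 * Real.pi) := by rw [← Real.exp_add, mul_inv_cancel₀ hn.ne']; simp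

lemma exists_norm_Gamma_le : ∃ C : ℝ, 0 < C ∧ ∀ s : ℂ, 1 / 2 ≤ s.re → s.re ≤ 3 / 2 →
    ‖Gamma s‖ ≤ C * ‖s‖ ^ (s.re - 1 / 2) * Real.exp (-(Real.pi * |s.im| / 2)) := by
  refine ⟨√(2 * Real.pi) * Real.exp (Real.pi / 2 * (3 / 2)), by positivity, fun s h1 h2 => ?_⟩
  have hs : 0 < s.re := by linarith
  have hn : 0 < ‖s‖ := by rw [norm_pos_iff]; rintro rfl; simp at hs
  have h := norm_gammaQuot_le h1 h2
  rw [norm_gammaQuot hs, Real.rpow_neg hn.le] at h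
  have hp : 0 < ‖s‖ ^ (s.re - 1 / 2) := Real.rpow_pos_of_pos hn _
  have h3 : ‖Gamma s‖ ≤ √(2 * Real.pi) * ‖s‖ ^ (s.re - 1 / 2) * Real.exp (-(s.im * s.arg)) := by
    rw [Real.exp_neg, ← div_eq_mul_inv, le_div_iff₀ (Real.exp_pos _), mul_comm _ (‖s‖ ^ _),
      ← div_le_iff₀' hp]
    calc _ = _ := by rw [div_eq_mul_inv]; ring
      _ ≤ _ := h
  refine h3.trans ?_
  have h4 : Real.exp (-(s.im * s.arg)) ≤
      Real.exp (Real.pi / 2 * (3 / 2)) * Real.exp (-(Real.pi * |s.im| / 2)) := by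
    rw [← Real.exp_add, Real.exp_le_exp]
    have a := le_im_mul_arg hs
    have b := mul_le_mul_of_nonneg_left h2 (by positivity : 0 ≤ Real.pi / 2)
    linarith
  calc _ ≤ √(2 * Real.pi) * ‖s‖ ^ (s.re - 1 / 2) *
        (Real.exp (Real.pi / 2 * (3 / 2)) * Real.exp (-(Real.pi * |s.im| / 2))) := by gcongr
    _ = _ := by ring

lemma norm_le_add_abs_im {s : ℂ} {b : ℝ} (h0 : 0 ≤ s.re) (h : s.re ≤ b) : ‖s‖ ≤ b + |s.im| := by
  refine (norm_le_abs_re_add_abs_im s).trans ?_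
  rw [abs_of_nonneg h0]
  linarith

lemma exists_norm_Gamma_le_linear : ∃ C : ℝ, 0 < C ∧ ∀ s : ℂ, 1 / 4 ≤ s.re → s.re ≤ 3 / 2 →
    ‖Gamma s‖ ≤ C * (1 + |s.im|) * Real.exp (-(Real.pi * |s.im| / 2)) := by
  obtain ⟨C, hC, h⟩ := exists_norm_Gamma_le
  have key : ∀ s : ℂ, 1 / 2 ≤ s.re → s.re ≤ 3 / 2 →
      ‖Gamma s‖ ≤ C * (5 / 2 * (1 + |s.im|)) * Real.exp (-(Real.pi * |s.im| / 2)) := by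
    intro s h1 h2
    refine (h s h1 h2).trans ?_
    have h3 : ‖s‖ ^ (s.re - 1 / 2) ≤ 5 / 2 * (1 + |s.im|) := by
      have hs := norm_le_add_abs_im (by linarith) h2
      have := abs_nonneg s.im
      calc ‖s‖ ^ (s.re - 1 / 2) ≤ (1 + ‖s‖) ^ (s.re - 1 / 2) :=
            Real.rpow_le_rpow (norm_nonneg _) (by linarith) (by linarith)
        _ ≤ (1 + ‖s‖) ^ (1 : ℝ) := Real.rpow_le_rpow_of_exponent_le
            (by linarith [norm_nonneg s]) (by linarith)
        _ ≤ _ := by rw [Real.rpow_one]; linarith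
    gcongr
  refine ⟨C * 10, by positivity, fun s h1 h2 => ?_⟩
  have h5 := abs_nonneg s.im
  have hE := Real.exp_pos (-(Real.pi * |s.im| / 2))
  rcases le_total (1 / 2) s.re with h3 | h3
  · refine (key s h3 h2).trans ?_
    have : C * (5 / 2 * (1 + |s.im|)) ≤ C * 10 * (1 + |s.im|) := by
      have : 0 ≤ C * (1 + |s.im|) := by positivity
      linarith
    gcongr
  · have hs0 : s ≠ 0 := by rintro rfl; norm_num at h1
    have hn : 1 / 4 ≤ ‖s‖ := h1.trans ((le_abs_self _).trans (abs_re_le_norm s))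
    have hrec : Gamma s = Gamma (s + 1) / s := by
      rw [Gamma_add_one _ hs0, mul_div_cancel_left₀ _ hs0]
    have := key (s + 1) (by simp; linarith) (by simp; linarith)
    rw [add_im, one_im, add_zero] at this
    rw [hrec, norm_div, div_le_iff₀ (by linarith)]
    refine this.trans ?_
    have h6 : C * (5 / 2 * (1 + |s.im|)) ≤ C * 10 * (1 + |s.im|) * ‖s‖ := by
      have : 0 ≤ C * (1 + |s.im|) := by positivity
      nlinarith
    calc _ ≤ C * 10 * (1 + |s.im|) * ‖s‖ * Real.exp (-(Real.pi * |s.im| / 2)) := by gcongr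
      _ = _ := by ring

lemma norm_sin_pi_mul_le (s : ℂ) : ‖sin (Real.pi * s)‖ ≤ Real.exp (Real.pi * |s.im|) := by
  rw [sin]
  have h1 : ‖exp (-(Real.pi * s) * I)‖ ≤ Real.exp (Real.pi * |s.im|) := by
    rw [norm_exp, Real.exp_le_exp]
    simp only [neg_mul, neg_re, mul_re, mul_im, ofReal_re, ofReal_im, I_re, I_im]
    nlinarith [le_abs_self s.im, Real.pi_pos]
  have h2 : ‖exp (Real.pi * s * I)‖ ≤ Real.exp (Real.pi * |s.im|) := by
    rw [norm_exp, Real.exp_le_exp]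
    simp only [mul_re, mul_im, ofReal_re, ofReal_im, I_re, I_im]
    nlinarith [neg_le_abs s.im, Real.pi_pos]
  rw [norm_div, norm_mul, norm_I, mul_one]
  have := norm_sub_le (exp (-(Real.pi * s) * I)) (exp (Real.pi * s * I))
  simp only [norm_ofNat]
  linarith

/-- Reflection turns an upper bound for Γ(1 − s) into a lower bound for Γ(s), since |sin πs| ≤
e^{π|t|}. Here 1 − s has real part 3/4 or 1/4, and in the second case one recursion step brings it
into the range of `exists_norm_Gamma_le`. -/
lemma exists_le_norm_Gamma (a : ℕ) (ha : a ≤ 1) : ∃ c : ℝ, 0 < c ∧ ∀ y : ℝ, 1 ≤ y →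
    c * y ^ ((a : ℝ) / 2 - 1 / 4) * Real.exp (-(Real.pi * y / 2)) ≤
      ‖Gamma ((1 / 4 + a / 2 : ℝ) + y * I)‖ := by
  obtain ⟨C, hC, h⟩ := exists_norm_Gamma_le
  have key : ∃ C', 0 < C' ∧ ∀ y : ℝ, 1 ≤ y → ‖Gamma (1 - ((1 / 4 + a / 2 : ℝ) + y * I))‖ ≤
      C' * y ^ (-((a : ℝ) / 2 - 1 / 4)) * Real.exp (-(Real.pi * y / 2)) := by
    interval_cases a
    · refine ⟨C * 2 ^ (1 / 4 : ℝ), by positivity, fun y hy => ?_⟩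
      set s : ℂ := 1 - ((1 / 4 + (0 : ℕ) / 2 : ℝ) + y * I) with hs
      have hre : s.re = 3 / 4 := by simp [hs]; norm_num
      have him : |s.im| = y := by simp [hs]; linarith
      have h1 := h s (by rw [hre]; norm_num) (by rw [hre]; norm_num)
      have h2 : ‖s‖ ≤ 2 * y := by
        have := norm_le_add_abs_im (s := s) (b := 3 / 4) (by rw [hre]; norm_num) hre.le
        rw [him] at this
        linarith
      rw [him, hre] at h1
      refine h1.trans ?_
      have h3 : ‖s‖ ^ (3 / 4 - 1 / 2 : ℝ) ≤ 2 ^ (1 / 4 : ℝ) * y ^ (1 / 4 : ℝ) := by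
        rw [← Real.mul_rpow (by norm_num) (by linarith)]
        norm_num
        exact Real.rpow_le_rpow (norm_nonneg _) h2 (by norm_num)
      have e : (-(((0 : ℕ) : ℝ) / 2 - 1 / 4)) = 1 / 4 := by norm_num
      rw [e]
      calc _ ≤ C * (2 ^ (1 / 4 : ℝ) * y ^ (1 / 4 : ℝ)) * Real.exp (-(Real.pi * y / 2)) := by
            gcongr
        _ = _ := by ring
    · refine ⟨C * 3 ^ (3 / 4 : ℝ), by positivity, fun y hy => ?_⟩
      set s : ℂ := 1 - ((1 / 4 + (1 : ℕ) / 2 : ℝ) + y * I) with hs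
      have hre : s.re = 1 / 4 := by simp [hs]; norm_num
      have him : |s.im| = y := by simp [hs]; linarith
      have h1 := h (s + 1) (by rw [add_re, hre, one_re]; norm_num)
        (by rw [add_re, hre, one_re]; norm_num)
      have h2 : ‖s + 1‖ ≤ 3 * y := by
        have := norm_le_add_abs_im (s := s + 1) (b := 5 / 4) (by rw [add_re, hre, one_re]; norm_num)
          (by rw [add_re, hre, one_re]; norm_num)
        rw [add_im, one_im, add_zero, him] at this
        linarith
      rw [add_im, one_im, add_zero, him, add_re, hre, one_re] at h1
      have h3 : ‖s + 1‖ ^ (1 / 4 + 1 - 1 / 2 : ℝ) ≤ 3 ^ (3 / 4 : ℝ) * y ^ (3 / 4 : ℝ) := by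
        rw [← Real.mul_rpow (by norm_num) (by linarith)]
        norm_num
        exact Real.rpow_le_rpow (norm_nonneg _) h2 (by norm_num)
      have hs0 : s ≠ 0 := by intro h0; rw [h0] at hre; norm_num at hre
      have hrec : Gamma s = Gamma (s + 1) / s := by
        rw [Gamma_add_one _ hs0, mul_div_cancel_left₀ _ hs0]
      have hys : y ≤ ‖s‖ := him ▸ abs_im_le_norm s
      have e : (-(((1 : ℕ) : ℝ) / 2 - 1 / 4)) = 3 / 4 - 1 := by norm_num
      rw [hrec, norm_div, e, Real.rpow_sub_one (by linarith)]
      have h4 : ‖Gamma (s + 1)‖ ≤ C * (3 ^ (3 / 4 : ℝ) * y ^ (3 / 4 : ℝ)) *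
          Real.exp (-(Real.pi * y / 2)) := h1.trans (by gcongr)
      calc ‖Gamma (s + 1)‖ / ‖s‖ ≤ (C * (3 ^ (3 / 4 : ℝ) * y ^ (3 / 4 : ℝ)) *
          Real.exp (-(Real.pi * y / 2))) / y := by gcongr
        _ = _ := by ring
  obtain ⟨C', hC', h'⟩ := key
  refine ⟨Real.pi / C', by positivity, fun y hy => ?_⟩
  set s : ℂ := (1 / 4 + a / 2 : ℝ) + y * I with hs
  have hy0 : 0 < y := by linarith
  have hr := congrArg norm (Gamma_mul_Gamma_one_sub s)
  have him : |s.im| = y := by simp [hs]; linarith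
  have hre : s.re = 1 / 4 + a / 2 := by simp [hs]
  have hsin := norm_sin_pi_mul_le s
  rw [him] at hsin
  have hne : 0 < ‖Gamma s * Gamma (1 - s)‖ := by
    rw [norm_pos_iff]
    refine mul_ne_zero (Gamma_ne_zero_of_re_pos ?_) (Gamma_ne_zero_of_re_pos ?_)
    · rw [hre]; positivity
    · rw [sub_re, one_re, hre]
      have : (a : ℝ) ≤ 1 := by exact_mod_cast ha
      linarith
  rw [hr, norm_div, norm_real, Real.norm_of_nonneg Real.pi_pos.le] at hne
  have hsin0 : 0 < ‖sin (Real.pi * s)‖ := by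
    by_contra! h0
    rw [le_antisymm h0 (norm_nonneg _), div_zero] at hne
    exact lt_irrefl _ hne
  rw [norm_mul, norm_div, norm_real, Real.norm_of_nonneg Real.pi_pos.le,
    eq_div_iff hsin0.ne'] at hr
  have h5 : Real.pi ≤ ‖Gamma s‖ * (C' * y ^ (-((a : ℝ) / 2 - 1 / 4)) *
      Real.exp (-(Real.pi * y / 2))) * Real.exp (Real.pi * y) := by
    refine hr.symm.le.trans ?_
    gcongr
    exact h' y hy
  have h6 : y ^ ((a : ℝ) / 2 - 1 / 4) * y ^ (-((a : ℝ) / 2 - 1 / 4)) = 1 := by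
    rw [← Real.rpow_add hy0]; simp
  have h7 : Real.exp (-(Real.pi * y / 2)) * (Real.exp (-(Real.pi * y / 2)) *
      Real.exp (Real.pi * y)) = 1 := by
    rw [← Real.exp_add, ← Real.exp_add]; ring_nf; simp
  set p := y ^ ((a : ℝ) / 2 - 1 / 4)
  set q := y ^ (-((a : ℝ) / 2 - 1 / 4))
  set E := Real.exp (-(Real.pi * y / 2))
  have hp : 0 < p := Real.rpow_pos_of_pos hy0 _
  have hE : 0 < E := Real.exp_pos _
  calc Real.pi / C' * p * E
      ≤ (‖Gamma s‖ * (C' * q * E) * Real.exp (Real.pi * y)) / C' * p * E := by gcongr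
    _ = ‖Gamma s‖ * (C' / C') * (p * q) * (E * (E * Real.exp (Real.pi * y))) := by ring
    _ = ‖Gamma s‖ := by rw [h6, h7, div_self hC'.ne']; ring

/-! ### Linear growth of L on Re s ≥ 1/2, from bounded character sums. -/

lemma sum_range_character_mul (hχ : χ ≠ 1) (q : ℕ) :
    ∑ i ∈ Finset.range (k * q), χ (i : ZMod k) = 0 := by
  have hper : ∑ i ∈ Finset.range k, χ (i : ZMod k) = 0 := by
    rw [← MulChar.sum_eq_zero_of_ne_one hχ]
    refine Finset.sum_bij' (fun i _ => (i : ZMod k)) (fun a _ => a.val) (by simp) ?_ ?_ ?_ ?_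
    · intro a _
      exact Finset.mem_range.mpr a.val_lt
    · intro i hi
      exact ZMod.val_cast_of_lt (Finset.mem_range.mp hi)
    · intro a _
      exact ZMod.natCast_zmod_val a
    · simp
  induction q with
  | zero => simp
  | succ q ih =>
    rw [Nat.mul_succ, Finset.sum_range_add, ih, zero_add, ← hper]
    simp

lemma norm_sum_range_character_le (hχ : χ ≠ 1) (n : ℕ) :
    ‖∑ i ∈ Finset.range n, χ (i : ZMod k)‖ ≤ k := by
  rw [← Nat.div_add_mod n k, Finset.sum_range_add, sum_range_character_mul hχ, zero_add]
  refine (norm_sum_le _ _).trans ?_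
  calc ∑ i ∈ Finset.range (n % k), ‖χ ((k * (n / k) + i : ℕ) : ZMod k)‖
      ≤ ∑ i ∈ Finset.range (n % k), 1 := Finset.sum_le_sum fun i _ => χ.norm_le_one _
    _ = ((n % k : ℕ) : ℝ) := by simp
    _ ≤ k := by exact_mod_cast (Nat.mod_lt n (NeZero.pos k)).le

lemma character_zero (hk : 1 < k) (χ : DirichletCharacter ℂ k) : χ 0 = 0 :=
  χ.map_zero' hk.ne'

lemma norm_sum_Icc_character_le (hk : 1 < k) (hχ : χ ≠ 1) (n : ℕ) :
    ‖∑ i ∈ Finset.Icc 1 n, χ (i : ZMod k)‖ ≤ k := by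
  have h : ∑ i ∈ Finset.Icc 1 n, χ (i : ZMod k) = ∑ i ∈ Finset.range (n + 1), χ (i : ZMod k) := by
    rw [Finset.range_eq_Ico, Finset.sum_eq_sum_Ico_succ_bot (Nat.succ_pos n), Nat.cast_zero,
      character_zero hk, zero_add]
    rfl
  rw [h]
  exact norm_sum_range_character_le hχ _

/-- The summatory function of `χ` on `(1, ∞)`. -/
def charSum (χ : DirichletCharacter ℂ k) : ℝ → ℂ :=
  (Set.Ioi 1).indicator fun t => ∑ i ∈ Finset.Icc 1 ⌊t⌋₊, χ (i : ZMod k)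

lemma norm_charSum_le (hk : 1 < k) (hχ : χ ≠ 1) (t : ℝ) : ‖charSum χ t‖ ≤ k := by
  rw [charSum]
  refine (norm_indicator_le_norm_self _ _).trans ?_
  exact norm_sum_Icc_character_le hk hχ _

lemma measurable_charSum (χ : DirichletCharacter ℂ k) : Measurable (charSum χ) :=
  ((measurable_from_nat (f := fun n => ∑ i ∈ Finset.Icc 1 n, χ (i : ZMod k))).comp
    Nat.measurable_floor).indicator measurableSet_Ioi

lemma mellin_charSum (χ : DirichletCharacter ℂ k) (s : ℂ) : mellin (charSum χ) (-s) =
    ∫ t in Set.Ioi (1 : ℝ), (∑ i ∈ Finset.Icc 1 ⌊t⌋₊, χ (i : ZMod k)) * (t : ℂ) ^ (-(s + 1)) := by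
  rw [mellin, ← MeasureTheory.integral_indicator measurableSet_Ioi,
    ← MeasureTheory.integral_indicator measurableSet_Ioi]
  congr 1
  funext t
  by_cases h1 : t ∈ Set.Ioi (1 : ℝ)
  · have h0 : t ∈ Set.Ioi (0 : ℝ) := zero_lt_one.trans (Set.mem_Ioi.mp h1)
    rw [Set.indicator_of_mem h0, Set.indicator_of_mem h1, charSum, Set.indicator_of_mem h1,
      smul_eq_mul, mul_comm]
    congr 2
    ring
  · rw [Set.indicator_of_notMem h1]
    by_cases h0 : t ∈ Set.Ioi (0 : ℝ)
    · rw [Set.indicator_of_mem h0, charSum, Set.indicator_of_notMem h1, smul_zero]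
    · rw [Set.indicator_of_notMem h0]

lemma differentiableAt_mellin_charSum (hk : 1 < k) (hχ : χ ≠ 1) {s : ℂ} (hs : 0 < s.re) :
    DifferentiableAt ℂ (fun s => mellin (charSum χ) (-s)) s := by
  have h : DifferentiableAt ℂ (mellin (charSum χ)) (-s) := by
    refine mellin_differentiableAt_of_isBigO_rpow (a := 0) (b := (-s).re - 1) ?_ ?_ (by simpa) ?_
      (by linarith)
    · refine MeasureTheory.LocallyIntegrable.locallyIntegrableOn ?_ _
      exact (MeasureTheory.locallyIntegrable_const (k : ℝ)).mono
        (measurable_charSum χ).aestronglyMeasurable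
        (Eventually.of_forall fun t => (norm_charSum_le hk hχ t).trans (by simp))
    · refine Asymptotics.IsBigO.of_bound k (Eventually.of_forall fun t => ?_)
      simpa using norm_charSum_le hk hχ t
    · refine Asymptotics.IsBigO.of_bound 1 ?_
      filter_upwards [mem_nhdsWithin_of_mem_nhds (Iio_mem_nhds zero_lt_one)] with t ht
      rw [charSum, Set.indicator_of_notMem (by simpa using le_of_lt ht), norm_zero]
      positivity
  exact h.comp s differentiableAt_id.neg

/-- Abel summation gives this for Re s > 1. The partial sums are bounded, so the integral is
holomorphic on Re s > 0 and the identity theorem applies. -/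
lemma LFunction_eq_mul_mellin (hk : 1 < k) (hχ : χ ≠ 1) {s : ℂ} (hs : 0 < s.re) :
    χ.LFunction s = s * mellin (charSum χ) (-s) := by
  have hopen : IsOpen {s : ℂ | 0 < s.re} := isOpen_lt continuous_const continuous_re
  have hA : AnalyticOnNhd ℂ (fun s => s * mellin (charSum χ) (-s)) {s : ℂ | 0 < s.re} :=
    DifferentiableOn.analyticOnNhd (fun z hz => (differentiableAt_id.mul
      (differentiableAt_mellin_charSum hk hχ hz)).differentiableWithinAt) hopen
  have hE := ((analyticOnNhd_LFunction hχ).mono (Set.subset_univ _)).eqOn_of_preconnected_of_eventuallyEq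
    hA (convex_halfSpace_re_gt 0).isPreconnected (z₀ := 2) (by simp) ?_
  · exact hE hs
  · have hopen : {z : ℂ | 1 < z.re} ∈ 𝓝 (2 : ℂ) :=
      (isOpen_lt continuous_const continuous_re).mem_nhds (by simp)
    filter_upwards [hopen] with z hz
    have hz0 : 0 < z.re := zero_lt_one.trans hz
    rw [χ.LFunction_eq_LSeries hz, mellin_charSum]
    refine LSeries_eq_mul_integral (fun n : ℕ => χ (n : ZMod k)) (r := 0) le_rfl hz0
      (χ.LSeriesSummable_of_one_lt_re hz) ?_
    refine Asymptotics.IsBigO.of_bound k (Eventually.of_forall fun n => ?_)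
    simpa using norm_sum_Icc_character_le hk hχ n

lemma norm_LFunction_le (hk : 1 < k) (hχ : χ ≠ 1) {s : ℂ} (hs : 1 / 2 ≤ s.re) :
    ‖χ.LFunction s‖ ≤ 2 * k * ‖s‖ := by
  have hs0 : 0 < s.re := by linarith
  rw [LFunction_eq_mul_mellin hk hχ hs0, norm_mul, mul_comm]
  gcongr
  rw [mellin_charSum]
  have hint : MeasureTheory.IntegrableOn (fun t : ℝ => (k : ℝ) * t ^ (-(s.re + 1)))
      (Set.Ioi 1) := (integrableOn_Ioi_rpow_of_lt (by linarith) one_pos).const_mul _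
  refine (MeasureTheory.norm_integral_le_of_norm_le hint ?_).trans ?_
  · refine (MeasureTheory.ae_restrict_iff' measurableSet_Ioi).mpr (Eventually.of_forall ?_)
    intro t ht
    have ht0 : (0 : ℝ) < t := zero_lt_one.trans ht
    rw [norm_mul, norm_cpow_eq_rpow_re_of_pos ht0]
    simp only [neg_re, add_re, one_re]
    gcongr
    exact norm_sum_Icc_character_le hk hχ _
  · rw [MeasureTheory.integral_const_mul, integral_Ioi_rpow_of_lt (by linarith) one_pos,
      Real.one_rpow, mul_comm (2 : ℝ)]
    gcongr
    have e : -(s.re + 1) + 1 = -s.re := by ring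
    rw [e, neg_div_neg_eq, div_le_iff₀ hs0]
    linarith

lemma continuous_LFunction (hχ : χ ≠ 1) : Continuous χ.LFunction :=
  (DirichletCharacter.differentiable_LFunction hχ).continuous

/-! ### A lower bound for the first moment of |L| on the line. -/

/-- The quadratic weight that vanishes at `1/2 + iT` and at `1/2 + 2iT`. -/
def quadWeight (T : ℝ) (s : ℂ) : ℂ :=
  (s - linePoint T) * (s - linePoint (2 * T)) / (T : ℂ) ^ 2

lemma quadWeight_line {T : ℝ} (hT : 0 < T) (t : ℝ) :
    quadWeight T ((1 / 2 : ℝ) + t * I) = (((t - T) * (2 * T - t) / T ^ 2 : ℝ) : ℂ) := by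
  have hT' : (T : ℂ) ≠ 0 := ofReal_ne_zero.mpr hT.ne'
  rw [quadWeight, linePoint, linePoint]
  push_cast
  field_simp
  linear_combination 4 * ((t : ℂ) - T) * (t - 2 * T) * I_sq

lemma norm_quadWeight_two_sub_le {T t : ℝ} (hT : 3 ≤ T) (h1 : T ≤ t) (h2 : t ≤ 2 * T) :
    ‖quadWeight T ((2 : ℝ) + t * I) - (((t - T) * (2 * T - t) / T ^ 2 : ℝ) : ℂ)‖ ≤ 3 / T := by
  have hT0 : 0 < T := by linarith
  have hT' : (T : ℂ) ≠ 0 := ofReal_ne_zero.mpr hT0.ne'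
  have e : quadWeight T ((2 : ℝ) + t * I) - (((t - T) * (2 * T - t) / T ^ 2 : ℝ) : ℂ) =
      ((9 / 4 : ℝ) + (3 / 2 * (2 * t - 3 * T) : ℝ) * I) / ((T ^ 2 : ℝ) : ℂ) := by
    rw [quadWeight, linePoint, linePoint]
    push_cast
    field_simp
    linear_combination 16 * ((t : ℂ) - T) * (t - 2 * T) * I_sq
  rw [e, norm_div, norm_real, Real.norm_of_nonneg (by positivity), div_le_div_iff₀ (by positivity)
    hT0]
  have h3 : ‖((9 / 4 : ℝ) + (3 / 2 * (2 * t - 3 * T) : ℝ) * I : ℂ)‖ ≤ 9 / 4 + 3 / 2 * T := by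
    refine (norm_add_le _ _).trans ?_
    rw [norm_mul, norm_I, mul_one, norm_real, norm_real, Real.norm_of_nonneg (by norm_num),
      Real.norm_eq_abs, abs_mul, abs_of_pos (by norm_num : (0 : ℝ) < 3 / 2)]
    have : |2 * t - 3 * T| ≤ T := abs_le.mpr ⟨by linarith, by linarith⟩
    linarith
  calc _ ≤ (9 / 4 + 3 / 2 * T) * T := by gcongr
    _ ≤ _ := by nlinarith

lemma norm_quadWeight_horizontal_le {T σ y : ℝ} (hT : 3 ≤ T) (h1 : 1 / 2 ≤ σ) (h2 : σ ≤ 2)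
    (hy : y = T ∨ y = 2 * T) : ‖quadWeight T (σ + y * I)‖ ≤ 3 / T := by
  have hT0 : 0 < T := by linarith
  have a1 : ∀ u : ℝ, ‖(σ + u * I - linePoint u : ℂ)‖ ≤ 3 / 2 := by
    intro u
    have : (σ + u * I - linePoint u : ℂ) = ((σ - 1 / 2 : ℝ) : ℂ) := by
      rw [linePoint]; push_cast; ring
    rw [this, norm_real, Real.norm_of_nonneg (by linarith)]
    linarith
  have a2 : ∀ u v : ℝ, |u - v| = T → ‖(σ + u * I - linePoint v : ℂ)‖ ≤ 3 / 2 + T := by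
    intro u v huv
    have : (σ + u * I - linePoint v : ℂ) = (σ + u * I - linePoint u) + ((u - v : ℝ) : ℂ) * I := by
      rw [linePoint, linePoint]; push_cast; ring
    rw [this]
    refine (norm_add_le _ _).trans ?_
    rw [norm_mul, norm_I, mul_one, norm_real, Real.norm_eq_abs, huv]
    linarith [a1 u]
  have hfin : 3 / 2 * (3 / 2 + T) / T ^ 2 ≤ 3 / T := by
    rw [div_le_div_iff₀ (by positivity) hT0]
    nlinarith
  rw [quadWeight, norm_div, norm_mul, norm_pow, norm_real, Real.norm_of_nonneg hT0.le]
  refine le_trans ?_ hfin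
  refine div_le_div_of_nonneg_right ?_ (by positivity)
  rcases hy with rfl | rfl
  · refine mul_le_mul (a1 _) (a2 _ _ ?_) (norm_nonneg _) (by norm_num)
    rw [abs_sub_comm, abs_of_pos (by linarith)]
    ring
  · refine (mul_comm _ _).trans_le ?_
    refine mul_le_mul (a1 _) (a2 _ _ ?_) (norm_nonneg _) (by norm_num)
    rw [abs_of_pos (by linarith)]
    ring

lemma integral_quadWeight {T : ℝ} (hT : 0 < T) :
    ∫ t in T..(2 * T), (t - T) * (2 * T - t) / T ^ 2 = T / 6 := by
  have h : ∀ t ∈ Set.uIcc T (2 * T), HasDerivAt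
      (fun t : ℝ => (-(t ^ 3) / 3 + 3 * T * t ^ 2 / 2 - 2 * T ^ 2 * t) / T ^ 2)
      ((t - T) * (2 * T - t) / T ^ 2) t := by
    intro t _
    have h1 : HasDerivAt (fun t : ℝ => t) 1 t := hasDerivAt_id t
    have := (((((h1.pow 3).neg.div_const 3).add (((h1.pow 2).const_mul (3 * T)).div_const 2)).sub
      (h1.const_mul (2 * T ^ 2))).div_const (T ^ 2))
    refine this.congr_deriv ?_
    norm_num
    ring
  rw [intervalIntegral.integral_eq_sub_of_hasDerivAt h
    (Continuous.intervalIntegrable (by fun_prop) _ _)]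
  field_simp
  ring

/-- Integrate L times the quadratic weight around [1/2, 2] × [T, 2T]. The weight is O(1/T) on the
horizontal sides, which offsets the linear growth of L. On Re s = 2 one has |L − 1| < 2/3, so the
integral there keeps at least a third of ∫ w = T/6, up to O(1), and the left side must balance it.
-/
lemma exists_le_integral_norm_LFunction (hk : 1 < k) (hχ : χ ≠ 1) :
    ∃ C : ℝ, ∀ T : ℝ, 3 ≤ T →
      2 / 9 * T - C ≤ ∫ t in T..(2 * T), ‖χ.LFunction (linePoint t)‖ := by
  -- The 5 is the error on Re s = 2, 48k is twice the bound 24k for a horizontal side, and the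
  -- factor 4 undoes the maximum 1/4 of the weight.
  refine ⟨4 * (5 + 48 * k), fun T hT => ?_⟩
  have hT0 : 0 < T := by linarith
  have hL := continuous_LFunction hχ
  set f : ℂ → ℂ := fun s => χ.LFunction s * quadWeight T s with hf
  have hfd : Differentiable ℂ f := by
    have := DirichletCharacter.differentiable_LFunction hχ
    simp only [hf, quadWeight]
    fun_prop
  have hrect := integral_boundary_rect_eq_zero_of_differentiableOn f
    ((1 / 2 : ℝ) + T * I) ((2 : ℝ) + (2 * T : ℝ) * I) hfd.differentiableOn
  simp only [add_re, add_im, ofReal_re, ofReal_im, mul_re, mul_im, I_re, I_im, mul_zero, mul_one,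
    sub_self, add_zero, zero_add] at hrect
  set A := ∫ x : ℝ in (1 / 2)..2, f (x + T * I)
  set B := ∫ x : ℝ in (1 / 2)..2, f (x + (2 * T : ℝ) * I)
  set D := ∫ y : ℝ in T..(2 * T), f ((2 : ℝ) + y * I) with hD
  set E := ∫ y : ℝ in T..(2 * T), f ((1 / 2 : ℝ) + y * I) with hE
  set w : ℝ → ℝ := fun t => (t - T) * (2 * T - t) / T ^ 2 with hw
  have hw0 : ∀ t ∈ Set.Icc T (2 * T), 0 ≤ w t := fun t ht =>
    div_nonneg (mul_nonneg (by linarith [ht.1]) (by linarith [ht.2])) (by positivity)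
  have hhor : ∀ y : ℝ, y = T ∨ y = 2 * T →
      ‖∫ x : ℝ in (1 / 2)..2, f (x + y * I)‖ ≤ 24 * k := by
    intro y hy
    have hb : ∀ x ∈ Set.uIoc (1 / 2 : ℝ) 2, ‖f (x + y * I)‖ ≤ 16 * k := by
      intro x hx
      rw [Set.uIoc_of_le (by norm_num)] at hx
      rw [hf]
      simp only [norm_mul]
      have hy2 : |y| ≤ 2 * T := by
        rcases hy with rfl | rfl
        · rw [abs_of_pos hT0]; linarith
        · rw [abs_of_pos (by linarith)]
      have h1 : ‖χ.LFunction (x + y * I)‖ ≤ 2 * k * (2 + 2 * T) := by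
        refine (norm_LFunction_le hk hχ (by simpa using hx.1.le)).trans ?_
        gcongr
        refine (norm_le_add_abs_im (b := 2) (by simpa using by linarith [hx.1])
          (by simpa using hx.2)).trans ?_
        simpa using hy2
      have h2 := norm_quadWeight_horizontal_le hT hx.1.le hx.2 hy
      calc _ ≤ 2 * k * (2 + 2 * T) * (3 / T) := by gcongr
        _ = 12 * k * ((1 + T) / T) := by field_simp; ring
        _ ≤ 12 * k * (4 / 3) := by
            refine mul_le_mul_of_nonneg_left ?_ (by positivity)
            rw [div_le_div_iff₀ hT0 (by norm_num)]
            linarith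
        _ = _ := by ring
    have := intervalIntegral.norm_integral_le_of_norm_le_const hb
    refine this.trans_eq ?_
    norm_num
    ring
  have hwc : Continuous w := by simp only [hw]; fun_prop
  have hfc := hfd.continuous
  have hTT : T ≤ 2 * T := by linarith
  have hwint : ∫ t in T..(2 * T), w t = T / 6 := integral_quadWeight hT0
  have hDw : ‖D - (T / 6 : ℝ)‖ ≤ T / 9 + 5 := by
    have e1 : D - (T / 6 : ℝ) = ∫ y : ℝ in T..(2 * T), (f ((2 : ℝ) + y * I) - (w y : ℂ)) := by
      rw [intervalIntegral.integral_sub (Continuous.intervalIntegrable (by fun_prop) _ _)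
        (Continuous.intervalIntegrable (by fun_prop) _ _), intervalIntegral.integral_ofReal, hwint]
    rw [e1]
    have hb : ∀ t ∈ Set.Ioc T (2 * T),
        ‖f ((2 : ℝ) + t * I) - (w t : ℂ)‖ ≤ 2 / 3 * w t + 5 / T := by
      intro t ht
      have hL1 := (norm_LFunction_sub_one_lt χ (s := (2 : ℝ) + t * I) (by simp)).le
      have hq := norm_quadWeight_two_sub_le hT ht.1.le ht.2
      set ℓ := χ.LFunction ((2 : ℝ) + t * I)
      set q := quadWeight T ((2 : ℝ) + t * I)
      have hℓ : ‖ℓ‖ ≤ 5 / 3 := by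
        have := norm_add_le (ℓ - 1) 1
        rw [sub_add_cancel, norm_one] at this
        linarith
      have e2 : f ((2 : ℝ) + t * I) - (w t : ℂ) = (ℓ - 1) * w t + ℓ * (q - w t) := by
        simp only [hf]; ring
      rw [e2]
      refine (norm_add_le _ _).trans ?_
      rw [norm_mul, norm_mul, norm_real, Real.norm_of_nonneg (hw0 t ⟨ht.1.le, ht.2⟩)]
      have h5 : 5 / T = 5 / 3 * (3 / T) := by ring
      rw [h5]
      exact add_le_add (mul_le_mul_of_nonneg_right hL1 (hw0 t ⟨ht.1.le, ht.2⟩))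
        (mul_le_mul hℓ hq (norm_nonneg _) (by norm_num))
    refine (intervalIntegral.norm_integral_le_of_norm_le hTT
      (MeasureTheory.ae_of_all _ fun t ht => hb t ht)
      (Continuous.intervalIntegrable (by fun_prop) _ _)).trans_eq ?_
    rw [intervalIntegral.integral_add (Continuous.intervalIntegrable (by fun_prop) _ _)
      (Continuous.intervalIntegrable (by fun_prop) _ _), intervalIntegral.integral_const_mul, hwint,
      intervalIntegral.integral_const, smul_eq_mul]
    field_simp
    ring
  have hE4 : ‖E‖ ≤ 1 / 4 * ∫ t in T..(2 * T), ‖χ.LFunction (linePoint t)‖ := by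
    rw [← intervalIntegral.integral_const_mul]
    refine intervalIntegral.norm_integral_le_of_norm_le hTT (MeasureTheory.ae_of_all _ ?_)
      (Continuous.intervalIntegrable (by have := continuous_linePoint; fun_prop) _ _)
    intro t ht
    have hl : ((1 / 2 : ℝ) : ℂ) + t * I = linePoint t := by rw [linePoint]; push_cast; ring
    have hwt := hw0 t ⟨ht.1.le, ht.2⟩
    have h4 : w t ≤ 1 / 4 := by
      simp only [hw]
      rw [div_le_iff₀ (by positivity)]
      nlinarith [sq_nonneg (2 * t - 3 * T)]
    simp only [hf]
    rw [quadWeight_line hT0, hl, norm_mul, norm_real, mul_comm]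
    rw [Real.norm_of_nonneg hwt]
    gcongr
  have hA := hhor T (.inl rfl)
  have hB := hhor (2 * T) (.inr rfl)
  have hI : I * E = A - B + I * D := by
    rw [smul_eq_mul, smul_eq_mul] at hrect
    linear_combination -hrect
  have hDE : ‖D‖ ≤ ‖E‖ + ‖A‖ + ‖B‖ := by
    have e3 : I * D = I * E - A + B := by rw [hI]; ring
    calc ‖D‖ = ‖I * D‖ := by rw [norm_mul, norm_I, one_mul]
      _ ≤ ‖I * E - A‖ + ‖B‖ := by rw [e3]; exact norm_add_le _ _
      _ ≤ ‖I * E‖ + ‖A‖ + ‖B‖ := by gcongr; exact norm_sub_le _ _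
      _ = _ := by rw [norm_mul, norm_I, one_mul]
  have hD6 : T / 6 ≤ ‖D‖ + (T / 9 + 5) := by
    have : ‖((T / 6 : ℝ) : ℂ)‖ ≤ ‖D‖ + ‖D - (T / 6 : ℝ)‖ := by
      rw [norm_sub_rev]
      have := norm_add_le D ((T / 6 : ℝ) - D)
      rwa [add_sub_cancel] at this
    rw [norm_real, Real.norm_of_nonneg (by positivity)] at this
    linarith
  linarith

/-! ### Mellin inversion and the theta-like series. -/

open MeasureTheory in
lemma integrableOn_cpow_mul_cexp {a z : ℂ} (ha : 0 < a.re) (hz : 0 < z.re) :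
    IntegrableOn (fun t : ℝ => (t : ℂ) ^ (a - 1) * exp (-(z * t))) (Set.Ioi 0) := by
  have h := integrableOn_rpow_mul_exp_neg_mul_rpow (s := a.re - 1) (p := 1) (b := z.re)
    (by linarith) one_pos hz
  refine Integrable.mono' h ?_ ?_
  · refine ContinuousOn.aestronglyMeasurable (fun t ht => ?_) measurableSet_Ioi
    have ht0 : (0 : ℝ) < t := ht
    refine ContinuousAt.continuousWithinAt ?_
    exact (continuousAt_ofReal_cpow_const _ _ (.inr ht0.ne')).mul (by fun_prop)
  · refine (ae_restrict_iff' measurableSet_Ioi).mpr (Eventually.of_forall fun t ht => ?_)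
    have ht0 : (0 : ℝ) < t := ht
    rw [norm_mul, norm_cpow_eq_rpow_re_of_pos ht0, norm_exp]
    simp

open MeasureTheory in
-- Both sides are holomorphic in z on the right half-plane and agree for real z > 1, a set that
-- accumulates at 1.
lemma integral_cpow_mul_cexp {a z : ℂ} (ha : 0 < a.re) (hz : 0 < z.re) :
    ∫ t : ℝ in Set.Ioi 0, (t : ℂ) ^ (a - 1) * exp (-(z * t)) = (1 / z) ^ a * Gamma a := by
  have hopen : IsOpen {z : ℂ | 0 < z.re} := isOpen_lt continuous_const continuous_re
  set F : ℂ → ℂ := fun z => ∫ t : ℝ in Set.Ioi 0, (t : ℂ) ^ (a - 1) * exp (-(z * t)) with hF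
  have hFd : ∀ z : ℂ, 0 < z.re → DifferentiableAt ℂ F z := by
    intro z₀ hz₀
    have hs : {z : ℂ | z₀.re / 2 < z.re} ∈ 𝓝 z₀ :=
      (isOpen_lt continuous_const continuous_re).mem_nhds (by
        simp only [Set.mem_ofPred_eq]; linarith)
    have hmeas : ∀ z : ℂ, 0 < z.re → AEStronglyMeasurable
        (fun t : ℝ => (t : ℂ) ^ (a - 1) * exp (-(z * t))) (volume.restrict (Set.Ioi 0)) :=
      fun z hz => (integrableOn_cpow_mul_cexp ha hz).aestronglyMeasurable
    have hint' : ∀ z : ℂ, 0 < z.re → IntegrableOn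
        (fun t : ℝ => (t : ℂ) ^ (a - 1) * (exp (-(z * t)) * (-t))) (Set.Ioi 0) := by
      intro z hz
      have := (integrableOn_cpow_mul_cexp (a := a + 1) (by simp; linarith) hz).neg
      refine this.congr_fun (fun t ht => ?_) measurableSet_Ioi
      have ht0 : (t : ℂ) ≠ 0 := ofReal_ne_zero.mpr (ne_of_gt ht)
      simp only [Pi.neg_apply, add_sub_cancel_right]
      rw [cpow_sub _ _ ht0, cpow_one]
      field_simp
    refine (hasDerivAt_integral_of_dominated_loc_of_deriv_le (F := fun z (t : ℝ) =>
      (t : ℂ) ^ (a - 1) * exp (-(z * t)))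
      (F' := fun z (t : ℝ) => (t : ℂ) ^ (a - 1) * (exp (-(z * t)) * (-t)))
      (bound := fun t : ℝ => ‖(t : ℂ) ^ (a - 1) * (exp (-(((z₀.re / 2 : ℝ) : ℂ) * t)) * (-t))‖)
      hs ?_ (integrableOn_cpow_mul_cexp ha hz₀) (hint' z₀ hz₀).aestronglyMeasurable ?_
      (hint' _ (by simpa using hz₀)).norm ?_).2.differentiableAt
    · filter_upwards [hopen.mem_nhds hz₀] with z hz using hmeas z hz
    · refine (ae_restrict_iff' measurableSet_Ioi).mpr (Eventually.of_forall fun t ht z hz => ?_)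
      have ht0 : (0 : ℝ) < t := ht
      have hz' : z₀.re / 2 < z.re := hz
      rw [norm_mul, norm_mul, norm_mul, norm_mul]
      gcongr ?_ * (?_ * ?_)
      rw [norm_exp, norm_exp, Real.exp_le_exp]
      simp only [neg_re, mul_re, ofReal_re, ofReal_im, mul_zero, sub_zero, neg_le_neg_iff]
      gcongr
    · refine (ae_restrict_iff' measurableSet_Ioi).mpr (Eventually.of_forall fun t ht z hz => ?_)
      refine HasDerivAt.const_mul _ ?_
      have : HasDerivAt (fun z : ℂ => -(z * t)) (-t) z := by
        simpa using (hasDerivAt_id z).mul_const (-(t : ℂ))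
      exact this.cexp
  have hA : AnalyticOnNhd ℂ F {z : ℂ | 0 < z.re} :=
    DifferentiableOn.analyticOnNhd (fun z hz => (hFd z hz).differentiableWithinAt) hopen
  have hB : AnalyticOnNhd ℂ (fun z : ℂ => (1 / z) ^ a * Gamma a) {z : ℂ | 0 < z.re} := by
    refine DifferentiableOn.analyticOnNhd (fun z hz => ?_) hopen
    have hz0 : z ≠ 0 := by rintro rfl; simp at hz
    have hsl : 1 / z ∈ slitPlane := by
      left
      rw [one_div, inv_re]
      exact div_pos hz (normSq_pos.mpr hz0)
    have hd : DifferentiableAt ℂ (fun z : ℂ => 1 / z) z := by fun_prop (disch := exact hz0)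
    exact ((hd.cpow_const hsl).mul_const _).differentiableWithinAt
  refine hA.eqOn_of_preconnected_of_frequently_eq hB (convex_halfSpace_re_gt 0).isPreconnected
    (z₀ := 1) (by simp) ?_ hz
  have htend : Tendsto (fun r : ℝ => (r : ℂ)) (𝓝[>] 1) (𝓝[≠] 1) := by
    refine tendsto_nhdsWithin_of_tendsto_nhds_of_eventually_within _ ?_ ?_
    · exact (continuous_ofReal.tendsto' 1 1 (by simp)).mono_left nhdsWithin_le_nhds
    · filter_upwards [self_mem_nhdsWithin] with r hr
      have : r ≠ 1 := ne_of_gt hr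
      simpa using this
  refine htend.frequently (Eventually.frequently ?_)
  filter_upwards [self_mem_nhdsWithin] with r hr
  have hr0 : (0 : ℝ) < r := zero_lt_one.trans hr
  exact integral_cpow_mul_exp_neg_mul_Ioi ha hr0

lemma exists_sq_mul_exp_le {η : ℝ} (hη : 0 < η) : ∃ C : ℝ, 0 < C ∧ ∀ y : ℝ,
    (1 + |y|) ^ 2 * Real.exp (-(η * |y|)) ≤ C * (1 + y ^ 2)⁻¹ := by
  -- From x⁴ / 4! ≤ e^x at x = η(1 + |y|), whose fourth power covers both quadratic factors.
  refine ⟨24 * Real.exp η / η ^ 4, by positivity, fun y => ?_⟩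
  have hy := abs_nonneg y
  have h1 := Real.pow_div_factorial_le_exp (x := η * (1 + |y|)) (by positivity) 4
  have h2 : (1 + y ^ 2) ≤ (1 + |y|) ^ 2 := by
    rw [← sq_abs y]; nlinarith
  have h3 : Real.exp (η * (1 + |y|)) = Real.exp η * Real.exp (η * |y|) := by
    rw [← Real.exp_add]; ring_nf
  rw [h3, div_le_iff₀ (by positivity)] at h1
  have h4 : ((Nat.factorial 4 : ℕ) : ℝ) = 24 := by norm_num [Nat.factorial]
  rw [h4] at h1
  rw [← div_eq_mul_inv, le_div_iff₀ (by positivity), Real.exp_neg, ← div_eq_mul_inv, div_mul_eq_mul_div,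
    div_le_iff₀ (Real.exp_pos _), div_mul_eq_mul_div, le_div_iff₀ (by positivity)]
  calc (1 + |y|) ^ 2 * (1 + y ^ 2) * η ^ 4 ≤ (1 + |y|) ^ 2 * (1 + |y|) ^ 2 * η ^ 4 := by gcongr
    _ = (η * (1 + |y|)) ^ 4 := by ring
    _ ≤ _ := h1
    _ = _ := by ring

lemma exists_norm_Gamma_mul_exp_le {θ : ℝ} (hθ : |θ| < Real.pi / 2) : ∃ C : ℝ, 0 < C ∧
    ∀ c y : ℝ, 1 / 4 ≤ c → c ≤ 3 / 2 →
      ‖Gamma (c + y * I)‖ * Real.exp (θ * y) ≤ C * (1 + y ^ 2)⁻¹ := by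
  obtain ⟨C₁, hC₁, h₁⟩ := exists_norm_Gamma_le_linear
  obtain ⟨C₂, hC₂, h₂⟩ := exists_sq_mul_exp_le (η := Real.pi / 2 - |θ|) (by linarith)
  refine ⟨C₁ * C₂, by positivity, fun c y hc hc' => ?_⟩
  have hG := h₁ (c + y * I) (by simpa using hc) (by simpa using hc')
  have him : (c + y * I : ℂ).im = y := by simp
  rw [him] at hG
  have hy := abs_nonneg y
  calc ‖Gamma (c + y * I)‖ * Real.exp (θ * y)
      ≤ (C₁ * (1 + |y|) * Real.exp (-(Real.pi * |y| / 2))) * Real.exp (|θ| * |y|) := by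
        exact mul_le_mul hG (Real.exp_le_exp.mpr (by rw [← abs_mul]; exact le_abs_self _))
          (Real.exp_pos _).le (by positivity)
    _ = C₁ * ((1 + |y|) * Real.exp (-((Real.pi / 2 - |θ|) * |y|))) := by
        rw [mul_assoc, ← Real.exp_add, mul_assoc]; congr 3; ring
    _ ≤ C₁ * ((1 + |y|) ^ 2 * Real.exp (-((Real.pi / 2 - |θ|) * |y|))) := by
        gcongr
        nlinarith
    _ ≤ C₁ * (C₂ * (1 + y ^ 2)⁻¹) := mul_le_mul_of_nonneg_left (h₂ y) hC₁.le
    _ = _ := by ring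

/-- The integrand of the inverse Mellin transform of `exp (-(exp lam) x)` at `x = 1`. -/
def gammaKernel (c : ℝ) (lam : ℂ) (y : ℝ) : ℂ :=
  Gamma (c + y * I) * exp (-((c + y * I) * lam))

lemma norm_gammaKernel (c : ℝ) (lam : ℂ) (y : ℝ) :
    ‖gammaKernel c lam y‖ =
      Real.exp (-(c * lam.re)) * (‖Gamma (c + y * I)‖ * Real.exp (lam.im * y)) := by
  rw [gammaKernel, norm_mul, norm_exp, mul_left_comm, ← Real.exp_add]
  congr 2
  simp
  ring

lemma continuous_gammaKernel {c : ℝ} (hc : 0 < c) (lam : ℂ) : Continuous (gammaKernel c lam) := by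
  unfold gammaKernel
  refine Continuous.mul ?_ (by fun_prop)
  rw [continuous_iff_continuousAt]
  intro y
  exact (analyticAt_Gamma_of_re_pos (s := c + y * I) (by simpa using hc)).continuousAt.comp
    (f := fun y : ℝ => (c + y * I : ℂ)) (by fun_prop)

open MeasureTheory in
lemma integrable_gammaKernel {c : ℝ} (hc : 1 / 4 ≤ c) (hc' : c ≤ 3 / 2) {lam : ℂ}
    (hl : |lam.im| < Real.pi / 2) : Integrable (gammaKernel c lam) := by
  obtain ⟨C, hC, h⟩ := exists_norm_Gamma_mul_exp_le hl
  refine (integrable_inv_one_add_sq.const_mul (Real.exp (-(c * lam.re)) * C)).mono'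
    (continuous_gammaKernel (by linarith) lam).aestronglyMeasurable
    (Eventually.of_forall fun y => ?_)
  rw [norm_gammaKernel, mul_assoc]
  exact mul_le_mul_of_nonneg_left (h c y hc hc') (Real.exp_pos _).le

lemma re_exp_pos {lam : ℂ} (hl : |lam.im| < Real.pi / 2) : 0 < (exp lam).re := by
  rw [exp_re]
  exact mul_pos (Real.exp_pos _) (Real.cos_pos_of_mem_Ioo (abs_lt.mp hl))

open MeasureTheory in
-- The kernel is the Mellin transform of t ↦ exp(−e^λ t) on a vertical line, and inversion is
-- evaluated at t = 1. The condition on Im λ gives Re e^λ > 0 and the logarithm −λ of e^{-λ}.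
lemma integral_gammaKernel {c : ℝ} (hc : 1 / 4 ≤ c) (hc' : c ≤ 3 / 2) {lam : ℂ}
    (hl : |lam.im| < Real.pi / 2) :
    ∫ y, gammaKernel c lam y = 2 * Real.pi * exp (-exp lam) := by
  have hz := re_exp_pos hl
  have hc0 : 0 < c := by linarith
  have hlog : log (1 / exp lam) = -lam := by
    rw [one_div, ← exp_neg, log_exp]
    · rw [neg_im]; linarith [(abs_lt.mp hl).2, Real.pi_pos]
    · rw [neg_im]; linarith [(abs_lt.mp hl).1, Real.pi_pos]
  have hmel : ∀ s : ℂ, 0 < s.re →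
      mellin (fun t : ℝ => exp (-(exp lam * t))) s = Gamma s * exp (-(s * lam)) := by
    intro s hs
    simp only [mellin, smul_eq_mul]
    rw [integral_cpow_mul_cexp hs hz, cpow_def_of_ne_zero (one_div_ne_zero (exp_ne_zero _)), hlog,
      mul_comm]
    congr 2
    ring
  have hline : ∀ y : ℝ, mellin (fun t : ℝ => exp (-(exp lam * t))) (c + y * I) =
      gammaKernel c lam y := fun y => hmel _ (by simpa using hc0)
  have hinv := mellinInv_mellin_eq c (fun t : ℝ => exp (-(exp lam * t))) one_pos
    (by simpa [MellinConvergent] using integrableOn_cpow_mul_cexp (a := c) (by simpa using hc0) hz)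
    (by
      unfold VerticalIntegrable
      simp only [hline]
      exact integrable_gammaKernel hc hc' hl)
    (by fun_prop)
  simp only [mellinInv, hline, ofReal_one, one_cpow, one_smul, mul_one] at hinv
  rw [← hinv, Complex.real_smul]
  push_cast
  have : (Real.pi : ℂ) ≠ 0 := ofReal_ne_zero.mpr Real.pi_ne_zero
  field_simp

lemma exp_neg_le_rpow {x p : ℝ} (hx : 0 < x) (hp : 0 < p) :
    Real.exp (-x) ≤ p ^ p * x ^ (-p) := by
  have h1 : (x / p) ^ p ≤ Real.exp x := by
    have h2 : x / p ≤ Real.exp (x / p) := by linarith [Real.add_one_le_exp (x / p)]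
    calc (x / p) ^ p ≤ Real.exp (x / p) ^ p := by gcongr
      _ = Real.exp x := by rw [← Real.exp_mul]; congr 1; field_simp
  have h3 : 0 < (x / p) ^ p := Real.rpow_pos_of_pos (by positivity) _
  rw [Real.exp_neg]
  calc (Real.exp x)⁻¹ ≤ ((x / p) ^ p)⁻¹ := by gcongr
    _ = _ := by
      rw [Real.div_rpow hx.le hp.le, inv_div, Real.rpow_neg hx.le, div_eq_mul_inv]

/-- With p = 5/8 + a/2, bounding e^{-x} by a multiple of x^{-p} leaves n^{a − 2p} = n^{-5/4}, which
is summable. The 5/8 need only lie strictly between 1/2, for convergence, and 3/4, for the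
contradiction in Hardy's theorem. -/
lemma exists_tsum_pow_mul_exp_le (a : ℕ) : ∃ C : ℝ, 0 < C ∧ ∀ b : ℝ, 0 < b → ∀ f : ℕ → ℂ, f 0 = 0 →
    (∀ n : ℕ, ‖f n‖ ≤ (n : ℝ) ^ a * Real.exp (-(b * (n : ℝ) ^ 2))) →
      ‖∑' n, f n‖ ≤ C * b ^ (-(5 / 8 + (a : ℝ) / 2)) := by
  set p : ℝ := 5 / 8 + a / 2 with hp
  have hp0 : 0 < p := by positivity
  have hs : Summable fun n : ℕ => (n : ℝ) ^ (-(5 / 4) : ℝ) :=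
    Real.summable_nat_rpow.mpr (by norm_num)
  have hS : 0 < ∑' n : ℕ, (n : ℝ) ^ (-(5 / 4) : ℝ) :=
    hs.tsum_pos (fun n => by positivity) 1 (by simp)
  refine ⟨p ^ p * ∑' n : ℕ, (n : ℝ) ^ (-(5 / 4) : ℝ), by positivity, fun b hb f hf0 hf => ?_⟩
  have hsum := (hs.mul_left (p ^ p * b ^ (-p))).hasSum
  rw [tsum_mul_left] at hsum
  refine (tsum_of_norm_bounded hsum fun n => ?_).trans_eq (by ring)
  rcases Nat.eq_zero_or_pos n with rfl | hn
  · rw [hf0, norm_zero]; positivity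
  · have hn0 : (0 : ℝ) < n := by exact_mod_cast hn
    refine (hf n).trans ?_
    have h1 := exp_neg_le_rpow (x := b * (n : ℝ) ^ 2) (by positivity) hp0
    have h2 : (b * (n : ℝ) ^ 2) ^ (-p) = b ^ (-p) * (n : ℝ) ^ (-(2 * p)) := by
      rw [Real.mul_rpow hb.le (by positivity), ← Real.rpow_natCast (n : ℝ) 2, ← Real.rpow_mul hn0.le]
      congr 2
      push_cast; ring
    have h3 : (n : ℝ) ^ a * (n : ℝ) ^ (-(2 * p)) = (n : ℝ) ^ (-(5 / 4) : ℝ) := by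
      rw [← Real.rpow_natCast, ← Real.rpow_add hn0, hp]
      congr 1
      ring
    calc (n : ℝ) ^ a * Real.exp (-(b * (n : ℝ) ^ 2))
        ≤ (n : ℝ) ^ a * (p ^ p * (b ^ (-p) * (n : ℝ) ^ (-(2 * p)))) := by
          rw [← h2]; gcongr
      _ = p ^ p * b ^ (-p) * ((n : ℝ) ^ a * (n : ℝ) ^ (-(2 * p))) := by ring
      _ = _ := by rw [h3]

/-- Shifting λ by 2 log n inserts the n-th Dirichlet term into the kernel, so each term is
integrated by the same inversion formula. -/
lemma mul_gammaKernel_add_log (hk : 1 < k) (a n : ℕ) (lam : ℂ) (y : ℝ) :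
    χ n * (n : ℂ) ^ a * gammaKernel (1 + a / 2) (lam + (2 * Real.log n : ℝ)) y =
      LSeries.term (χ ·) (2 + 2 * y * I) n * gammaKernel (1 + a / 2) lam y := by
  rcases eq_or_ne n 0 with rfl | hn
  · simp [character_zero hk]
  · have hn0 : (n : ℂ) ≠ 0 := Nat.cast_ne_zero.mpr hn
    have h1 : (n : ℂ) ^ a = exp (a * Real.log n) := by
      rw [exp_nat_mul, natCast_log, exp_log hn0]
    rw [LSeries.term_of_ne_zero hn, cpow_def_of_ne_zero hn0, ← natCast_log,
      div_eq_mul_inv (χ n), ← exp_neg, gammaKernel, gammaKernel, h1]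
    have h2 : exp (a * Real.log n) *
        exp (-((((1 + a / 2 : ℝ) : ℂ) + y * I) * (lam + (2 * Real.log n : ℝ)))) =
        exp (-(Real.log n * (2 + 2 * y * I))) * exp (-((((1 + a / 2 : ℝ) : ℂ) + y * I) * lam)) := by
      rw [← exp_add, ← exp_add]
      congr 1
      push_cast
      ring
    linear_combination (χ n * Gamma (((1 + a / 2 : ℝ) : ℂ) + y * I)) * h2

lemma norm_term_two_le (y : ℝ) (n : ℕ) :
    ‖LSeries.term (χ ·) (2 + 2 * y * I) n‖ ≤ ((n : ℝ) ^ 2)⁻¹ := by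
  rw [LSeries.norm_term_eq]
  split_ifs with hn
  · positivity
  · have : (2 + 2 * y * I : ℂ).re = 2 := by simp
    rw [this, div_eq_mul_inv, Real.rpow_ofNat]
    exact mul_le_of_le_one_left (by positivity) (χ.norm_le_one _)

open MeasureTheory in
-- On Re s = 2 the series converges absolutely and may be integrated termwise, which gives 2π ∑ χ(n)
-- n^a exp(−n² e^λ). Absolute values and the elementary series bound suffice.
lemma exists_norm_integral_gammaKernel_mul_LFunction_le (hk : 1 < k) {a : ℕ} (ha : a ≤ 1) :
    ∃ C : ℝ, 0 < C ∧ ∀ lam : ℂ, |lam.im| < Real.pi / 2 →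
      ‖∫ y : ℝ, gammaKernel (1 + a / 2) lam y * χ.LFunction (2 + 2 * y * I)‖ ≤
        C * (exp lam).re ^ (-(5 / 8 + (a : ℝ) / 2)) := by
  obtain ⟨C, hC, h⟩ := exists_tsum_pow_mul_exp_le a
  refine ⟨2 * Real.pi * C, by positivity, fun lam hl => ?_⟩
  have ha' : (a : ℝ) ≤ 1 := by exact_mod_cast ha
  have ha0 : (0 : ℝ) ≤ a := Nat.cast_nonneg a
  have hc : (1 : ℝ) / 4 ≤ 1 + a / 2 := by linarith
  have hc' : (1 : ℝ) + a / 2 ≤ 3 / 2 := by linarith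
  have hl' : ∀ n : ℕ, |(lam + (2 * Real.log n : ℝ)).im| < Real.pi / 2 := fun n => by
    rwa [add_im, ofReal_im, add_zero]
  set F : ℕ → ℝ → ℂ := fun n y =>
    χ n * (n : ℂ) ^ a * gammaKernel (1 + a / 2) (lam + (2 * Real.log n : ℝ)) y with hF
  have hFi : ∀ n, Integrable (F n) := fun n => (integrable_gammaKernel hc hc' (hl' n)).const_mul _
  have hFn : ∀ n y, ‖F n y‖ ≤ ((n : ℝ) ^ 2)⁻¹ * ‖gammaKernel (1 + a / 2) lam y‖ := by
    intro n y
    simp only [hF]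
    rw [mul_gammaKernel_add_log hk, norm_mul]
    gcongr
    exact norm_term_two_le y n
  have hsum : Summable fun n => ∫ y, ‖F n y‖ := by
    refine Summable.of_nonneg_of_le (fun n => integral_nonneg fun y => norm_nonneg _) (fun n => ?_)
      ((Real.summable_nat_pow_inv.mpr one_lt_two).mul_right
        (∫ y, ‖gammaKernel (1 + a / 2) lam y‖))
    rw [← integral_const_mul]
    exact integral_mono (hFi n).norm ((integrable_gammaKernel hc hc' hl).norm.const_mul _)
      fun y => hFn n y
  have hint := (hasSum_integral_of_summable_integral_norm hFi hsum).tsum_eq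
  have hL : ∀ y : ℝ, ∑' n, F n y =
      gammaKernel (1 + a / 2) lam y * χ.LFunction (2 + 2 * y * I) := by
    intro y
    rw [χ.LFunction_eq_LSeries (by simp), LSeries, mul_comm, ← tsum_mul_right]
    exact tsum_congr fun n => mul_gammaKernel_add_log hk a n lam y
  simp only [hL] at hint
  rw [← hint]
  have hval : ∀ n : ℕ, ∫ y, F n y =
      2 * Real.pi * (χ n * (n : ℂ) ^ a * exp (-exp (lam + (2 * Real.log n : ℝ)))) := by
    intro n
    simp only [hF]
    rw [integral_const_mul, integral_gammaKernel hc hc' (hl' n)]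
    ring
  rw [tsum_congr hval, tsum_mul_left, norm_mul]
  have h2 : ‖(2 * Real.pi : ℂ)‖ = 2 * Real.pi := by
    simp [abs_of_pos Real.pi_pos]
  rw [h2, mul_assoc (2 * Real.pi)]
  refine mul_le_mul_of_nonneg_left (h _ (re_exp_pos hl) _ ?_ fun n => ?_) (by positivity)
  · simp [character_zero hk]
  · rcases eq_or_ne n 0 with rfl | hn
    · simp only [Nat.cast_zero, character_zero hk, zero_mul, norm_zero]; positivity
    have hn0 : (n : ℂ) ≠ 0 := Nat.cast_ne_zero.mpr hn
    have he : exp (lam + (2 * Real.log n : ℝ)) = exp lam * ((n : ℝ) ^ 2 : ℝ) := by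
      rw [exp_add]
      congr 1
      push_cast
      rw [two_mul, exp_add, exp_log hn0, sq]
    rw [norm_mul, norm_mul, norm_pow, Complex.norm_natCast, norm_exp, he, neg_re, re_mul_ofReal]
    gcongr
    exact mul_le_of_le_one_left (by positivity) (χ.norm_le_one _)

/-! ### Decay of the completed function and the shift of the contour. -/

lemma parity_le_one (χ : DirichletCharacter ℂ k) : parity χ ≤ 1 := by
  unfold parity; split_ifs <;> simp

/-- Γ((s + a)/2) decays like e^{-π|t|/4} up to a power. For |α| < π/4 a positive exponential rate
remains, which absorbs this power and the linear growth of L. -/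
lemma exists_norm_xi_mul_exp_le (hk : 1 < k) (hχ : χ.IsPrimitive) {α : ℝ}
    (hα : |α| < Real.pi / 4) : ∃ C : ℝ, 0 < C ∧ ∀ s : ℂ, 1 / 2 ≤ s.re → s.re ≤ 2 →
      ‖xi χ s‖ * Real.exp (α * s.im) ≤ C * (1 + s.im ^ 2)⁻¹ := by
  obtain ⟨C₁, hC₁, h₁⟩ := exists_norm_Gamma_le_linear
  obtain ⟨C₂, hC₂, h₂⟩ := exists_sq_mul_exp_le (η := Real.pi / 4 - |α|) (by linarith)
  have hk0 : (0 : ℝ) < k := by exact_mod_cast NeZero.pos k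
  set B := Real.exp (|Real.log (k / Real.pi)|) with hB
  refine ⟨B * C₁ * (4 * k) * C₂, by positivity, fun s hs hs' => ?_⟩
  have ht := abs_nonneg s.im
  have ha : (parity χ : ℝ) ≤ 1 := by exact_mod_cast parity_le_one χ
  have ha0 : (0 : ℝ) ≤ parity χ := Nat.cast_nonneg _
  have hre : ((s + parity χ) / 2).re = (s.re + parity χ) / 2 := by simp
  have him : ((s + parity χ) / 2).im = s.im / 2 := by simp
  have hG := h₁ ((s + parity χ) / 2) (by rw [hre]; linarith) (by rw [hre]; linarith)
  rw [him, abs_div, abs_two] at hG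
  have hL : ‖χ.LFunction s‖ ≤ 4 * k * (1 + |s.im|) := by
    have h3 := norm_LFunction_le hk (ne_one_of_isPrimitive hk hχ) hs
    have h4 := norm_le_add_abs_im (by linarith) hs'
    calc _ ≤ 2 * k * ‖s‖ := h3
      _ ≤ 2 * k * (2 + |s.im|) := by gcongr
      _ ≤ _ := by nlinarith [mul_nonneg hk0.le ht]
  have hE : ‖exp ((s - 1 / 2) / 2 * Real.log (k / Real.pi))‖ ≤ B := by
    rw [norm_exp, hB, Real.exp_le_exp, re_mul_ofReal]
    have h5 : ((s - 1 / 2) / 2).re = (s.re - 1 / 2) / 2 := by simp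
    rw [h5]
    calc _ ≤ (s.re - 1 / 2) / 2 * |Real.log (k / Real.pi)| :=
          mul_le_mul_of_nonneg_left (le_abs_self _) (by linarith)
      _ ≤ 1 * |Real.log (k / Real.pi)| := by gcongr; linarith
      _ = _ := one_mul _
  have hph : ‖phase χ‖ = 1 := norm_exp_ofReal_mul_I _
  have hexp : Real.exp (α * s.im) ≤ Real.exp (|α| * |s.im|) := by
    rw [← abs_mul]; exact Real.exp_le_exp.mpr (le_abs_self _)
  rw [xi, norm_mul, norm_mul, norm_mul, hph, one_mul]
  calc _ ≤ B * (C₁ * (1 + |s.im| / 2) * Real.exp (-(Real.pi * (|s.im| / 2) / 2))) *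
        (4 * k * (1 + |s.im|)) * Real.exp (|α| * |s.im|) := by
        refine mul_le_mul (mul_le_mul (mul_le_mul hE hG ?_ ?_) hL ?_ ?_) hexp ?_ ?_ <;> positivity
    _ = B * C₁ * (4 * k) * ((1 + |s.im| / 2) * (1 + |s.im|) *
        (Real.exp (-(Real.pi * (|s.im| / 2) / 2)) * Real.exp (|α| * |s.im|))) := by ring
    _ = B * C₁ * (4 * k) * ((1 + |s.im| / 2) * (1 + |s.im|) *
        Real.exp (-((Real.pi / 4 - |α|) * |s.im|))) := by
        rw [← Real.exp_add]; congr 3; ring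
    _ ≤ B * C₁ * (4 * k) * ((1 + |s.im|) ^ 2 * Real.exp (-((Real.pi / 4 - |α|) * |s.im|))) := by
        rw [sq]; gcongr; linarith
    _ ≤ B * C₁ * (4 * k) * (C₂ * (1 + s.im ^ 2)⁻¹) :=
        mul_le_mul_of_nonneg_left (h₂ _) (by positivity)
    _ = _ := by ring

open MeasureTheory in
/-- A vertical integral can be moved across a strip in which the integrand decays. -/
lemma integral_vertical_eq {f : ℂ → ℂ} {a b C : ℝ} (hab : a ≤ b)
    (hd : ∀ s : ℂ, a ≤ s.re → s.re ≤ b → DifferentiableAt ℂ f s)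
    (hf : ∀ s : ℂ, a ≤ s.re → s.re ≤ b → ‖f s‖ ≤ C * (1 + s.im ^ 2)⁻¹) :
    Integrable (fun t : ℝ => f (a + t * I)) ∧
      ∫ t : ℝ, f (a + t * I) = ∫ t : ℝ, f (b + t * I) := by
  have hint : ∀ x : ℝ, a ≤ x → x ≤ b → Integrable (fun t : ℝ => f (x + t * I)) := by
    intro x hx hx'
    refine (integrable_inv_one_add_sq.const_mul C).mono' ?_ (Eventually.of_forall fun t => ?_)
    · refine Continuous.aestronglyMeasurable (continuous_iff_continuousAt.mpr fun t => ?_)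
      exact (hd (x + t * I) (by simpa) (by simpa)).continuousAt.comp
        (f := fun t : ℝ => (x + t * I : ℂ)) (by fun_prop)
    · simpa using hf (x + t * I) (by simpa) (by simpa)
  refine ⟨hint a le_rfl hab, ?_⟩
  have hlim : ∀ x : ℝ, a ≤ x → x ≤ b → Tendsto (fun T : ℝ => ∫ t in (-T)..T, f (x + t * I)) atTop
      (𝓝 (∫ t : ℝ, f (x + t * I))) := fun x hx hx' =>
    intervalIntegral_tendsto_integral (hint x hx hx') tendsto_neg_atTop_atBot tendsto_id
  have hrect : ∀ T : ℝ, ‖(∫ t in (-T)..T, f (b + t * I)) - ∫ t in (-T)..T, f (a + t * I)‖ ≤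
      2 * (C * (1 + T ^ 2)⁻¹ * |b - a|) := by
    intro T
    have h := integral_boundary_rect_eq_zero_of_differentiableOn f ⟨a, -T⟩ ⟨b, T⟩
      (fun s hs => (hd s ?_ ?_).differentiableWithinAt)
    · simp only [smul_eq_mul] at h
      have hb : ∀ τ : ℝ, ‖∫ x in a..b, f (x + τ * I)‖ ≤ C * (1 + τ ^ 2)⁻¹ * |b - a| := by
        intro τ
        refine intervalIntegral.norm_integral_le_of_norm_le_const fun x hx => ?_
        rw [Set.uIoc_of_le hab] at hx
        simpa using hf (x + τ * I) (by simpa using hx.1.le) (by simpa using hx.2)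
      have h1 := hb T
      have h2 := hb (-T)
      rw [neg_sq] at h2
      have h3 : (∫ t in (-T)..T, f (b + t * I)) - ∫ t in (-T)..T, f (a + t * I) =
          I * ((∫ x in a..b, f (x + (-T : ℝ) * I)) - ∫ x in a..b, f (x + T * I)) := by
        linear_combination (-I) * h + ((∫ t in (-T)..T, f (b + t * I)) -
          ∫ t in (-T)..T, f (a + t * I)) * I_mul_I
      rw [h3, norm_mul, norm_I, one_mul]
      exact (norm_sub_le _ _).trans (by linarith)
    · have := hs.1; simp only [Set.uIcc_of_le hab] at this; exact this.1
    · have := hs.1; simp only [Set.uIcc_of_le hab] at this; exact this.2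
  have h0 : Tendsto (fun T : ℝ => 2 * (C * (1 + T ^ 2)⁻¹ * |b - a|)) atTop (𝓝 0) := by
    have h1 : Tendsto (fun T : ℝ => (1 + T ^ 2)⁻¹) atTop (𝓝 0) :=
      (tendsto_atTop_add_const_left _ 1 (tendsto_pow_atTop two_ne_zero)).inv_tendsto_atTop
    simpa using ((h1.const_mul C).mul_const |b - a|).const_mul 2
  have h1 := tendsto_nhds_unique ((hlim b hab le_rfl).sub (hlim a le_rfl hab))
    (squeeze_zero_norm hrect h0)
  exact (sub_eq_zero.mp h1).symm

lemma xi_two_mul_exp (α t : ℝ) :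
    xi χ (2 + t * I) * exp (-(I * α * (2 + t * I - 1 / 2))) =
      phase χ * exp ((parity χ + 1 / 2) / 2 * ((Real.log (Real.pi / k) : ℝ) + 2 * α * I)) *
        (gammaKernel (1 + parity χ / 2) ((Real.log (Real.pi / k) : ℝ) + 2 * α * I) (t / 2) *
          χ.LFunction (2 + t * I)) := by
  have hlog : Real.log (k / Real.pi) = -Real.log (Real.pi / k) := by
    rw [← Real.log_inv, inv_div]
  have hw : (2 + t * I + parity χ) / 2 =
      ((1 + parity χ / 2 : ℝ) : ℂ) + ((t / 2 : ℝ) : ℂ) * I := by push_cast; ring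
  rw [xi, hlog, gammaKernel, hw]
  have he : exp ((2 + t * I - 1 / 2) / 2 * ((-Real.log (Real.pi / k) : ℝ) : ℂ)) *
      exp (-(I * α * (2 + t * I - 1 / 2))) =
      exp ((parity χ + 1 / 2) / 2 * ((Real.log (Real.pi / k) : ℝ) + 2 * α * I)) *
        exp (-((((1 + parity χ / 2 : ℝ) : ℂ) + ((t / 2 : ℝ) : ℂ) * I) *
          ((Real.log (Real.pi / k) : ℝ) + 2 * α * I))) := by
    rw [← exp_add, ← exp_add]
    congr 1
    push_cast
    ring
  linear_combination (phase χ * Gamma (((1 + parity χ / 2 : ℝ) : ℂ) + ((t / 2 : ℝ) : ℂ) * I) *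
    χ.LFunction (2 + t * I)) * he

/-- The real part is x sin 2δ, and Jordan's inequality gives sin 2δ ≥ 4δ/π ≥ δ. -/
lemma le_re_exp_log_add {x δ : ℝ} (hx : 0 < x) (hδ : 0 < δ) (hδ' : δ ≤ Real.pi / 4) :
    x * δ ≤ (exp ((Real.log x : ℝ) + 2 * ((Real.pi / 4 - δ : ℝ) : ℂ) * I)).re := by
  rw [exp_re]
  have h1 : ((Real.log x : ℝ) + 2 * ((Real.pi / 4 - δ : ℝ) : ℂ) * I).re = Real.log x := by simp
  have h2 : ((Real.log x : ℝ) + 2 * ((Real.pi / 4 - δ : ℝ) : ℂ) * I).im =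
      Real.pi / 2 - 2 * δ := by simp; ring
  rw [h1, h2, Real.exp_log hx, Real.cos_pi_div_two_sub]
  have h3 := Real.mul_le_sin (x := 2 * δ) (by linarith) (by linarith)
  gcongr
  refine le_trans ?_ h3
  rw [div_mul_eq_mul_div, le_div_iff₀ Real.pi_pos]
  nlinarith [Real.pi_lt_four]

lemma xi_linePoint_mul_exp (α t : ℝ) :
    xi χ (linePoint t) * exp (-(I * α * (linePoint t - 1 / 2))) =
      xi χ (linePoint t) * (Real.exp (α * t) : ℝ) := by
  push_cast
  congr 2
  rw [linePoint]
  linear_combination (-(α : ℂ) * t) * I_mul_I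

open MeasureTheory in
-- On the critical line exp(−iα(s − 1/2)) is the real weight e^{αt}. Moved to Re s = 2 the integral
-- becomes the kernel integral with λ = log(π/k) + 2iα, and α = π/4 − δ gives Re e^λ ≥ (π/k)δ.
lemma exists_norm_integral_xi_mul_exp_le (hk : 1 < k) (hχ : χ.IsPrimitive) :
    ∃ C : ℝ, 0 < C ∧ ∀ δ : ℝ, 0 < δ → δ ≤ Real.pi / 4 →
      Integrable (fun t : ℝ => xi χ (linePoint t) * (Real.exp ((Real.pi / 4 - δ) * t) : ℝ)) ∧
      ‖∫ t : ℝ, xi χ (linePoint t) * (Real.exp ((Real.pi / 4 - δ) * t) : ℝ)‖ ≤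
        C * δ ^ (-(5 / 8 + (parity χ : ℝ) / 2)) := by
  have h1 := ne_one_of_isPrimitive hk hχ
  have hk0 : (0 : ℝ) < k := by exact_mod_cast NeZero.pos k
  obtain ⟨C, hC, h⟩ := exists_norm_integral_gammaKernel_mul_LFunction_le (χ := χ) hk
    (parity_le_one χ)
  have hπk : 0 < Real.pi / k := by positivity
  refine ⟨Real.exp ((parity χ + 1 / 2) / 2 * Real.log (Real.pi / k)) *
    (2 * (C * (Real.pi / k) ^ (-(5 / 8 + (parity χ : ℝ) / 2)))), by positivity,
    fun δ hδ hδ' => ?_⟩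
  set α : ℝ := Real.pi / 4 - δ with hα
  have hα' : |α| < Real.pi / 4 := by rw [abs_lt]; constructor <;> linarith [Real.pi_pos]
  obtain ⟨B, hB, hb⟩ := exists_norm_xi_mul_exp_le hk hχ hα'
  have hv := integral_vertical_eq (a := 1 / 2) (b := 2) (C := B)
    (f := fun s => xi χ s * exp (-(I * α * (s - 1 / 2)))) (by norm_num)
    (fun s hs hs' => by
      have hG := (analyticAt_Gamma_of_re_pos
        (re_add_parity_pos (χ := χ) (s := s) (by linarith))).differentiableAt
      have hL := (DirichletCharacter.differentiable_LFunction h1) s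
      have hG' : DifferentiableAt ℂ (fun s => Gamma ((s + parity χ) / 2)) s :=
        hG.comp s (f := fun s : ℂ => (s + parity χ) / 2) (by fun_prop)
      unfold xi
      fun_prop)
    (fun s hs hs' => by
      rw [norm_mul, norm_exp]
      have : (-(I * α * (s - 1 / 2))).re = α * s.im := by simp
      rw [this]
      exact hb s hs hs')
  have hlp : ∀ t : ℝ, ((1 / 2 : ℝ) : ℂ) + t * I = linePoint t := fun t => by
    rw [linePoint]; push_cast; rfl
  simp only [hlp, xi_linePoint_mul_exp] at hv
  refine ⟨hv.1, ?_⟩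
  rw [hv.2]
  set lam : ℂ := (Real.log (Real.pi / k) : ℝ) + 2 * α * I with hlam
  have hint : ∫ t : ℝ, xi χ (((2 : ℝ) : ℂ) + t * I) *
      exp (-(I * α * (((2 : ℝ) : ℂ) + t * I - 1 / 2))) =
      phase χ * exp ((parity χ + 1 / 2) / 2 * lam) *
        (2 * ∫ y : ℝ, gammaKernel (1 + parity χ / 2) lam y * χ.LFunction (2 + 2 * y * I)) := by
    have h2 := Measure.integral_comp_div
      (fun y : ℝ => gammaKernel (1 + parity χ / 2) lam y * χ.LFunction (2 + 2 * y * I)) 2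
    rw [abs_two, Complex.real_smul, ofReal_ofNat] at h2
    rw [← h2, ← integral_const_mul]
    congr 1
    funext t
    rw [ofReal_ofNat, xi_two_mul_exp]
    congr 4
    push_cast
    ring
  have hre : ((parity χ + 1 / 2) / 2 * lam).re =
      (parity χ + 1 / 2) / 2 * Real.log (Real.pi / k) := by
    have : ((parity χ + 1 / 2) / 2 : ℂ) = (((parity χ + 1 / 2) / 2 : ℝ) : ℂ) := by push_cast; rfl
    rw [this, re_ofReal_mul, hlam]
    simp
  have hlim : |lam.im| < Real.pi / 2 := by
    have : lam.im = 2 * α := by simp [hlam]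
    rw [this, abs_mul, abs_two]
    linarith
  have hx := le_re_exp_log_add hπk hδ hδ'
  rw [hint, norm_mul, norm_mul, norm_mul, norm_exp, hre, phase, norm_exp_ofReal_mul_I, one_mul,
    norm_ofNat]
  have hfin := (h lam hlim).trans (mul_le_mul_of_nonneg_left
    (Real.rpow_le_rpow_of_nonpos (by positivity) hx
      (neg_nonpos.mpr (by positivity : 0 ≤ 5 / 8 + (parity χ : ℝ) / 2))) hC.le)
  rw [Real.mul_rpow hπk.le hδ.le] at hfin
  calc _ ≤ Real.exp ((parity χ + 1 / 2) / 2 * Real.log (Real.pi / k)) * (2 * (C *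
        ((Real.pi / k) ^ (-(5 / 8 + (parity χ : ℝ) / 2)) * δ ^ (-(5 / 8 + (parity χ : ℝ) / 2))))) := by
        gcongr
    _ = _ := by ring

/-! ### Hardy's theorem. -/

lemma exists_abs_eq_mul {W : ℝ → ℝ} (hW : Continuous W) {T : ℝ} (h : ∀ t, T ≤ t → W t ≠ 0) :
    ∃ ε : ℝ, |ε| = 1 ∧ ∀ t, T ≤ t → |W t| = ε * W t := by
  rcases lt_or_gt_of_ne (h T le_rfl) with h0 | h0
  · refine ⟨-1, by simp, fun t ht => ?_⟩
    rw [abs_of_nonpos, neg_one_mul]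
    by_contra! hpos
    obtain ⟨u, hu, hu0⟩ := intermediate_value_Icc ht hW.continuousOn ⟨h0.le, hpos.le⟩
    exact h u hu.1 hu0
  · refine ⟨1, by simp, fun t ht => ?_⟩
    rw [abs_of_nonneg, one_mul]
    by_contra! hneg
    obtain ⟨u, hu, hu0⟩ := intermediate_value_Icc' ht hW.continuousOn ⟨hneg.le, h0.le⟩
    exact h u hu.1 hu0

lemma norm_xi_linePoint (χ : DirichletCharacter ℂ k) (t : ℝ) :
    ‖xi χ (linePoint t)‖ =
      ‖Gamma ((1 / 4 + parity χ / 2 : ℝ) + (t / 2 : ℝ) * I)‖ * ‖χ.LFunction (linePoint t)‖ := by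
  have h1 : ((linePoint t - 1 / 2) / 2 * (Real.log (k / Real.pi) : ℝ)).re = 0 := by
    rw [re_mul_ofReal, linePoint]; simp
  have h2 : (linePoint t + parity χ) / 2 =
      (1 / 4 + parity χ / 2 : ℝ) + (t / 2 : ℝ) * I := by
    rw [linePoint]; push_cast; ring
  rw [xi, norm_mul, norm_mul, norm_mul, norm_exp, h1, Real.exp_zero, phase,
    norm_exp_ofReal_mul_I, h2, one_mul, one_mul]

lemma continuous_xi_linePoint (hχ : χ ≠ 1) : Continuous fun t => xi χ (linePoint t) := by
  rw [continuous_iff_continuousAt]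
  intro t
  have hG := (analyticAt_Gamma_of_re_pos (re_add_parity_pos (χ := χ) (s := linePoint t)
    (by rw [linePoint_re]; norm_num))).continuousAt
  have hl := continuous_linePoint
  have hG' : ContinuousAt (fun t => Gamma ((linePoint t + parity χ) / 2)) t :=
    hG.comp (f := fun t => (linePoint t + parity χ) / 2) (by fun_prop)
  have hL := (continuous_LFunction hχ).comp hl
  unfold xi
  exact ((by fun_prop : Continuous fun t : ℝ => phase χ *
    exp ((linePoint t - 1 / 2) / 2 * Real.log (k / Real.pi))).continuousAt.mul hG').mul
      hL.continuousAt

open MeasureTheory in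
/-- If the completed `L`-function has constant sign on the critical line from some point on, its
absolute moments are controlled by the oscillatory integral over the whole line. -/
lemma exists_integral_norm_xi_mul_exp_le (hk : 1 < k) (hχ : χ.IsPrimitive) {T₀ : ℝ} (hT₀ : 0 ≤ T₀)
    (h : ∀ t, T₀ ≤ t → χ.LFunction (linePoint t) ≠ 0) :
    ∃ C : ℝ, 0 < C ∧ ∀ δ : ℝ, 0 < δ → δ ≤ Real.pi / 4 → ∀ a b : ℝ, T₀ ≤ a → a ≤ b →
      ∫ t in a..b, ‖xi χ (linePoint t)‖ * Real.exp ((Real.pi / 4 - δ) * t) ≤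
        C * (δ ^ (-(5 / 8 + (parity χ : ℝ) / 2)) + 1) := by
  have h1 := ne_one_of_isPrimitive hk hχ
  obtain ⟨C, hC, hb⟩ := exists_norm_integral_xi_mul_exp_le hk hχ
  set W : ℝ → ℝ := fun t => (xi χ (linePoint t)).re with hWdef
  have hWc : Continuous W := continuous_re.comp (continuous_xi_linePoint h1)
  have hxW : ∀ t, xi χ (linePoint t) = (W t : ℂ) := xi_line_real hk hχ
  have hnW : ∀ t, ‖xi χ (linePoint t)‖ = |W t| := fun t => by rw [hxW, norm_real, Real.norm_eq_abs]
  obtain ⟨ε, hε, hW⟩ := exists_abs_eq_mul hWc (T := T₀) fun t ht h0 => h t ht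
    ((xi_eq_zero_iff (by rw [linePoint_re]; norm_num)).mp (by rw [hxW, h0, ofReal_zero]))
  have hWi : Integrable W := by
    have := (hb (Real.pi / 4) (by positivity) le_rfl).1
    simp only [sub_self, zero_mul, Real.exp_zero, ofReal_one, mul_one] at this
    exact this.re
  set D := Real.exp (Real.pi / 4 * T₀) * ∫ t, |W t| with hD
  have hD0 : 0 ≤ D := mul_nonneg (Real.exp_pos _).le (integral_nonneg fun t => abs_nonneg _)
  refine ⟨C + D, by linarith, fun δ hδ hδ' a b ha hab => ?_⟩
  obtain ⟨hi, hn⟩ := hb δ hδ hδ'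
  set g : ℝ → ℝ := fun t => W t * Real.exp ((Real.pi / 4 - δ) * t) with hg
  have hxg : ∀ t, xi χ (linePoint t) * (Real.exp ((Real.pi / 4 - δ) * t) : ℝ) = (g t : ℂ) := by
    intro t; rw [hxW, hg]; push_cast; rfl
  simp only [hxg] at hi hn
  have hgi : Integrable g := hi.re
  rw [integral_complex_ofReal, norm_real, Real.norm_eq_abs] at hn
  have habs : ∀ t, |g t| = |W t| * Real.exp ((Real.pi / 4 - δ) * t) := fun t => by
    rw [hg, abs_mul, Real.abs_exp]
  simp only [hnW, ← habs]
  have s1 : ∫ t in a..b, |g t| ≤ ∫ t in Set.Ioi T₀, |g t| := by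
    rw [intervalIntegral.integral_of_le hab]
    exact setIntegral_mono_set hgi.abs.integrableOn (Eventually.of_forall fun t => abs_nonneg _)
      (Eventually.of_forall fun t ht => ha.trans_lt ht.1)
  have s2 : ∫ t in Set.Ioi T₀, |g t| = ε * ∫ t in Set.Ioi T₀, g t := by
    rw [← integral_const_mul]
    refine setIntegral_congr_fun measurableSet_Ioi fun t ht => ?_
    change |g t| = ε * g t
    rw [habs, hW t (le_of_lt ht), mul_assoc]
  have s3 : ∫ t in Set.Ioi T₀, g t = (∫ t, g t) - ∫ t in Set.Iic T₀, g t := by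
    rw [← intervalIntegral.integral_Iic_add_Ioi hgi.integrableOn hgi.integrableOn (b := T₀)]
    ring
  -- The part below T₀ is bounded uniformly in δ: the weight there is at most e^{πT₀/4}, and `xi` is
  -- integrable on the line, as the case δ = π/4 shows.
  have s4 : |∫ t in Set.Iic T₀, g t| ≤ D := by
    have i1 : |∫ t in Set.Iic T₀, g t| ≤ ∫ t in Set.Iic T₀, |g t| := abs_integral_le_integral_abs
    refine i1.trans ?_
    have i2 : ∫ t in Set.Iic T₀, |g t| ≤
        ∫ t in Set.Iic T₀, Real.exp (Real.pi / 4 * T₀) * |W t| := by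
      refine setIntegral_mono_on hgi.abs.integrableOn (hWi.abs.const_mul _).integrableOn
        measurableSet_Iic fun t ht => ?_
      have ht' : t ≤ T₀ := ht
      rw [habs, mul_comm]
      refine mul_le_mul_of_nonneg_right (Real.exp_le_exp.mpr ?_) (abs_nonneg _)
      calc (Real.pi / 4 - δ) * t ≤ (Real.pi / 4 - δ) * T₀ :=
            mul_le_mul_of_nonneg_left ht' (by linarith)
        _ ≤ Real.pi / 4 * T₀ := by gcongr; linarith
    refine i2.trans ?_
    rw [integral_const_mul, hD]
    refine mul_le_mul_of_nonneg_left ?_ (Real.exp_pos _).le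
    exact setIntegral_le_integral hWi.abs (Eventually.of_forall fun t => abs_nonneg _)
  have s5 : ε * ∫ t in Set.Ioi T₀, g t ≤ |∫ t, g t| + |∫ t in Set.Iic T₀, g t| := by
    refine (le_abs_self _).trans ?_
    rw [abs_mul, hε, one_mul, s3]
    exact abs_sub _ _
  have hpow : 0 ≤ δ ^ (-(5 / 8 + (parity χ : ℝ) / 2)) := Real.rpow_nonneg hδ.le _
  nlinarith [mul_nonneg hD0 hpow]

/-- The weight e^{πt/4} cancels the decay of Gamma, and δ = 1/T costs at most e^{-2} on [T, 2T].
Replacing (t/2)^p by T^p costs a factor 2, because t/(2T) lies in [1/2, 1] and p ≤ 1. -/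
lemma exists_le_norm_xi_mul_exp (χ : DirichletCharacter ℂ k) : ∃ c : ℝ, 0 < c ∧
    ∀ T : ℝ, 3 ≤ T → ∀ t ∈ Set.Icc T (2 * T),
      c * T ^ ((parity χ : ℝ) / 2 - 1 / 4) * ‖χ.LFunction (linePoint t)‖ ≤
        ‖xi χ (linePoint t)‖ * Real.exp ((Real.pi / 4 - T⁻¹) * t) := by
  obtain ⟨c, hc, h⟩ := exists_le_norm_Gamma (parity χ) (parity_le_one χ)
  refine ⟨c / 2 * Real.exp (-2), by positivity, fun T hT t ht => ?_⟩
  have hT0 : 0 < T := by linarith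
  have ha : (parity χ : ℝ) ≤ 1 := by exact_mod_cast parity_le_one χ
  have hG := h (t / 2) (by linarith [ht.1])
  set p : ℝ := (parity χ : ℝ) / 2 - 1 / 4 with hp
  have hpow : T ^ p / 2 ≤ (t / 2) ^ p := by
    have hr : t / 2 = T * (t / (2 * T)) := by field_simp
    have hr0 : 1 / 2 ≤ t / (2 * T) := by rw [le_div_iff₀ (by positivity)]; linarith [ht.1]
    have hr1 : t / (2 * T) ≤ 1 := by rw [div_le_one (by positivity)]; exact ht.2
    rw [hr, Real.mul_rpow hT0.le (by linarith), div_eq_mul_inv]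
    refine mul_le_mul_of_nonneg_left ?_ (Real.rpow_nonneg hT0.le _)
    have := Real.rpow_le_rpow_of_exponent_ge (by linarith) hr1 (by linarith : p ≤ 1)
    rw [Real.rpow_one] at this
    linarith
  have hexp : Real.exp (-2) ≤
      Real.exp (-(Real.pi * (t / 2) / 2)) * Real.exp ((Real.pi / 4 - T⁻¹) * t) := by
    rw [← Real.exp_add, Real.exp_le_exp]
    have : T⁻¹ * t ≤ 2 := by rw [inv_mul_le_iff₀ hT0]; linarith [ht.2]
    linarith
  have ht0 : 0 ≤ c * (t / 2) ^ p := mul_nonneg hc.le (Real.rpow_nonneg (by linarith [ht.1]) _)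
  rw [norm_xi_linePoint]
  calc c / 2 * Real.exp (-2) * T ^ p * ‖χ.LFunction (linePoint t)‖
      = c * (T ^ p / 2) * Real.exp (-2) * ‖χ.LFunction (linePoint t)‖ := by ring
    _ ≤ c * (t / 2) ^ p *
        (Real.exp (-(Real.pi * (t / 2) / 2)) * Real.exp ((Real.pi / 4 - T⁻¹) * t)) *
          ‖χ.LFunction (linePoint t)‖ := by gcongr
    _ = c * (t / 2) ^ p * Real.exp (-(Real.pi * (t / 2) / 2)) * ‖χ.LFunction (linePoint t)‖ *
        Real.exp ((Real.pi / 4 - T⁻¹) * t) := by ring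
    _ ≤ _ := by gcongr

open MeasureTheory in
/-- Hardy's theorem for `L(s, χ)` on the upper half of the critical line. -/
lemma infinite_zeros_pos (hk : 1 < k) (hχ : χ.IsPrimitive) :
    {t : ℝ | 0 < t ∧ χ.LFunction (linePoint t) = 0}.Infinite := by
  intro hfin
  have h1 := ne_one_of_isPrimitive hk hχ
  obtain ⟨M, hM⟩ := hfin.bddAbove
  have hT₀ : (0 : ℝ) ≤ |M| + 1 := by positivity
  obtain ⟨A, hA, hup⟩ := exists_integral_norm_xi_mul_exp_le hk hχ hT₀ fun t ht h0 => by
    have := hM ⟨by linarith [abs_nonneg M], h0⟩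
    linarith [le_abs_self M]
  obtain ⟨c, hc, hlow⟩ := exists_le_norm_xi_mul_exp χ
  obtain ⟨B, hB⟩ := exists_le_integral_norm_LFunction hk h1
  set p : ℝ := (parity χ : ℝ) / 2 - 1 / 4 with hp
  have ha0 : (0 : ℝ) ≤ parity χ := Nat.cast_nonneg _
  -- The upper bound at δ = 1/T is of order T^{5/8 + a/2} = T^p · T^{7/8}, while the lower bound is
  -- T^p times a quantity of order T; T^p cancels.
  have key : ∀ T : ℝ, 3 ≤ T → |M| + 1 ≤ T → c * (2 / 9 * T - B) ≤ 2 * A * T ^ (7 / 8 : ℝ) := by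
    intro T hT hT'
    have hT0 : 0 < T := by linarith
    have hTp : 0 < T ^ p := Real.rpow_pos_of_pos hT0 p
    have hinv : T⁻¹ ≤ Real.pi / 4 := by
      have : T⁻¹ ≤ 3⁻¹ := by gcongr
      linarith [Real.pi_gt_three]
    have u := hup T⁻¹ (by positivity) hinv T (2 * T) hT' (by linarith)
    have hLc := (continuous_LFunction h1).comp continuous_linePoint
    have hXc := continuous_xi_linePoint h1
    have l : ∫ t in T..(2 * T), c * T ^ p * ‖χ.LFunction (linePoint t)‖ ≤
        ∫ t in T..(2 * T), ‖xi χ (linePoint t)‖ * Real.exp ((Real.pi / 4 - T⁻¹) * t) := by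
      refine intervalIntegral.integral_mono_on (by linarith) ?_ ?_ (hlow T hT)
      · exact (hLc.norm.const_mul _).intervalIntegrable _ _
      · exact (hXc.norm.mul (by fun_prop)).intervalIntegrable _ _
    rw [intervalIntegral.integral_const_mul] at l
    have l2 := mul_le_mul_of_nonneg_left (hB T hT) (by positivity : 0 ≤ c * T ^ p)
    have e1 : T⁻¹ ^ (-(5 / 8 + (parity χ : ℝ) / 2)) = T ^ p * T ^ (7 / 8 : ℝ) := by
      rw [Real.inv_rpow hT0.le, ← Real.rpow_neg hT0.le, ← Real.rpow_add hT0, hp]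
      congr 1
      ring
    have e2 : 1 ≤ T ^ p * T ^ (7 / 8 : ℝ) := by
      rw [← Real.rpow_add hT0]
      exact Real.one_le_rpow (by linarith) (by rw [hp]; linarith)
    rw [e1] at u
    have e3 : A * (T ^ p * T ^ (7 / 8 : ℝ) + 1) ≤ A * (2 * (T ^ p * T ^ (7 / 8 : ℝ))) := by
      gcongr; linarith
    have := l2.trans (l.trans (u.trans e3))
    refine le_of_mul_le_mul_left ?_ hTp
    linarith
  -- Taking T = x⁸ turns T^{7/8} into x⁷. The last summand makes 2cx exceed 9(2A + c|B|), which
  -- contradicts the inequality in `key`.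
  set x : ℝ := 3 + |M| + 9 * (2 * A + c * |B|) / (2 * c) with hx
  have hM0 := abs_nonneg M
  have hB0 := abs_nonneg B
  have hr0 : 0 ≤ 9 * (2 * A + c * |B|) / (2 * c) := by positivity
  have hx1 : 1 ≤ x := by linarith
  have hx0 : 0 < x := by linarith
  have hx8 : x ≤ x ^ 8 := le_self_pow₀ hx1 (by norm_num)
  have hk8 := key (x ^ 8) (by linarith) (by linarith)
  have e7 : (x ^ 8) ^ (7 / 8 : ℝ) = x ^ 7 := by
    rw [← Real.rpow_natCast, ← Real.rpow_natCast, ← Real.rpow_mul hx0.le]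
    norm_num
  rw [e7] at hk8
  have h7 : 1 ≤ x ^ 7 := one_le_pow₀ hx1
  have hcx : 9 * (2 * A + c * |B|) < 2 * c * x := by
    have : 9 * (2 * A + c * |B|) / (2 * c) < x := by linarith
    rwa [div_lt_iff₀' (by positivity)] at this
  have hBx : c * B ≤ c * |B| * x ^ 7 :=
    (mul_le_mul_of_nonneg_left (le_abs_self B) hc.le).trans
      (le_mul_of_one_le_right (by positivity) h7)
  have := mul_lt_mul_of_pos_right hcx (by positivity : 0 < x ^ 7)
  have e8 : x ^ 8 = x * x ^ 7 := by ring
  rw [e8] at hk8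
  linarith

lemma isPrimitive_inv (hχ : χ.IsPrimitive) : χ⁻¹.IsPrimitive := by
  rw [DirichletCharacter.isPrimitive_def] at hχ ⊢
  have h : DirichletCharacter.conductorSet χ⁻¹ = DirichletCharacter.conductorSet χ := by
    have key : ∀ ψ : DirichletCharacter ℂ k, DirichletCharacter.conductorSet ψ ⊆
        DirichletCharacter.conductorSet ψ⁻¹ := by
      rintro ψ d ⟨hd, φ, hφ⟩
      exact ⟨hd, φ⁻¹, by rw [hφ, map_inv]⟩
    exact Set.Subset.antisymm (by simpa using key χ⁻¹) (key χ)
  rw [DirichletCharacter.conductor, h]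
  exact hχ

/-- Conjugation turns zeros of L(s, χ⁻¹) on the upper half of the line into zeros of L(s, χ) on the
lower half, and χ⁻¹ is again primitive. -/
lemma infinite_zeros_neg (hk : 1 < k) (hχ : χ.IsPrimitive) :
    {t : ℝ | t < 0 ∧ χ.LFunction (linePoint t) = 0}.Infinite := by
  have h1 := ne_one_of_isPrimitive hk hχ
  have h := infinite_zeros_pos hk (isPrimitive_inv hχ)
  have himg : (fun t : ℝ => -t) '' {t : ℝ | 0 < t ∧ χ⁻¹.LFunction (linePoint t) = 0} ⊆
      {t : ℝ | t < 0 ∧ χ.LFunction (linePoint t) = 0} := by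
    rintro _ ⟨t, ⟨ht, ht0⟩, rfl⟩
    refine ⟨by simpa using ht, ?_⟩
    rw [LFunction_inv_eq_conj h1, map_eq_zero] at ht0
    have : linePoint (-t) = conj (linePoint t) := by
      apply Complex.ext <;> simp [linePoint]
    rw [this, ht0]
  exact (h.image neg_injective.injOn).mono himg

end DirichletZeros
end

/-! ### Assembly. -/

open DirichletZeros in
theorem mainTheorem3 {k : ℕ} [NeZero k] (hk : 1 < k) (χ : DirichletCharacter ℂ k)
    (hχ : χ.IsPrimitive) :
    -- infinitely many zeros on the upper and on the lower half of the critical line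
    ({t : ℝ | 0 < t ∧ χ.LFunction (linePoint t) = 0}.Infinite ∧
      {t : ℝ | t < 0 ∧ χ.LFunction (linePoint t) = 0}.Infinite) ∧
    -- the exact equation is satisfied precisely at the zeros of odd order on the line
    (∀ t ℓ : ℝ, HasArgLimit χ t ℓ →
      ((∃ n : ℤ, IsSolution χ n t) ↔ Odd (analyticOrderNatAt χ.LFunction (linePoint t)))) ∧
    -- uniqueness for every index
    (∀ (n : ℤ) (t t' : ℝ), IsSolution χ n t → IsSolution χ n t' → t = t') ∧
    -- unique solvability in terms of the existence of the limit
    (UniquelySolvable χ ↔ ArgLimitExists χ ∧ SimpleOnLine χ) ∧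
    ∃ n₀ : ℤ,
      -- counting
      (ArgLimitExists χ → ∀ T : ℝ, 0 < T →
        lineCountPos χ T = stripCountPos χ T ∧
        lineCountNeg χ T = stripCountNeg χ T ∧
        (χ.LFunction (linePoint T) ≠ 0 → ∀ ℓ : ℝ, HasArgLimit χ T ℓ →
          (lineCountPos χ T : ℝ) = thetaRS k (parity χ) T / Real.pi + ℓ / Real.pi
            - (gauss χ).arg / (2 * Real.pi) + (parity χ : ℝ) / 4 + n₀) ∧
        (χ.LFunction (linePoint 0) ≠ 0 → χ.LFunction (linePoint (-T)) ≠ 0 →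
          ∀ ℓ : ℝ, HasArgLimit χ (-T) ℓ →
          (lineCountNeg χ T : ℝ) = thetaRS k (parity χ) T / Real.pi - ℓ / Real.pi
            + (gauss χ).arg / (2 * Real.pi) - (parity χ : ℝ) / 4 - n₀)) ∧
      -- enumeration of all zeros of the critical strip by the exact equation
      (UniquelySolvable χ → ∃ t : ℤ → ℝ,
        StrictMono t ∧
        (∀ n : ℤ, 0 < t n ↔ 1 ≤ n) ∧
        (∀ (n : ℤ) (τ : ℝ), IsSolution χ (n - n₀) τ ↔ τ = t n) ∧
        (∀ s : ℂ, 0 < s.re → s.re < 1 → (χ.LFunction s = 0 ↔ ∃ n : ℤ, s = linePoint (t n))) ∧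
        (∀ n : ℤ, analyticOrderNatAt χ.LFunction (linePoint (t n)) = 1) ∧
        (∀ T : ℝ, 0 < T →
          lineCountPos χ T = {n : ℤ | 0 < t n ∧ t n < T}.ncard ∧
          lineCountNeg χ T = {n : ℤ | -T < t n ∧ t n < 0}.ncard)) := by
  have h1 := ne_one_of_isPrimitive hk hχ
  have hpos := infinite_zeros_pos hk hχ
  have hneg := infinite_zeros_neg hk hχ
  refine ⟨⟨hpos, hneg⟩, fun t ℓ h => exists_index_iff_odd hk hχ h.noZerosRight,
    fun n t t' h h' => h.unique hk hχ h', ⟨fun h => h.argLimitExists_and_simpleOnLine hk hχ,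
      fun h => uniquelySolvable_of_simple hk hχ hpos hneg h.1 h.2⟩, ?_⟩
  by_cases hA : ArgLimitExists χ
  · have hA' := (argLimitExists_iff hk hχ).mp hA
    obtain ⟨ε, hε, hgap⟩ := exists_gap h1
    obtain ⟨n₀, hn₀⟩ := exists_heightArg_gap_eq hk hχ hA' (hgap ε hε le_rfl)
    refine ⟨n₀, fun _ T hT => ⟨lineCountPos_eq hk hχ hA' T, lineCountNeg_eq hk hχ hA' T, ?_, ?_⟩,
      fun hU => ?_⟩
    · intro h0 ℓ hℓ
      have h2 := heightArg_sub_eq_lineCountPos hk hχ hA' hε hgap hT h0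
      rw [hn₀, hℓ.heightArg_eq, totalArg] at h2
      have hpi := Real.pi_ne_zero
      field_simp
      linarith
    · intro hz0 h0 ℓ hℓ
      have h2 := heightArg_sub_eq_lineCountNeg hk hχ hA' hε hgap hT hz0 h0
      rw [hn₀, hℓ.heightArg_eq, totalArg, thetaRS_neg] at h2
      have hpi := Real.pi_ne_zero
      field_simp
      linarith
    · exact exists_enumeration hk hχ hU hA' (hU.argLimitExists_and_simpleOnLine hk hχ).2 hε hgap hn₀
  · exact ⟨0, fun h => absurd h hA,
      fun hU => absurd (hU.argLimitExists_and_simpleOnLine hk hχ).1 hA⟩
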